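/- **Setting.** Let $\omega=e^{2\pi i/3}$, $\lambda_j(z)=z\omega^j$ ($j=1,2,3$), $\Lambda(z)=\operatorname{diag}(\lambda_1,\lambda_2,\lambda_3)$, and let $\Sigma=\{z\in\mathbb C:\operatorname{Re}\lambda_j(z)=\operatorname{Re}\lambda_l(z)\text{ for some }j\ne l\}$ (six rays from $0$, of arguments $\pi\nu/3$). For each ray, oriented outwards, the subscripts $+$ and $-$ denote the limits from the sectors on its left and right. Let $u_0:\mathbb R\to\mathbb R$ be $C^\infty$ with $u_0^{(k)}(x)=O((1+|x|)^{-4})$ for $0\le k\le 4$ and $1-u_0''>0$. Put $q_0=(1-u_0'')^{1/3}$, $y_0(x)=x-\int_x^\infty(q_0-1)\,d\xi$ and $$U=\frac{q_0'}{3q_0}\begin{pmatrix}0&1-\omega^2&1-\omega\\1-\omega&0&1-\omega^2\\1-\omega^2&1-\omega&0\end{pmatrix}.$$ For $z\notin\Sigma$ consider bounded continuous solutions $m(\cdot,z):\mathbb R\to\mathbb C^{3\times3}$ of $$m_{jl}(x,z)=\delta_{jl}+\int_{\infty_{jl}}^x e^{(\lambda_j-\lambda_l)(y_0(x)-y_0(\xi))}\,(Um)_{jl}(\xi,z)\,d\xi,\qquad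 \infty_{jl}=\begin{cases}+\infty&\operatorname{Re}\lambda_j\ge\operatorname{Re}\lambda_l,\\-\infty&\operatorname{Re}\lambda_j<\operatorname{Re}\lambda_l.\end{cases}\tag{1}$$ *Data.* Let $S_0:\Sigma\setminus\{0\}\to\mathbb C^{3\times3}$, and let finitely many distinct points $z_n\in\mathbb C\setminus\Sigma$, indices $l_n\neq j_n$ and constants $v_n\in\mathbb C$ be given; let $Z=\{z_n\}$. For $y\in\mathbb R$, $t\ge0$, a matrix function $M$ satisfies the *jump and residue conditions* at $(y,t)$ if it is analytic in $\mathbb C\setminus(\Sigma\cup Z)$, has limits $M_\pm$ at all points of $\Sigma\setminus\{0\}$ with $$M_+=M_-\,e^{y\Lambda+t\Lambda^{-1}}S_0\,e^{-y\Lambda-t\Lambda^{-1}},$$ and if at $z_n$ all columns but the $l_n$-th are analytic, while $$\lim_{z\to z_n}(z-z_n)M^{(l_n)}(z)=M^{(j_n)}(z_n)\,v_n\,e^{y(\lambda_{j_n}-\lambda_{l_n})(z_n)+t(\lambda_{j_n}^{-1}-\lambda_{l_n}^{-1})(z_n)}.$$ The data are *the scattering data of $u_0$* if for each $z\in\mathbb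 C\setminus(\Sigma\cup Z)$ equation (1) has a solution $m(\cdot,z)$, and for each $x$ the function $m(x,\cdot)$ satisfies the jump and residue conditions at $(y_0(x),0)$. The *RH problem* at $(y,t)$ is: find $M$ that satisfies the jump and residue conditions at $(y,t)$, has a limit at $z=0$ from each sector, and satisfies $M=I+O(1/z)$ as $z\to\infty$. **Theorem.** Let the above be the scattering data of $u_0$. Suppose that for all $y\in\mathbb R$, $t\ge0$ the RH problem has a unique solution $\hat M(y,t,\cdot)$ (unique as a function on $\mathbb C\setminus(\Sigma\cup Z)$), and that $\hat M$ depends on the parameters classically: for every $\varepsilon>0$ the map $(y,t)\mapsto\hat M(y,t,\cdot)$ is $C^2$ on $\mathbb R\times[0,\infty)$ for the uniform norm on $\{z\notin\Sigma:\operatorname{dist}(z,Z)\ge\varepsilon\}$, and it and its derivatives of order $\le2$ are bounded on each set $[a,\infty)\times[0,T]$. Suppose that there is $\hat q(y,t)>0$ with $\hat q\to1$ as $y\to+\infty$ for each $t\ge 0$, such that $$\lim_{z\to0,\ z\notin\Sigma}\hat M(y,t,z)=\begin{pmatrix}\alpha&\beta&\bar\beta\\\bar\beta&\alpha&\beta\\\beta&\bar\beta&\alpha\end{pmatrix},\qquad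 \alpha=\tfrac13\Bigl(\hat q+1+\tfrac1{\hat q}\Bigr),\quad \beta=\tfrac13\Bigl(\hat q+\omega+\tfrac{\omega^2}{\hat q}\Bigr).$$ Then: (i) for all $y\in\mathbb R$, $t\ge0$ (with one-sided $t$-derivative at $t=0$), the derivatives below exist and $$\Bigl(\frac{\hat q_y}{\hat q}\Bigr)_t=\hat q^2-\frac1{\hat q};$$ (ii) there is $x(y,t)$ ($y\in\mathbb R$, $t\ge0$), which is unique, with $\partial x/\partial y=1/\hat q$ and $x(y,t)-y\to0$ as $y\to+\infty$; it is differentiable in $t$, and $y\mapsto x(y,t)$ is a bijection of $\mathbb R$ for each $t\ge0$. The functions $u,q$ defined by $u(x(y,t),t)=\partial x/\partial t(y,t)$ and $q(x(y,t),t)=\hat q(y,t)$ satisfy, for $x\in\mathbb R$, $t>0$, $$q_t=-(uq)_x,\qquad u_{xx}=1-q^3,\tag{2}$$ and hence $$u_{txx}-3u_x+3u_xu_{xx}+uu_{xxx}=0\tag{3}$$ (with $u_{txx}$ understood as $\partial_t(u_{xx})$). Moreover, (2) and (3) are equivalent for arbitrary functions $u$ and $q>0$ with $u_{xx}=1-q^3$,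 both in the sense that the derivatives involved exist and the equations hold for $x\in\mathbb R$, $t>0$; (iii) $u(x,0)=u_0(x)$ for all $x\in\mathbb R$. -/

import Mathlib

open Filter Topology Set
open scoped BoundedContinuousFunction ContDiff

noncomputable section

namespace ShortWave

/-- Complex `3 × 3` matrices; the index `j : Fin 3` stands for the mathematical index `j + 1`. -/
abbrev Mat : Type := Matrix (Fin 3) (Fin 3) ℂ

/-- The primitive cube root of unity `exp (2πi/3)`. -/
def omega : ℂ := Complex.exp (2 * (Real.pi : ℂ) * Complex.I / 3)

/-- The eigenvalues `λ₁ = ω z`, `λ₂ = ω² z`, `λ₃ = z`. -/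
def lam (j : Fin 3) (z : ℂ) : ℂ := z * omega ^ ((j : ℕ) + 1)

/-- The contour: the points where two of the `λ`'s have equal real parts
(six rays from the origin, including the origin). -/
def contour : Set ℂ := {z | ∃ j l : Fin 3, j ≠ l ∧ (lam j z).re = (lam l z).re}

/-- The open ray of direction `exp (iπν/3)`. -/
def ray (ν : ℤ) : Set ℂ :=
  {z | ∃ r : ℝ, 0 < r ∧ z = (r : ℂ) * Complex.exp (((Real.pi / 3 * (ν : ℝ) : ℝ) : ℂ) * Complex.I)}

/-- The open sector `πν/3 < arg z < π(ν+1)/3`. It lies to the left of `ray ν` (oriented outwards),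
and `sector (ν - 1)` lies to the right of it. -/
def sector (ν : ℤ) : Set ℂ :=
  {z | ∃ r θ : ℝ, 0 < r ∧ Real.pi / 3 * (ν : ℝ) < θ ∧ θ < Real.pi / 3 * ((ν : ℝ) + 1) ∧
    z = (r : ℂ) * Complex.exp ((θ : ℂ) * Complex.I)}

/-! ### The initial data and the direct problem -/

/-- Admissible initial data: smooth, sufficiently decaying at infinity together with the first
derivatives, and with `1 - u₀'' > 0`. -/
structure Admissible (u₀ : ℝ → ℝ) : Prop where
  smooth : ContDiff ℝ ∞ u₀
  decay : ∀ k : ℕ, k ≤ 4 → ∃ C : ℝ, ∀ x : ℝ, (1 + |x|) ^ 4 * |iteratedDeriv k u₀ x| ≤ C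
  pos : ∀ x : ℝ, 0 < 1 - iteratedDeriv 2 u₀ x

/-- `q₀ = (1 - u₀'')^{1/3}`. -/
def q₀ (u₀ : ℝ → ℝ) (x : ℝ) : ℝ := (1 - iteratedDeriv 2 u₀ x) ^ (1 / 3 : ℝ)

/-- `y(x) = x - ∫_x^∞ (q₀ - 1)`. -/
def y₀ (u₀ : ℝ → ℝ) (x : ℝ) : ℝ := x - ∫ ξ in Ioi x, (q₀ u₀ ξ - 1)

/-- The potential of the `x`-equation of the Lax pair at `t = 0`. -/
def potential (u₀ : ℝ → ℝ) (x : ℝ) : Mat :=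
  ((deriv (q₀ u₀) x / (3 * q₀ u₀ x) : ℝ) : ℂ) •
    !![0, 1 - omega ^ 2, 1 - omega;
       1 - omega, 0, 1 - omega ^ 2;
       1 - omega ^ 2, 1 - omega, 0]

/-- The integrand `exp((λ_j - λ_l)(y(x) - y(ξ))) (U m)_{jl}(ξ)`. -/
def kernelTerm (u₀ : ℝ → ℝ) (z : ℂ) (m : ℝ → Mat) (j l : Fin 3) (x ξ : ℝ) : ℂ :=
  Complex.exp ((lam j z - lam l z) * ((y₀ u₀ x - y₀ u₀ ξ : ℝ) : ℂ)) *
    (potential u₀ ξ * m ξ) j l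

open scoped Classical in
/-- `m` is a (bounded continuous) solution of the system of Fredholm integral equations
`m_{jl}(x) = δ_{jl} + ∫_{∞_{jl}}^x exp((λ_j - λ_l)(y(x) - y(ξ))) (U m)_{jl}(ξ) dξ`, where
`∞_{jl} = +∞` if `Re λ_j ≥ Re λ_l` and `∞_{jl} = -∞` otherwise. -/
def SolvesIntegralEquation (u₀ : ℝ → ℝ) (z : ℂ) (m : ℝ → Mat) : Prop :=
  Continuous m ∧ (∃ C : ℝ, ∀ x j l, ‖m x j l‖ ≤ C) ∧
  ∀ (x : ℝ) (j l : Fin 3),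
    m x j l = (1 : Mat) j l +
      if (lam l z).re ≤ (lam j z).re then
        -∫ ξ in Ioi x, kernelTerm u₀ z m j l x ξ
      else
        ∫ ξ in Iic x, kernelTerm u₀ z m j l x ξ

/-! ### The Riemann–Hilbert problem -/

/-- Data of the Riemann–Hilbert problem: a matrix function on the contour and finitely many
residue parameters. The `k`-th pole is a pole of column `col k` only, and its residue is
proportional, with constant `coef k`, to column `src k`. -/
structure RHData where
  S₀ : ℂ → Mat
  n : ℕ
  pole : Fin n → ℂ
  col : Fin n → Fin 3
  src : Fin n → Fin 3
  coef : Fin n → ℂ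
  pole_injective : Function.Injective pole
  pole_notMem : ∀ k, pole k ∉ contour
  src_ne_col : ∀ k, src k ≠ col k

/-- The domain of the solution: off the contour and off the poles. -/
def RHData.domain (D : RHData) : Set ℂ := (contour ∪ range D.pole)ᶜ

/-- The exponents `y λ_j(z) + t λ_j(z)⁻¹`. -/
def phase (y t : ℝ) (z : ℂ) (j : Fin 3) : ℂ := (y : ℂ) * lam j z + (t : ℂ) * (lam j z)⁻¹

/-- The jump matrix `e^{yΛ + tΛ⁻¹} S₀ e^{-yΛ - tΛ⁻¹}`. -/
def RHData.jump (D : RHData) (y t : ℝ) (z : ℂ) : Mat :=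
  Matrix.diagonal (fun j => Complex.exp (phase y t z j)) * D.S₀ z *
    Matrix.diagonal (fun j => Complex.exp (-phase y t z j))

/-- `M` is piecewise meromorphic, takes continuous boundary values on both sides of each ray,
and satisfies the jump condition `M₊ = M₋ S(y,t,·)` and the residue conditions. -/
structure JumpAndResidue (D : RHData) (y t : ℝ) (M : ℂ → Mat) : Prop where
  analytic : ∀ i j, DifferentiableOn ℂ (fun z => M z i j) D.domain
  jump : ∀ (ν : ℤ) (z : ℂ), z ∈ ray ν → ∃ Mp Mm : Mat,
    Tendsto M (𝓝[sector ν] z) (𝓝 Mp) ∧ Tendsto M (𝓝[sector (ν - 1)] z) (𝓝 Mm) ∧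
      Mp = Mm * D.jump y t z
  regular_columns : ∀ (k : Fin D.n) (i j : Fin 3), j ≠ D.col k →
    AnalyticAt ℂ (fun z => M z i j) (D.pole k)
  residue : ∀ (k : Fin D.n) (i : Fin 3),
    Tendsto (fun z => (z - D.pole k) * M z i (D.col k)) (𝓝[≠] (D.pole k))
      (𝓝 (M (D.pole k) i (D.src k) * D.coef k *
        Complex.exp (phase y t (D.pole k) (D.src k) - phase y t (D.pole k) (D.col k))))

/-- `D` is the scattering data determined by `u₀`: off the contour and the poles the integral
equations have a solution `m(x, z)`, and `D` records its jumps and its residues. -/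
def IsScatteringData (u₀ : ℝ → ℝ) (D : RHData) : Prop :=
  ∃ m : ℝ → ℂ → Mat,
    (∀ z ∈ D.domain, SolvesIntegralEquation u₀ z (fun x => m x z)) ∧
    ∀ x : ℝ, JumpAndResidue D (y₀ u₀ x) 0 (m x)

/-- `M` solves the Riemann–Hilbert problem with parameters `(y, t)`: jump and residue conditions,
existence of boundary values at the origin (the vertex of the contour), and the normalization
`M = I + O(1/z)` as `z → ∞`. -/
structure IsRHSolution (D : RHData) (y t : ℝ) (M : ℂ → Mat) : Prop where
  jumpAndResidue : JumpAndResidue D y t M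
  origin : ∀ ν : ℤ, ∃ A : Mat, Tendsto M (𝓝[sector ν] 0) (𝓝 A)
  normalization : ∃ C R : ℝ, ∀ z ∈ D.domain, R ≤ ‖z‖ →
    ∀ i j, ‖M z i j - (1 : Mat) i j‖ ≤ C / ‖z‖

/-- `M` is the unique solution (as a function on the domain). -/
def IsUniqueRHSolution (D : RHData) (y t : ℝ) (M : ℂ → Mat) : Prop :=
  IsRHSolution D y t M ∧
    ∀ M' : ℂ → Mat, IsRHSolution D y t M' → ∀ z ∈ D.domain, M' z = M z

/-- The points of the domain at distance at least `ε` from the poles. -/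
def RHData.away (D : RHData) (ε : ℝ) : Set ℂ :=
  {z | z ∉ contour ∧ ∀ k, ε ≤ dist z (D.pole k)}

/-- The closed half-plane `t ≥ 0` in the `(y, t)`-plane. -/
def halfPlane : Set (ℝ × ℝ) := {p | 0 ≤ p.2}

/-- Classical dependence on the parameters: away from the poles, `(y, t) ↦ M(y, t, ·)` is twice
continuously differentiable on `t ≥ 0` with respect to the uniform norm in `z`, with derivatives
bounded on every set `y ≥ a`, `0 ≤ t ≤ T`. -/
def ClassicalDependence (D : RHData) (M : ℝ → ℝ → ℂ → Mat) : Prop :=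
  ∀ ε : ℝ, 0 < ε → ∀ i j : Fin 3, ∃ F : ℝ × ℝ → (↥(D.away ε) →ᵇ ℂ),
    (∀ p ∈ halfPlane, ∀ z : ↥(D.away ε), F p z = M p.1 p.2 z i j) ∧
    ContDiffOn ℝ 2 F halfPlane ∧
    ∀ a T : ℝ, ∃ K : ℝ, ∀ p ∈ halfPlane, a ≤ p.1 → p.2 ≤ T → ∀ k : ℕ, k ≤ 2 →
      ‖iteratedFDerivWithin ℝ k F halfPlane p‖ ≤ K

/-- `α = (q + 1 + 1/q)/3`. -/
def alpha (q : ℝ) : ℂ := (((q + 1 + q⁻¹) / 3 : ℝ) : ℂ)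

/-- `β = (q + ω + ω²/q)/3`. -/
def beta (q : ℝ) : ℂ := ((q : ℂ) + omega + omega ^ 2 * ((q⁻¹ : ℝ) : ℂ)) / 3

/-- The circulant matrix built from `α`, `β` and the conjugate of `β`. -/
def structured (q : ℝ) : Mat :=
  !![alpha q, beta q, star (beta q);
     star (beta q), alpha q, beta q;
     beta q, star (beta q), alpha q]

/-! ### The nonlinear equations -/

/-- The system `q_t = -(uq)_x`, `u_xx = 1 - q³` for `x ∈ ℝ`, `t > 0`, in the classical sense. -/
def SolvesSystem (u q : ℝ → ℝ → ℝ) : Prop :=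
  ∀ x t : ℝ, 0 < t →
    DifferentiableAt ℝ (fun ξ => u ξ t) x ∧ DifferentiableAt ℝ (fun ξ => q ξ t) x ∧
    HasDerivAt (fun s => q x s) (-deriv (fun ξ => u ξ t * q ξ t) x) t ∧
    HasDerivAt (deriv (fun ξ => u ξ t)) (1 - q x t ^ 3) x

/-- The equation `u_txx - 3 u_x + 3 u_x u_xx + u u_xxx = 0` for `x ∈ ℝ`, `t > 0`, in the classical
sense, with `u_txx` the `t`-derivative of `u_xx`. -/
def SolvesEquation (u : ℝ → ℝ → ℝ) : Prop :=
  ∀ x t : ℝ, 0 < t →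
    DifferentiableAt ℝ (fun ξ => u ξ t) x ∧
    DifferentiableAt ℝ (deriv (fun ξ => u ξ t)) x ∧
    DifferentiableAt ℝ (iteratedDeriv 2 (fun ξ => u ξ t)) x ∧
    DifferentiableAt ℝ (fun s => iteratedDeriv 2 (fun ξ => u ξ s) x) t ∧
    deriv (fun s => iteratedDeriv 2 (fun ξ => u ξ s) x) t
      - 3 * deriv (fun ξ => u ξ t) x
      + 3 * deriv (fun ξ => u ξ t) x * iteratedDeriv 2 (fun ξ => u ξ t) x
      + u x t * iteratedDeriv 3 (fun ξ => u ξ t) x = 0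

end ShortWave

end

/-! ### Equivalence of the first-order system and the scalar equation -/

namespace ShortWave

/-! The engine is unique solvability. If X satisfies the jump and residue conditions of the RH
problem, has sectorial limits at 0 and decays like 1/z, then M + X is a second solution, so X = 0.
Dividing by z - z₀ extends this: a bounded X with one zero vanishes, and so does an X of linear
growth with two zeros (`eq_zero_of_decay`, `eq_zero_of_bounded`, `eq_zero_of_linear_growth`). In
particular M is invertible off the contour and the poles.

Differentiating the conditions in a parameter shows that M_y + zMJ and M_t + z⁻¹MJ⁻¹ satisfy them
again, where Λ = zJ (`DifferentiableFamily.jumpAndResidue`). Comparison with M yields a Lax pair M_y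
= z[J, M] + CM and M_t = z⁻¹(AM - MJ⁻¹) (`lax_y`, `lax_t`). The value G of M at z = 0 determines the
coefficients: C = G_y G⁻¹ and A = GJ⁻¹G⁻¹. Since G = exp((log q)K) for a constant circulant K, one
has C = (q_y/q)K, and equality of the mixed derivatives of M becomes (q_y/q)_t = q² - 1/q
(`tzitzeica`).

At t = 0 the direct solution m is shown to solve the RH problem. Two gauge transformations of the
integral equation give m = I + O(1/z) at infinity and m = G(q₀) + O(z) at 0 (`exists_large_bound`,
`exists_small_bound`). Uniqueness identifies m with M, hence q(y₀(x), 0) = q₀(x).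

It remains to make the change of variables x(y,t) converge. Put φ = q_t/q, so that φ_y = q² - 1/q.
Then (q²/2 + 1/q)_t = (φ²/2)_y, an energy law. The energy at t = 0 beyond y is O(y⁻⁶), so ∫φ(y,s)²
ds is O(y⁻⁶). As φ is Lipschitz in t, this improves to the pointwise bound |φ|³ = O(y⁻⁶), so φ =
O(y⁻²) is integrable at +∞ (`exists_abs_φ_le_inv_sq`). Therefore x = y - ∫_y^∞(1/q - 1) and its
t-derivative u = ∫_y^∞ φ/q exist. The same law bounds the energy to the left of 0; as 1/q plus the
energy density is at least 1/2, x → -∞ as y → -∞, which gives bijectivity (`tendsto_xOf_atBot`).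

In the variable x the relations read u_x = -φ and u_xx = 1 - q³, and q_t = -(uq)_x is the chain
rule. At t = 0, u and u₀ have the same second derivative and the same limits at +∞, hence agree. -/

theorem SolvesSystem.solvesEquation {w p : ℝ → ℝ → ℝ}
    (hw : ∀ ξ t : ℝ, 0 < t → 0 < p ξ t ∧ iteratedDeriv 2 (fun η => w η t) ξ = 1 - p ξ t ^ 3)
    (h : SolvesSystem w p) : SolvesEquation w := by
  intro x t ht
  obtain ⟨h1, h2, h3, h4⟩ := h x t ht
  have e2 : iteratedDeriv 2 (fun ξ => w ξ t) = fun ξ => 1 - p ξ t ^ 3 :=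
    funext fun ξ => (hw ξ t ht).2
  have d2 : HasDerivAt (fun ξ => 1 - p ξ t ^ 3)
      (-(3 * p x t ^ 2 * deriv (fun ξ => p ξ t) x)) x := by
    have := (h2.hasDerivAt.pow 3).const_sub 1
    simpa using this
  have et : (fun s => iteratedDeriv 2 (fun ξ => w ξ s) x) =ᶠ[𝓝 t] fun s => 1 - p x s ^ 3 := by
    filter_upwards [lt_mem_nhds ht] with s hs using (hw x s hs).2
  have dt : HasDerivAt (fun s => iteratedDeriv 2 (fun ξ => w ξ s) x)
      (-(3 * p x t ^ 2 * (-deriv (fun ξ => w ξ t * p ξ t) x))) t := by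
    have := ((h3.pow 3).const_sub 1).congr_of_eventuallyEq et
    simpa using this
  have e3 : iteratedDeriv 3 (fun ξ => w ξ t) x = -(3 * p x t ^ 2 * deriv (fun ξ => p ξ t) x) := by
    rw [iteratedDeriv_succ, e2]
    exact d2.deriv
  refine ⟨h1, h4.differentiableAt, e2 ▸ d2.differentiableAt, dt.differentiableAt, ?_⟩
  rw [dt.deriv, e3, (hw x t ht).2, (h1.hasDerivAt.fun_mul h2.hasDerivAt).deriv]
  ring

/-- When w_xx = 1 - p³, the left side of the scalar equation equals -3p²(p_t + (wp)_x), so for p > 0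
the two formulations agree. Differentiability of p is recovered from p = (1 - w_xx)^{1/3}, the
radicand being nonzero. -/
theorem SolvesEquation.solvesSystem {w p : ℝ → ℝ → ℝ}
    (hw : ∀ ξ t : ℝ, 0 < t → 0 < p ξ t ∧ iteratedDeriv 2 (fun η => w η t) ξ = 1 - p ξ t ^ 3)
    (h : SolvesEquation w) : SolvesSystem w p := by
  intro x t ht
  obtain ⟨h1, h2, h3, h4, h5⟩ := h x t ht
  have root : ∀ ξ s : ℝ, 0 < s →
      p ξ s = (1 - iteratedDeriv 2 (fun η => w η s) ξ) ^ (1 / 3 : ℝ) := by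
    intro ξ s hs
    rw [(hw ξ s hs).2, sub_sub_cancel, ← Real.rpow_natCast, ← Real.rpow_mul (hw ξ s hs).1.le]
    norm_num
  have hne : 1 - iteratedDeriv 2 (fun η => w η t) x ≠ 0 := by
    rw [(hw x t ht).2, sub_sub_cancel]
    exact (pow_pos (hw x t ht).1 3).ne'
  have dx : DifferentiableAt ℝ (fun ξ => p ξ t) x := by
    rw [funext fun ξ => root ξ t ht]
    exact ((differentiableAt_const 1).sub h3).rpow_const (Or.inl hne)
  have dt : DifferentiableAt ℝ (fun s => p x s) t := by
    have et : (fun s => p x s) =ᶠ[𝓝 t]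
        fun s => (1 - iteratedDeriv 2 (fun η => w η s) x) ^ (1 / 3 : ℝ) := by
      filter_upwards [lt_mem_nhds ht] with s hs using root x s hs
    exact (((differentiableAt_const 1).sub h4).rpow_const (Or.inl hne)).congr_of_eventuallyEq et
  have e2 : iteratedDeriv 2 (fun ξ => w ξ t) = fun ξ => 1 - p ξ t ^ 3 :=
    funext fun ξ => (hw ξ t ht).2
  have d2 : HasDerivAt (fun ξ => 1 - p ξ t ^ 3)
      (-(3 * p x t ^ 2 * deriv (fun ξ => p ξ t) x)) x := by
    have := (dx.hasDerivAt.pow 3).const_sub 1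
    simpa using this
  have e3 : iteratedDeriv 3 (fun ξ => w ξ t) x = -(3 * p x t ^ 2 * deriv (fun ξ => p ξ t) x) := by
    rw [iteratedDeriv_succ, e2]
    exact d2.deriv
  have et : (fun s => iteratedDeriv 2 (fun ξ => w ξ s) x) =ᶠ[𝓝 t] fun s => 1 - p x s ^ 3 := by
    filter_upwards [lt_mem_nhds ht] with s hs using (hw x s hs).2
  have dtt : HasDerivAt (fun s => iteratedDeriv 2 (fun ξ => w ξ s) x)
      (-(3 * p x t ^ 2 * deriv (fun s => p x s) t)) t := by
    have := ((dt.hasDerivAt.pow 3).const_sub 1).congr_of_eventuallyEq et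
    simpa using this
  refine ⟨h1, dx, ?_, ?_⟩
  · have key : deriv (fun s => p x s) t = -deriv (fun ξ => w ξ t * p ξ t) x := by
      rw [dtt.deriv, e3, (hw x t ht).2] at h5
      rw [(h1.hasDerivAt.fun_mul dx.hasDerivAt).deriv]
      have hp := (hw x t ht).1
      have : (3 * p x t ^ 2) * (deriv (fun s => p x s) t +
          (deriv (fun ξ => w ξ t) x * p x t + w x t * deriv (fun ξ => p ξ t) x)) = 0 := by
        linear_combination -h5
      have := (mul_eq_zero.1 this).resolve_left (by positivity)
      linarith
    rw [← key]
    exact dt.hasDerivAt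
  · have := h2.hasDerivAt
    have e : deriv (deriv fun ξ => w ξ t) x = 1 - p x t ^ 3 := by
      rw [← (hw x t ht).2, iteratedDeriv_succ, iteratedDeriv_one]
    rwa [e] at this

end ShortWave

namespace ShortWave

/-! ### The cube root of unity and the contour -/

theorem omega_eq : omega = ⟨-1 / 2, Real.sqrt 3 / 2⟩ := by
  have h : (2 * (Real.pi : ℂ) * Complex.I / 3) = ((Real.pi - Real.pi / 3 : ℝ) : ℂ) * Complex.I := by
    push_cast; ring
  rw [omega, h, Complex.exp_mul_I, ← Complex.ofReal_cos, ← Complex.ofReal_sin, Real.cos_pi_sub,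
    Real.sin_pi_sub, Real.cos_pi_div_three, Real.sin_pi_div_three]
  apply Complex.ext <;> norm_num

theorem omega_sq : omega ^ 2 = -1 - omega := by
  rw [omega_eq]
  have h3 : Real.sqrt 3 ^ 2 = 3 := Real.sq_sqrt (by norm_num)
  apply Complex.ext <;> simp [pow_two] <;> nlinarith

theorem omega_cube : omega ^ 3 = 1 := by
  linear_combination (omega - 1) * omega_sq

theorem omega_ne_zero : omega ≠ 0 := by
  intro h
  have := omega_cube
  simp [h] at this

theorem omega_inv : omega⁻¹ = -1 - omega := by
  rw [inv_eq_iff_eq_inv, ← mul_left_inj' (inv_ne_zero (inv_ne_zero omega_ne_zero))]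
  have : (-1 - omega) ≠ 0 := by
    rw [← omega_sq]; exact pow_ne_zero _ omega_ne_zero
  rw [inv_inv, inv_mul_eq_div, eq_div_iff this]
  linear_combination -omega * omega_sq

theorem star_omega : star omega = -1 - omega := by
  rw [omega_eq]
  apply Complex.ext <;> norm_num

theorem lam_zero_eq (z : ℂ) : lam 0 z = z * omega := by simp [lam]

theorem lam_one_eq (z : ℂ) : lam 1 z = z * (-1 - omega) := by
  have := omega_sq
  simp [lam, this]

theorem lam_two_eq (z : ℂ) : lam 2 z = z := by
  have := omega_cube
  simp [lam, this]

/-- The polynomial Im z³ splits into three real linear factors, whose zero lines are the lines Re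
λ_j = Re λ_l. -/
theorem mem_contour_iff {z : ℂ} : z ∈ contour ↔ (z ^ 3).im = 0 := by
  have h3 : Real.sqrt 3 ^ 2 = 3 := Real.sq_sqrt (by norm_num)
  have h0 : Real.sqrt 3 ≠ 0 := by positivity
  have e : (z ^ 3).im = z.im * (Real.sqrt 3 * z.re - z.im) * (Real.sqrt 3 * z.re + z.im) := by
    simp only [pow_succ, pow_zero, one_mul, Complex.mul_im, Complex.mul_re]
    linear_combination (-z.im * z.re ^ 2) * h3
  have l0 : (lam 0 z).re = -z.re / 2 - z.im * Real.sqrt 3 / 2 := by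
    rw [lam_zero_eq, omega_eq]; simp; ring
  have l1 : (lam 1 z).re = -z.re / 2 + z.im * Real.sqrt 3 / 2 := by
    rw [lam_one_eq, omega_eq]; simp; ring
  have l2 : (lam 2 z).re = z.re := by rw [lam_two_eq]
  rw [e, mul_eq_zero, mul_eq_zero]
  constructor
  · rintro ⟨j, l, hjl, h⟩
    have key : z.im * Real.sqrt 3 = 0 ∨ z.re * 3 = z.im * Real.sqrt 3 ∨
        z.re * 3 = - z.im * Real.sqrt 3 := by
      fin_cases j <;> fin_cases l <;> simp only [Fin.zero_eta, Fin.mk_one, Fin.reduceFinMk, l0, l1, l2] at h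
      · exact absurd rfl hjl
      · left; linarith
      · right; right; linarith
      · left; linarith
      · exact absurd rfl hjl
      · right; left; linarith
      · right; right; linarith
      · right; left; linarith
      · exact absurd rfl hjl
    rcases key with h | h | h
    · left; left; exact (mul_eq_zero.1 h).resolve_right h0
    · left; right
      have : Real.sqrt 3 * (Real.sqrt 3 * z.re - z.im) = 0 := by linear_combination h + z.re * h3
      exact (mul_eq_zero.1 this).resolve_left h0
    · right
      have : Real.sqrt 3 * (Real.sqrt 3 * z.re + z.im) = 0 := by linear_combination h + z.re * h3
      exact (mul_eq_zero.1 this).resolve_left h0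
  · rintro ((h | h) | h)
    · exact ⟨0, 1, by decide, by rw [l0, l1, h]; ring⟩
    · refine ⟨1, 2, by decide, ?_⟩
      rw [l1, l2]
      linear_combination (-Real.sqrt 3 / 2) * h + (1 / 2 * z.re) * h3
    · refine ⟨0, 2, by decide, ?_⟩
      rw [l0, l2]
      linear_combination (-Real.sqrt 3 / 2) * h + (1 / 2 * z.re) * h3

theorem isClosed_contour : IsClosed contour := by
  have : contour = (fun z : ℂ => (z ^ 3).im) ⁻¹' {0} := by
    ext z; simp [mem_contour_iff]
  rw [this]
  exact isClosed_singleton.preimage (Complex.continuous_im.comp (continuous_pow 3))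

theorem zero_mem_contour : (0 : ℂ) ∈ contour := by simp [mem_contour_iff]

theorem cube_polar_im (r θ : ℝ) :
    (((r : ℂ) * Complex.exp ((θ : ℂ) * Complex.I)) ^ 3).im = r ^ 3 * Real.sin (3 * θ) := by
  have : ((r : ℂ) * Complex.exp ((θ : ℂ) * Complex.I)) ^ 3
      = ((r ^ 3 : ℝ) : ℂ) * Complex.exp (((3 * θ : ℝ) : ℂ) * Complex.I) := by
    rw [mul_pow, ← Complex.exp_nat_mul]
    push_cast
    ring_nf
  rw [this, Complex.im_ofReal_mul, Complex.exp_ofReal_mul_I_im]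

theorem ray_subset_contour (ν : ℤ) : ray ν ⊆ contour := by
  rintro z ⟨r, -, rfl⟩
  rw [mem_contour_iff, cube_polar_im]
  have : 3 * (Real.pi / 3 * (ν : ℝ)) = ν * Real.pi := by ring
  rw [this, Real.sin_int_mul_pi, mul_zero]

theorem ne_zero_of_mem_ray {ν : ℤ} {z : ℂ} (hz : z ∈ ray ν) : z ≠ 0 := by
  obtain ⟨r, hr, rfl⟩ := hz
  exact mul_ne_zero (by exact_mod_cast hr.ne') (Complex.exp_ne_zero _)

/-- On a sector 3θ lies strictly between consecutive multiples of π, so sin 3θ does not vanish. -/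
theorem sector_subset (ν : ℤ) : sector ν ⊆ contourᶜ := by
  rintro z ⟨r, θ, hr, h1, h2, rfl⟩
  rw [mem_compl_iff, mem_contour_iff, cube_polar_im, mul_eq_zero, not_or]
  refine ⟨by positivity, fun h => ?_⟩
  obtain ⟨k, hk⟩ := Real.sin_eq_zero_iff.1 h
  have hpi := Real.pi_pos
  have a1 : (ν : ℝ) < k := by
    by_contra! hc
    have := mul_le_mul_of_nonneg_right hc hpi.le
    nlinarith
  have a2 : (k : ℝ) < ν + 1 := by
    by_contra! hc
    have := mul_le_mul_of_nonneg_right hc hpi.le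
    nlinarith
  have a1' : ν < k := by exact_mod_cast a1
  have a2' : k < ν + 1 := by exact_mod_cast a2
  omega

/-- Boundary values on a ray will be differentiated in a parameter, which needs uniqueness of limits
from either side. The point is approached along the circle through it. -/
theorem neBot_sector_of_mem_ray {ν : ℤ} {z : ℂ} (hz : z ∈ ray ν) : (𝓝[sector ν] z).NeBot := by
  obtain ⟨r, hr, rfl⟩ := hz
  have hpi := Real.pi_pos
  have : Tendsto (fun θ : ℝ => (r : ℂ) * Complex.exp ((θ : ℂ) * Complex.I))
      (𝓝[Ioo (Real.pi / 3 * ν) (Real.pi / 3 * (ν + 1))] (Real.pi / 3 * ν))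
      (𝓝[sector ν] ((r : ℂ) * Complex.exp (((Real.pi / 3 * (ν : ℝ) : ℝ) : ℂ) * Complex.I))) := by
    refine tendsto_nhdsWithin_iff.2 ⟨?_, ?_⟩
    · have : Continuous (fun θ : ℝ => (r : ℂ) * Complex.exp ((θ : ℂ) * Complex.I)) := by fun_prop
      exact (this.tendsto _).mono_left nhdsWithin_le_nhds
    · filter_upwards [self_mem_nhdsWithin] with θ hθ
      exact ⟨r, θ, hr, hθ.1, hθ.2, rfl⟩
  have hne : (𝓝[Ioo (Real.pi / 3 * ν) (Real.pi / 3 * (ν + 1))] (Real.pi / 3 * (ν : ℝ))).NeBot := by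
    apply left_nhdsWithin_Ioo_neBot
    nlinarith
  exact this.neBot

theorem neBot_sector_pred_of_mem_ray {ν : ℤ} {z : ℂ} (hz : z ∈ ray ν) :
    (𝓝[sector (ν - 1)] z).NeBot := by
  obtain ⟨r, hr, rfl⟩ := hz
  have hpi := Real.pi_pos
  have : Tendsto (fun θ : ℝ => (r : ℂ) * Complex.exp ((θ : ℂ) * Complex.I))
      (𝓝[Ioo (Real.pi / 3 * (ν - 1)) (Real.pi / 3 * ν)] (Real.pi / 3 * ν))
      (𝓝[sector (ν - 1)]
        ((r : ℂ) * Complex.exp (((Real.pi / 3 * (ν : ℝ) : ℝ) : ℂ) * Complex.I))) := by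
    refine tendsto_nhdsWithin_iff.2 ⟨?_, ?_⟩
    · have : Continuous (fun θ : ℝ => (r : ℂ) * Complex.exp ((θ : ℂ) * Complex.I)) := by fun_prop
      exact (this.tendsto _).mono_left nhdsWithin_le_nhds
    · filter_upwards [self_mem_nhdsWithin] with θ hθ
      refine ⟨r, θ, hr, ?_, ?_, rfl⟩
      · push_cast; exact hθ.1
      · push_cast; rw [sub_add_cancel]; exact hθ.2
  have hne : (𝓝[Ioo (Real.pi / 3 * (ν - 1)) (Real.pi / 3 * ν)] (Real.pi / 3 * (ν : ℝ))).NeBot := by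
    apply right_nhdsWithin_Ioo_neBot
    nlinarith
  exact this.neBot

/-- The bisector of the sector `0 < arg z < π/3`. -/
theorem bisector_mem {r : ℝ} (hr : 0 < r) :
    (r : ℂ) * Complex.exp (((Real.pi / 6 : ℝ) : ℂ) * Complex.I) ∈ sector 0 :=
  ⟨r, Real.pi / 6, hr, by simpa using by positivity, by
    have := Real.pi_pos; push_cast; linarith, rfl⟩

theorem neBot_contour_compl : (𝓝[contourᶜ] (0 : ℂ)).NeBot := by
  have : Tendsto (fun r : ℝ => (r : ℂ) * Complex.exp (((Real.pi / 6 : ℝ) : ℂ) * Complex.I))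
      (𝓝[>] 0) (𝓝[contourᶜ] 0) := by
    refine tendsto_nhdsWithin_iff.2 ⟨?_, ?_⟩
    · have : Continuous (fun r : ℝ =>
          (r : ℂ) * Complex.exp (((Real.pi / 6 : ℝ) : ℂ) * Complex.I)) := by fun_prop
      have := this.tendsto 0
      simp only [Complex.ofReal_zero, zero_mul] at this
      exact this.mono_left nhdsWithin_le_nhds
    · filter_upwards [self_mem_nhdsWithin] with r hr
      exact sector_subset 0 (bisector_mem hr)
  exact this.neBot

/-! ### The domain and neighbourhoods avoiding the poles -/

variable {D : RHData}

theorem RHData.isOpen_domain (D : RHData) : IsOpen D.domain :=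
  (isClosed_contour.union (finite_range D.pole).isClosed).isOpen_compl

theorem RHData.mem_domain_iff {z : ℂ} :
    z ∈ D.domain ↔ z ∉ contour ∧ ∀ k, D.pole k ≠ z := by
  simp [RHData.domain]

/-- Parameter dependence is uniform only at a positive distance from the poles; this supplies such a
distance near any point that is not a pole. -/
theorem RHData.exists_dist_pole (D : RHData) {z : ℂ} (hz : ∀ k, D.pole k ≠ z) :
    ∃ ε > 0, ∀ w ∈ Metric.ball z ε, ∀ k, ε ≤ dist w (D.pole k) := by
  have hopen : IsOpen (range D.pole)ᶜ := (finite_range D.pole).isClosed.isOpen_compl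
  obtain ⟨δ, hδ, hb⟩ := Metric.isOpen_iff.1 hopen z (by simpa using hz)
  refine ⟨δ / 2, by positivity, fun w hw k => ?_⟩
  have h1 : δ ≤ dist (D.pole k) z := by
    by_contra! hc
    exact hb hc (mem_range_self k)
  have h2 := dist_triangle (D.pole k) w z
  rw [dist_comm (D.pole k) w] at h2
  have := Metric.mem_ball.1 hw
  linarith

theorem RHData.pole_ne_of_mem_contour {z : ℂ} (hz : z ∈ contour) (k : Fin D.n) :
    D.pole k ≠ z := fun h => D.pole_notMem k (h ▸ hz)

theorem RHData.eventually_mem_domain {z : ℂ} (hz : z ∈ contour) :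
    ∀ᶠ w in 𝓝[contourᶜ] z, w ∈ D.domain := by
  obtain ⟨ε, hε, h⟩ := D.exists_dist_pole (z := z) (fun k => pole_ne_of_mem_contour hz k)
  filter_upwards [self_mem_nhdsWithin, mem_nhdsWithin_of_mem_nhds (Metric.ball_mem_nhds z hε)]
    with w hw hwb
  refine RHData.mem_domain_iff.2 ⟨hw, fun k hk => ?_⟩
  have := h w hwb k
  rw [hk, dist_self] at this
  linarith

/-- Infinity is approached inside the domain along the bisector of a sector, beyond all poles. This
also supplies base points for evaluation. -/
theorem RHData.exists_mem_domain (D : RHData) (R : ℝ) : ∃ z ∈ D.domain, R ≤ ‖z‖ := by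
  obtain ⟨B, hB⟩ := (finite_range D.pole).isBounded.exists_norm_le
  set r : ℝ := max (max R B) 0 + 1 with hr
  have hr0 : 0 < r := by positivity
  have hnorm : ‖(r : ℂ) * Complex.exp (((Real.pi / 6 : ℝ) : ℂ) * Complex.I)‖ = r := by
    rw [norm_mul, Complex.norm_exp_ofReal_mul_I, mul_one, Complex.norm_real, Real.norm_of_nonneg hr0.le]
  refine ⟨_, RHData.mem_domain_iff.2 ⟨sector_subset 0 (bisector_mem hr0), fun k hk => ?_⟩, ?_⟩
  · have := hB _ (mem_range_self k)
    rw [hk, hnorm] at this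
    have := le_max_left (max R B) 0
    have := le_max_right R B
    linarith
  · rw [hnorm]
    have := le_max_left (max R B) 0
    have := le_max_left R B
    linarith

end ShortWave

namespace ShortWave

/-! ### Linear structure of the jump and residue conditions -/

namespace JumpAndResidue

variable {D : RHData} {y t : ℝ} {M N : ℂ → Mat}

theorem tendsto_entry {l : Filter ℂ} {A : Mat} :
    Tendsto M l (𝓝 A) ↔ ∀ i j, Tendsto (fun z => M z i j) l (𝓝 (A i j)) := by
  exact tendsto_pi_nhds.trans (forall_congr' fun i => tendsto_pi_nhds)

theorem add (hM : JumpAndResidue D y t M) (hN : JumpAndResidue D y t N) :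
    JumpAndResidue D y t (fun z => M z + N z) where
  analytic i j := (hM.analytic i j).add (hN.analytic i j)
  jump ν z hz := by
    obtain ⟨Mp, Mm, h1, h2, h3⟩ := hM.jump ν z hz
    obtain ⟨Np, Nm, k1, k2, k3⟩ := hN.jump ν z hz
    exact ⟨Mp + Np, Mm + Nm, h1.add k1, h2.add k2, by rw [h3, k3, add_mul]⟩
  regular_columns k i j hj := (hM.regular_columns k i j hj).add (hN.regular_columns k i j hj)
  residue k i := by
    have := (hM.residue k i).add (hN.residue k i)
    simp only [Matrix.add_apply, mul_add, add_mul] at this ⊢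
    exact this

/-- The jump matrix multiplies from the right and the residue condition relates columns, so constant
left factors pass through both. -/
theorem const_mul (A : Mat) (hM : JumpAndResidue D y t M) :
    JumpAndResidue D y t (fun z => A * M z) where
  analytic i j := by
    simp only [Matrix.mul_apply]
    exact DifferentiableOn.fun_sum fun k _ => (hM.analytic k j).const_mul _
  jump ν z hz := by
    obtain ⟨Mp, Mm, h1, h2, h3⟩ := hM.jump ν z hz
    refine ⟨A * Mp, A * Mm, ?_, ?_, by rw [h3, mul_assoc]⟩
    · exact (continuous_const.matrix_mul continuous_id).tendsto Mp |>.comp h1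
    · exact (continuous_const.matrix_mul continuous_id).tendsto Mm |>.comp h2
  regular_columns k i j hj := by
    simp only [Matrix.mul_apply]
    exact Finset.analyticAt_fun_sum _ fun l _ => analyticAt_const.mul (hM.regular_columns k l j hj)
  residue k i := by
    have := tendsto_finsetSum (Finset.univ : Finset (Fin 3))
      fun l _ => (hM.residue k l).const_mul (A i l)
    simp only [Matrix.mul_apply, Finset.mul_sum, Finset.sum_mul] at this ⊢
    refine this.congr' ?_ |>.trans (le_of_eq ?_)
    · exact Eventually.of_forall fun z => Finset.sum_congr rfl fun l _ => by ring
    · congr 1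
      exact Finset.sum_congr rfl fun l _ => by ring

/-- An entire factor has the same boundary values on both sides of the contour, and the same value
at a pole on both sides of the residue condition. -/
theorem smul {f : ℂ → ℂ} (hf : Differentiable ℂ f) (hM : JumpAndResidue D y t M) :
    JumpAndResidue D y t (fun z => f z • M z) where
  analytic i j := hf.differentiableOn.mul (hM.analytic i j)
  jump ν z hz := by
    obtain ⟨Mp, Mm, h1, h2, h3⟩ := hM.jump ν z hz
    have hfz : ∀ s : Set ℂ, Tendsto f (𝓝[s] z) (𝓝 (f z)) := fun s =>
      (hf.continuous.tendsto z).mono_left nhdsWithin_le_nhds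
    exact ⟨f z • Mp, f z • Mm, (hfz _).smul h1, (hfz _).smul h2, by rw [h3, smul_mul_assoc]⟩
  regular_columns k i j hj := (hf.analyticAt _).mul (hM.regular_columns k i j hj)
  residue k i := by
    have hfz : Tendsto f (𝓝[≠] (D.pole k)) (𝓝 (f (D.pole k))) :=
      (hf.continuous.tendsto _).mono_left nhdsWithin_le_nhds
    have := hfz.mul (hM.residue k i)
    simp only [Matrix.smul_apply, smul_eq_mul] at this ⊢
    refine this.congr' ?_ |>.trans (le_of_eq ?_)
    · exact Eventually.of_forall fun z => by ring
    · congr 1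
      ring

/-- Dividing out a zero keeps all conditions and lowers the growth at infinity by one order, which
reduces growing functions to decaying ones. -/
theorem exists_quotient (hM : JumpAndResidue D y t M) {z₀ : ℂ} (hz₀ : z₀ ∈ D.domain)
    (h0 : M z₀ = 0) :
    ∃ N : ℂ → Mat, JumpAndResidue D y t N ∧ ∀ z ≠ z₀, N z = (z - z₀)⁻¹ • M z := by
  -- `dslope` is the difference quotient with its removable singularity at `z₀` filled in.
  set N : ℂ → Mat := fun z => Matrix.of fun i j => dslope (fun w => M w i j) z₀ z with hN
  have hq : ∀ z ≠ z₀, N z = (z - z₀)⁻¹ • M z := by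
    intro z hz
    ext i j
    simp only [hN, Matrix.of_apply, Matrix.smul_apply]
    rw [dslope_of_ne _ hz, slope_def_module, h0]
    simp
  have hev : ∀ z ≠ z₀, ∀ᶠ w in 𝓝 z, N w = (w - z₀)⁻¹ • M w := fun z hz => by
    filter_upwards [isOpen_ne.mem_nhds hz] with w hw using hq w hw
  have hne : ∀ k, D.pole k ≠ z₀ := (RHData.mem_domain_iff.1 hz₀).2
  refine ⟨N, ⟨fun i j => ?_, fun ν z hz => ?_, fun k i j hj => ?_, fun k i => ?_⟩, hq⟩
  · exact (Complex.differentiableOn_dslope (D.isOpen_domain.mem_nhds hz₀)).2 (hM.analytic i j)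
  · obtain ⟨Mp, Mm, h1, h2, h3⟩ := hM.jump ν z hz
    have hzz : z ≠ z₀ := by
      rintro rfl
      exact (RHData.mem_domain_iff.1 hz₀).1 (ray_subset_contour ν hz)
    have hf : Tendsto (fun w => (w - z₀)⁻¹) (𝓝 z) (𝓝 (z - z₀)⁻¹) :=
      ((continuous_id.sub continuous_const).tendsto z).inv₀ (sub_ne_zero.2 hzz)
    refine ⟨(z - z₀)⁻¹ • Mp, (z - z₀)⁻¹ • Mm, ?_, ?_, by rw [h3, smul_mul_assoc]⟩
    · exact ((hf.mono_left nhdsWithin_le_nhds).smul h1).congr'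
        ((hev z hzz).filter_mono nhdsWithin_le_nhds |>.mono fun w hw => hw.symm)
    · exact ((hf.mono_left nhdsWithin_le_nhds).smul h2).congr'
        ((hev z hzz).filter_mono nhdsWithin_le_nhds |>.mono fun w hw => hw.symm)
  · have h1 : AnalyticAt ℂ (fun w => (w - z₀)⁻¹ * M w i j) (D.pole k) :=
      ((analyticAt_id.sub analyticAt_const).inv (sub_ne_zero.2 (hne k))).mul
        (hM.regular_columns k i j hj)
    refine h1.congr ?_
    filter_upwards [hev _ (hne k)] with w hw
    rw [hw]; rfl
  · have hf : Tendsto (fun w => (w - z₀)⁻¹) (𝓝[≠] (D.pole k)) (𝓝 (D.pole k - z₀)⁻¹) :=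
      (((continuous_id.sub continuous_const).tendsto _).inv₀ (sub_ne_zero.2 (hne k))).mono_left
        nhdsWithin_le_nhds
    have := hf.mul (hM.residue k i)
    rw [hq _ (hne k)]
    refine (this.congr' ?_).trans (le_of_eq ?_)
    · filter_upwards [(hev _ (hne k)).filter_mono nhdsWithin_le_nhds] with w hw
      rw [hw]
      simp only [Matrix.smul_apply, smul_eq_mul]
      ring
    · simp only [Matrix.smul_apply, smul_eq_mul]
      congr 1
      ring

end JumpAndResidue

/-! ### Consequences of unique solvability -/

/-- Boundary values at the origin from each sector. -/
def HasOriginLimits (M : ℂ → Mat) : Prop := ∀ ν : ℤ, ∃ A : Mat, Tendsto M (𝓝[sector ν] 0) (𝓝 A)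

theorem HasOriginLimits.add {M N : ℂ → Mat} (hM : HasOriginLimits M) (hN : HasOriginLimits N) :
    HasOriginLimits fun z => M z + N z := fun ν => by
  obtain ⟨A, hA⟩ := hM ν
  obtain ⟨B, hB⟩ := hN ν
  exact ⟨A + B, hA.add hB⟩

theorem HasOriginLimits.const_mul {M : ℂ → Mat} (A : Mat) (hM : HasOriginLimits M) :
    HasOriginLimits fun z => A * M z := fun ν => by
  obtain ⟨B, hB⟩ := hM ν
  exact ⟨A * B, (continuous_const.matrix_mul continuous_id).tendsto B |>.comp hB⟩

theorem HasOriginLimits.smul {M : ℂ → Mat} {f : ℂ → ℂ} (hf : Continuous f)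
    (hM : HasOriginLimits M) : HasOriginLimits fun z => f z • M z := fun ν => by
  obtain ⟨B, hB⟩ := hM ν
  exact ⟨f 0 • B, ((hf.tendsto 0).mono_left nhdsWithin_le_nhds).smul hB⟩

/-- Entrywise bound `|M| ≤ C |z|^k` near infinity. -/
def GrowthAtInfinity (D : RHData) (k : ℤ) (M : ℂ → Mat) : Prop :=
  ∃ C R : ℝ, ∀ z ∈ D.domain, R ≤ ‖z‖ → ∀ i j, ‖M z i j‖ ≤ C * ‖z‖ ^ k

theorem GrowthAtInfinity.add {D : RHData} {k : ℤ} {M N : ℂ → Mat} (hM : GrowthAtInfinity D k M)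
    (hN : GrowthAtInfinity D k N) : GrowthAtInfinity D k fun z => M z + N z := by
  obtain ⟨C, R, h⟩ := hM
  obtain ⟨C', R', h'⟩ := hN
  refine ⟨C + C', max R R', fun z hz hR i j => ?_⟩
  rw [add_mul]
  exact (norm_add_le _ _).trans (add_le_add (h z hz ((le_max_left _ _).trans hR) i j)
    (h' z hz ((le_max_right _ _).trans hR) i j))

theorem GrowthAtInfinity.const_mul {D : RHData} {k : ℤ} {M : ℂ → Mat} (A : Mat)
    (hM : GrowthAtInfinity D k M) : GrowthAtInfinity D k fun z => A * M z := by
  obtain ⟨C, R, h⟩ := hM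
  refine ⟨(∑ i, ∑ l, ‖A i l‖) * C, R, fun z hz hR i j => ?_⟩
  have hC : 0 ≤ C * ‖z‖ ^ k := (norm_nonneg _).trans (h z hz hR 0 0)
  beta_reduce
  rw [Matrix.mul_apply, mul_assoc]
  calc ‖∑ l, A i l * M z l j‖ ≤ ∑ l, ‖A i l‖ * ‖M z l j‖ := by
        refine (norm_sum_le _ _).trans (Finset.sum_le_sum fun l _ => (norm_mul_le _ _))
    _ ≤ ∑ l, ‖A i l‖ * (C * ‖z‖ ^ k) :=
        Finset.sum_le_sum fun l _ => mul_le_mul_of_nonneg_left (h z hz hR l j) (norm_nonneg _)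
    _ = (∑ l, ‖A i l‖) * (C * ‖z‖ ^ k) := by rw [Finset.sum_mul]
    _ ≤ (∑ i, ∑ l, ‖A i l‖) * (C * ‖z‖ ^ k) := by
        refine mul_le_mul_of_nonneg_right ?_ hC
        exact Finset.single_le_sum (f := fun i => ∑ l, ‖A i l‖)
          (fun i _ => Finset.sum_nonneg fun l _ => norm_nonneg _) (Finset.mem_univ i)

theorem GrowthAtInfinity.mono {D : RHData} {k l : ℤ} (hkl : k ≤ l) {M : ℂ → Mat}
    (hM : GrowthAtInfinity D k M) : GrowthAtInfinity D l M := by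
  obtain ⟨C, R, h⟩ := hM
  refine ⟨C, max R 1, fun z hz hR i j => ?_⟩
  have h1 : 1 ≤ ‖z‖ := (le_max_right _ _).trans hR
  have h2 := h z hz ((le_max_left _ _).trans hR)
  have hC : 0 ≤ C := by
    by_contra! hc
    have := (norm_nonneg _).trans (h2 0 0)
    have h3 : 0 < ‖z‖ ^ k := zpow_pos (by linarith) k
    nlinarith
  exact (h2 i j).trans (mul_le_mul_of_nonneg_left (zpow_le_zpow_right₀ h1 hkl) hC)

theorem GrowthAtInfinity.id_smul {D : RHData} {k : ℤ} {M : ℂ → Mat} (hM : GrowthAtInfinity D k M) :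
    GrowthAtInfinity D (k + 1) fun z => z • M z := by
  obtain ⟨C, R, h⟩ := hM
  refine ⟨C, max R 1, fun z hz hR i j => ?_⟩
  have h1 : 1 ≤ ‖z‖ := (le_max_right _ _).trans hR
  have h2 := h z hz ((le_max_left _ _).trans hR) i j
  beta_reduce
  rw [zpow_add₀ (by linarith), zpow_one, ← mul_assoc, Matrix.smul_apply, smul_eq_mul, norm_mul,
    mul_comm]
  exact mul_le_mul_of_nonneg_right h2 (norm_nonneg _)

theorem GrowthAtInfinity.quotient {D : RHData} {k : ℤ} {M N : ℂ → Mat} {z₀ : ℂ}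
    (hN : ∀ z ≠ z₀, N z = (z - z₀)⁻¹ • M z) (hM : GrowthAtInfinity D k M) :
    GrowthAtInfinity D (k - 1) N := by
  obtain ⟨C, R, h⟩ := hM
  -- Beyond 2‖z₀‖ one has ‖z - z₀‖ ≥ ‖z‖/2, whence the factor 2; the extra 1 keeps z nonzero and
  -- away from `z₀`.
  refine ⟨2 * C, max R (2 * ‖z₀‖ + 1), fun z hz hR i j => ?_⟩
  have h1 : 2 * ‖z₀‖ + 1 ≤ ‖z‖ := (le_max_right _ _).trans hR
  have h2 := h z hz ((le_max_left _ _).trans hR) i j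
  have h0 := norm_nonneg z₀
  have hz0 : 0 < ‖z‖ := by linarith
  have hne : z ≠ z₀ := by
    rintro rfl
    linarith
  have h3 : ‖z‖ / 2 ≤ ‖z - z₀‖ := by
    have := norm_sub_norm_le z z₀
    linarith
  rw [hN z hne, Matrix.smul_apply, smul_eq_mul, norm_mul, norm_inv, zpow_sub₀ hz0.ne', zpow_one]
  calc ‖z - z₀‖⁻¹ * ‖M z i j‖ ≤ (‖z‖ / 2)⁻¹ * (C * ‖z‖ ^ k) :=
        mul_le_mul (inv_anti₀ (by positivity) h3) h2 (norm_nonneg _) (by positivity)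
    _ = 2 * C * (‖z‖ ^ k / ‖z‖) := by field_simp

theorem HasOriginLimits.quotient {D : RHData} {M N : ℂ → Mat} {z₀ : ℂ} (hz₀ : z₀ ∈ D.domain)
    (hN : ∀ z ≠ z₀, N z = (z - z₀)⁻¹ • M z) (hM : HasOriginLimits M) : HasOriginLimits N := by
  intro ν
  obtain ⟨A, hA⟩ := hM ν
  have h0 : (0 : ℂ) ≠ z₀ := by
    rintro rfl
    exact (RHData.mem_domain_iff.1 hz₀).1 zero_mem_contour
  have hf : Tendsto (fun w => (w - z₀)⁻¹) (𝓝 0) (𝓝 (0 - z₀)⁻¹) :=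
    ((continuous_id.sub continuous_const).tendsto 0).inv₀ (sub_ne_zero.2 h0)
  refine ⟨(0 - z₀)⁻¹ • A, ((hf.mono_left nhdsWithin_le_nhds).smul hA).congr' ?_⟩
  filter_upwards [mem_nhdsWithin_of_mem_nhds (isOpen_ne.mem_nhds h0)] with w hw
  exact (hN w hw).symm

namespace IsUniqueRHSolution

variable {D : RHData} {y t : ℝ} {M X : ℂ → Mat}

/-- M + X is again a solution of the RH problem, so uniqueness forces X = 0. -/
theorem eq_zero_of_decay (hM : IsUniqueRHSolution D y t M) (hX : JumpAndResidue D y t X)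
    (h0 : HasOriginLimits X) (hg : GrowthAtInfinity D (-1) X) : ∀ z ∈ D.domain, X z = 0 := by
  intro z hz
  have := hM.2 (fun z => M z + X z) ⟨hM.1.jumpAndResidue.add hX,
    HasOriginLimits.add hM.1.origin h0, ?_⟩ z hz
  · simpa using this
  · obtain ⟨C, R, h⟩ := hM.1.normalization
    obtain ⟨C', R', h'⟩ := hg
    refine ⟨C + C', max R R', fun z hz hR i j => ?_⟩
    have h1 := h z hz ((le_max_left _ _).trans hR) i j
    have h2 := h' z hz ((le_max_right _ _).trans hR) i j
    rw [zpow_neg_one, ← div_eq_mul_inv] at h2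
    rw [Matrix.add_apply, add_sub_right_comm, add_div]
    exact (norm_add_le _ _).trans (add_le_add h1 h2)

theorem eq_zero_of_bounded (hM : IsUniqueRHSolution D y t M) (hX : JumpAndResidue D y t X)
    (h0 : HasOriginLimits X) (hg : GrowthAtInfinity D 0 X) {z₀ : ℂ} (hz₀ : z₀ ∈ D.domain)
    (hv : X z₀ = 0) : ∀ z ∈ D.domain, X z = 0 := by
  intro z hz
  obtain ⟨N, hN, hq⟩ := hX.exists_quotient hz₀ hv
  by_cases hzz : z = z₀
  · rw [hzz, hv]
  have := hM.eq_zero_of_decay hN (h0.quotient hz₀ hq) (hg.quotient hq) z hz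
  rw [hq z hzz] at this
  exact (smul_eq_zero.1 this).resolve_left (inv_ne_zero (sub_ne_zero.2 hzz))

/-- Each zero divided out costs one order of growth: the first leaves a bounded function that still
vanishes at the other point. -/
theorem eq_zero_of_linear_growth (hM : IsUniqueRHSolution D y t M) (hX : JumpAndResidue D y t X)
    (h0 : HasOriginLimits X) (hg : GrowthAtInfinity D 1 X) {z₀ z₁ : ℂ} (hz₀ : z₀ ∈ D.domain)
    (hz₁ : z₁ ∈ D.domain) (hne : z₀ ≠ z₁) (hv₀ : X z₀ = 0) (hv₁ : X z₁ = 0) :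
    ∀ z ∈ D.domain, X z = 0 := by
  intro z hz
  obtain ⟨N, hN, hq⟩ := hX.exists_quotient hz₁ hv₁
  by_cases hzz : z = z₁
  · rw [hzz, hv₁]
  have := hM.eq_zero_of_bounded hN (h0.quotient hz₁ hq) (hg.quotient hq) hz₀
    (by rw [hq z₀ hne, hv₀, smul_zero]) z hz
  rw [hq z hzz] at this
  exact (smul_eq_zero.1 this).resolve_left (inv_ne_zero (sub_ne_zero.2 hzz))

theorem growth (hM : IsUniqueRHSolution D y t M) : GrowthAtInfinity D 0 M := by
  obtain ⟨C, R, h⟩ := hM.1.normalization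
  refine ⟨1 + max C 0, max R 1, fun z hz hR i j => ?_⟩
  have h1 := h z hz ((le_max_left _ _).trans hR) i j
  have h2 : 1 ≤ ‖z‖ := (le_max_right _ _).trans hR
  have h3 : ‖(1 : Mat) i j‖ ≤ 1 := by
    rw [Matrix.one_apply]
    split_ifs <;> simp
  have h4 : C / ‖z‖ ≤ max C 0 := by
    rw [div_le_iff₀ (by linarith)]
    exact (le_max_left C 0).trans (le_mul_of_one_le_right (le_max_right _ _) h2)
  have := norm_add_le (M z i j - (1 : Mat) i j) ((1 : Mat) i j)
  rw [sub_add_cancel] at this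
  rw [zpow_zero, mul_one]
  linarith

/-- Uniqueness forces the solution to be invertible off the contour. -/
theorem isUnit_det (hM : IsUniqueRHSolution D y t M) {z₀ : ℂ} (hz₀ : z₀ ∈ D.domain) :
    IsUnit (M z₀).det := by
  rw [isUnit_iff_ne_zero]
  intro hdet
  obtain ⟨v, hv, hv0⟩ := Matrix.exists_vecMul_eq_zero_iff.2 hdet
  -- If vM(z₀) = 0, the matrix A with all rows equal to v makes AM bounded with a zero, hence
  -- identically zero. But AM tends to A at infinity, so v = 0.
  set A : Mat := Matrix.of fun _ j => v j with hA
  have hmul : ∀ z i, (A * M z) i = Matrix.vecMul v (M z) := fun z i => by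
    ext j; simp [hA, Matrix.mul_apply, Matrix.vecMul, dotProduct]
  have hz := hM.eq_zero_of_bounded (hM.1.jumpAndResidue.const_mul A)
    (HasOriginLimits.const_mul A hM.1.origin) (hM.growth.const_mul A) hz₀
    (by ext i j; rw [hmul, hv0]; rfl)
  obtain ⟨C, R, h⟩ := hM.1.normalization
  apply hv
  ext j
  by_contra hj
  have hj' : 0 < ‖v j‖ := norm_pos_iff.2 hj
  set K : ℝ := ∑ i, ‖v i‖ with hK
  have hK0 : 0 ≤ K := Finset.sum_nonneg fun i _ => norm_nonneg _
  obtain ⟨z, hzd, hzR⟩ := D.exists_mem_domain (max R (K * |C| / ‖v j‖ + 1))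
  have hzpos : 0 < ‖z‖ := by
    have : 0 < K * |C| / ‖v j‖ + 1 := by positivity
    exact this.trans_le ((le_max_right _ _).trans hzR)
  have h1 : Matrix.vecMul v (M z) j = 0 := by
    rw [← hmul z 0, hz z hzd]; rfl
  have h2 : v j = -∑ i, v i * (M z i j - (1 : Mat) i j) := by
    have h3 : ∑ i, v i * M z i j = 0 := h1
    have h4 : ∑ i, v i * (1 : Mat) i j = v j := by simp [Matrix.one_apply]
    simp only [mul_sub, Finset.sum_sub_distrib, h3, h4]
    ring
  have h5 : ‖v j‖ ≤ K * (|C| / ‖z‖) := by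
    rw [h2, norm_neg, hK, Finset.sum_mul]
    refine (norm_sum_le _ _).trans (Finset.sum_le_sum fun i _ => ?_)
    rw [norm_mul]
    refine mul_le_mul_of_nonneg_left ?_ (norm_nonneg _)
    exact (h z hzd ((le_max_left _ _).trans hzR) i j).trans
      (div_le_div_of_nonneg_right (le_abs_self C) hzpos.le)
  have h6 : K * |C| / ‖v j‖ + 1 ≤ ‖z‖ := (le_max_right _ _).trans hzR
  have h7 : ‖v j‖ * ‖z‖ ≤ K * |C| := by
    have := mul_le_mul_of_nonneg_right h5 hzpos.le
    rwa [mul_assoc, div_mul_cancel₀ _ hzpos.ne'] at this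
  have h8 : K * |C| < ‖v j‖ * ‖z‖ := by
    have := mul_le_mul_of_nonneg_left h6 hj'.le
    rw [mul_add, mul_div_cancel₀ _ hj'.ne'] at this
    linarith
  linarith

end IsUniqueRHSolution

end ShortWave

namespace ShortWave

/-! ### Limits of families of bounded functions depending on a parameter -/

section Limits

variable {X : Type*} [TopologicalSpace X]

/-- An ultrafilter finer than `l` assigns a limit to every bounded function, by compactness of
closed balls in ℂ. The resulting continuous functional extends the limit along `l`, so boundary
limits can be interchanged with derivatives in a parameter. -/
theorem exists_limit_functional (l : Filter X) [l.NeBot] :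
    ∃ ℓ : (X →ᵇ ℂ) →L[ℝ] ℂ, ∀ (f : X →ᵇ ℂ) (c : ℂ), Tendsto f l (𝓝 c) → ℓ f = c := by
  set U : Ultrafilter X := Ultrafilter.of l
  have hex : ∀ f : X →ᵇ ℂ, ∃ c : ℂ, Tendsto f U (𝓝 c) := fun f => by
    have hc : IsCompact (Metric.closedBall (0 : ℂ) ‖f‖) := isCompact_closedBall _ _
    have := hc.ultrafilter_le_nhds (U.map f) (by
      refine le_principal_iff.2 (Ultrafilter.mem_coe.2 ?_)
      exact univ_mem' (f := (U : Filter X)) fun x => by simpa using f.norm_coe_le_norm x)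
    obtain ⟨c, -, h⟩ := this
    exact ⟨c, h⟩
  choose L hL using hex
  have uniq : ∀ (f : X →ᵇ ℂ) c, Tendsto f U (𝓝 c) → L f = c := fun f c h => tendsto_nhds_unique (hL f) h
  let ℓ₀ : (X →ᵇ ℂ) →ₗ[ℝ] ℂ :=
    { toFun := L
      map_add' := fun f g => uniq _ _ ((hL f).add (hL g))
      map_smul' := fun r f => uniq _ _ ((hL f).const_smul r) }
  refine ⟨ℓ₀.mkContinuous 1 fun f => ?_, fun f c h => uniq f c (h.mono_left (Ultrafilter.of_le l))⟩
  rw [one_mul]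
  exact le_of_tendsto (hL f).norm (Eventually.of_forall fun x => f.norm_coe_le_norm x)

/-- Uniform limits preserve the existence of a limit along `l`. A parameter derivative is a uniform
limit of difference quotients, so it inherits boundary values. -/
theorem isClosed_setOf_exists_tendsto (l : Filter X) [l.NeBot] :
    IsClosed {f : X →ᵇ ℂ | ∃ c : ℂ, Tendsto f l (𝓝 c)} := by
  refine isClosed_of_closure_subset fun f hf => ?_
  have : Cauchy (l.map f) := by
    rw [Metric.cauchy_iff]
    refine ⟨inferInstance, fun ε hε => ?_⟩
    obtain ⟨g, ⟨c, hg⟩, hfg⟩ := Metric.mem_closure_iff.1 hf (ε / 4) (by positivity)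
    refine ⟨f '' {x | dist (g x) c < ε / 4}, ?_, ?_⟩
    · exact image_mem_map (Metric.tendsto_nhds.1 hg (ε / 4) (by positivity))
    · rintro _ ⟨x, hx, rfl⟩ _ ⟨y, hy, rfl⟩
      have h1 := (f.dist_coe_le_dist (g := g) x).trans_lt hfg
      have h2 := (f.dist_coe_le_dist (g := g) y).trans_lt hfg
      have h3 := dist_triangle4 (f x) (g x) c (f y)
      have h4 := dist_triangle_right c (f y) (g y)
      simp only [mem_ofPred_eq] at hx hy
      rw [dist_comm] at hy
      linarith
  exact cauchy_iff_exists_le_nhds.1 this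

theorem hasDerivWithinAt_limit {Φ : ℝ → X →ᵇ ℂ} {Φ' : X →ᵇ ℂ} {S : Set ℝ} {s₀ : ℝ}
    (hS : UniqueDiffWithinAt ℝ S s₀) (hs₀ : s₀ ∈ S) (hΦ : HasDerivWithinAt Φ Φ' S s₀)
    {l : Filter X} [l.NeBot] {L : ℝ → ℂ} (hL : ∀ s ∈ S, Tendsto (Φ s) l (𝓝 (L s))) :
    ∃ L', Tendsto Φ' l (𝓝 L') ∧ HasDerivWithinAt L L' S s₀ := by
  have hne : (𝓝[S \ {s₀}] s₀).NeBot := by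
    have := uniqueDiffWithinAt_iff_accPt.1 hS
    rwa [accPt_principal_iff_nhdsWithin] at this
  have hmem : Φ' ∈ {f : X →ᵇ ℂ | ∃ c : ℂ, Tendsto f l (𝓝 c)} := by
    refine (isClosed_setOf_exists_tendsto l).mem_of_tendsto
      (hasDerivWithinAt_iff_tendsto_slope.1 hΦ) ?_
    filter_upwards [self_mem_nhdsWithin] with s hs
    refine ⟨(s - s₀)⁻¹ • (L s - L s₀), ?_⟩
    simp only [slope, vsub_eq_sub]
    exact ((hL s hs.1).sub (hL s₀ hs₀)).const_smul _
  obtain ⟨c, hc⟩ := hmem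
  obtain ⟨ℓ, hℓ⟩ := exists_limit_functional l
  refine ⟨c, hc, ?_⟩
  rw [← hℓ Φ' c hc]
  exact (ℓ.hasFDerivAt.comp_hasDerivWithinAt s₀ hΦ).congr (fun s hs => (hℓ _ _ (hL s hs)).symm)
    (hℓ _ _ (hL s₀ hs₀)).symm

end Limits

/-- If holomorphic functions on a disc depend differentiably on a parameter, uniformly on the
boundary circle, then they do so inside, and the derivative is holomorphic. -/
theorem exists_deriv_of_circle {X : Set ℂ} {c : ℂ} {r : ℝ}
    (hX : Metric.sphere c r ⊆ X) {κ : ℂ → ℂ} (hκ : Continuous κ) {f : ℝ → ℂ → ℂ}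
    {Φ : ℝ → X →ᵇ ℂ} {Φ' : X →ᵇ ℂ} {S : Set ℝ} {s₀ : ℝ} (hs₀ : s₀ ∈ S)
    (hf : ∀ s ∈ S, DiffContOnCl ℂ (f s) (Metric.ball c r))
    (hfΦ : ∀ s ∈ S, ∀ z (hz : z ∈ Metric.sphere c r), f s z = κ z * Φ s ⟨z, hX hz⟩)
    (hΦ : HasDerivWithinAt Φ Φ' S s₀) :
    ∃ g : ℂ → ℂ, DifferentiableOn ℂ g (Metric.ball c r) ∧
      ∀ w ∈ Metric.ball c r, HasDerivWithinAt (fun s => f s w) (g w) S s₀ := by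
  classical
  rcases le_or_gt r 0 with hr | hr
  · refine ⟨0, ?_, fun w hw => ?_⟩
    · rw [Metric.ball_eq_empty.2 hr]; exact differentiableOn_empty
    · rw [Metric.ball_eq_empty.2 hr] at hw; exact hw.elim
  -- The default value 0 off `X` only makes the circle integral well-formed; the circle itself lies
  -- in `X`.
  set ext : (X →ᵇ ℂ) → ℂ → ℂ := fun φ z => if h : z ∈ X then κ z * φ ⟨z, h⟩ else 0 with hext
  have hval : ∀ φ z (hz : z ∈ Metric.sphere c r), ext φ z = κ z * φ ⟨z, hX hz⟩ := fun φ z hz => by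
    simp only [hext, dif_pos (hX hz)]
  have hcont : ∀ φ, ContinuousOn (ext φ) (Metric.sphere c r) := fun φ => by
    rw [continuousOn_iff_continuous_domRestrict]
    have : (Metric.sphere c r).domRestrict (ext φ) =
        fun z : Metric.sphere c r => κ z * φ ⟨z, hX z.2⟩ := by
      ext z; exact hval φ z z.2
    rw [this]
    exact (hκ.comp continuous_subtype_val).mul
      (φ.continuous.comp (continuous_subtype_val.subtype_mk _))
  obtain ⟨K, hK⟩ := (isCompact_sphere c r).exists_bound_of_continuousOn hκ.continuousOn
  have hint : ∀ φ, ∀ w ∈ Metric.ball c r,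
      CircleIntegrable (fun ζ => (ζ - w)⁻¹ • ext φ ζ) c r := fun φ w hw => by
    apply ContinuousOn.circleIntegrable hr.le
    refine ContinuousOn.smul (ContinuousOn.inv₀ (continuous_id.sub continuous_const).continuousOn fun ζ hζ h => ?_) (hcont φ)
    have h := sub_eq_zero.1 h
    simp only [id] at h
    rw [← h, Metric.mem_ball, Metric.mem_sphere.1 hζ] at hw
    exact lt_irrefl _ hw
  have hK0 : 0 ≤ K := (norm_nonneg _).trans
    (hK (c + r) (by simp [abs_of_pos hr]))
  -- Cauchy's formula expresses the value at an interior point w as a bounded real-linear functional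
  -- of the boundary data, and such a functional commutes with the parameter derivative.
  set ℓ₀ : (w : ℂ) → w ∈ Metric.ball c r → ((X →ᵇ ℂ) →ₗ[ℝ] ℂ) := fun w hw =>
    { toFun := fun φ => (2 * Real.pi * Complex.I : ℂ)⁻¹ • ∮ ζ in C(c, r), (ζ - w)⁻¹ • ext φ ζ
      map_add' := fun φ ψ => by
        rw [← smul_add, ← circleIntegral.integral_add (hint φ w hw) (hint ψ w hw)]
        congr 1
        refine circleIntegral.integral_congr hr.le fun ζ hζ => ?_
        simp only [hval _ ζ hζ, BoundedContinuousFunction.coe_add, Pi.add_apply, smul_eq_mul]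
        ring
      map_smul' := fun a φ => by
        rw [RingHom.id_apply, smul_comm a, ← Complex.coe_smul a (∮ ζ in C(c, r), _)]
        rw [← circleIntegral.integral_smul (a : ℂ)]
        congr 1
        refine circleIntegral.integral_congr hr.le fun ζ hζ => ?_
        simp only [hval _ ζ hζ, BoundedContinuousFunction.coe_smul, smul_eq_mul, Complex.real_smul]
        ring } with hℓ₀
  have hbd : ∀ w (hw : w ∈ Metric.ball c r), ∃ B, ∀ φ, ‖ℓ₀ w hw φ‖ ≤ B * ‖φ‖ := fun w hw => by
    have hpos : 0 < r - dist w c := by have := Metric.mem_ball.1 hw; linarith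
    refine ⟨r * ((r - dist w c)⁻¹ * K), fun φ => ?_⟩
    have := circleIntegral.norm_two_pi_i_inv_smul_integral_le_of_norm_le_const hr.le
      (f := fun ζ => (ζ - w)⁻¹ • ext φ ζ) (c := c) (C := (r - dist w c)⁻¹ * K * ‖φ‖) (fun ζ hζ => by
        rw [norm_smul, norm_inv, hval φ ζ hζ, norm_mul, mul_assoc]
        have h1 : r - dist w c ≤ ‖ζ - w‖ := by
          have := dist_triangle_right ζ c w
          rw [Metric.mem_sphere.1 hζ, dist_comm c w] at *
          rw [← dist_eq_norm]
          have h2 := dist_triangle ζ w c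
          rw [Metric.mem_sphere.1 hζ] at h2
          linarith
        exact mul_le_mul (inv_anti₀ hpos h1)
          (mul_le_mul (hK ζ hζ) (φ.norm_coe_le_norm _) (norm_nonneg _) hK0)
          (by positivity) (by positivity))
    rw [mul_assoc]
    exact this
  choose B hB using hbd
  refine ⟨fun w => (2 * Real.pi * Complex.I : ℂ)⁻¹ • ∮ ζ in C(c, r), (ζ - w)⁻¹ • ext Φ' ζ, ?_, ?_⟩
  -- A Cauchy integral of a circle-integrable density is holomorphic inside the circle, whatever the
  -- density.
  · have hci : CircleIntegrable (ext Φ') c r := (hcont Φ').circleIntegrable hr.le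
    lift r to NNReal using hr.le
    have := hasFPowerSeriesOn_cauchy_integral hci (by exact_mod_cast hr)
    have h2 := this.differentiableOn
    rwa [Metric.eball_coe] at h2
  · intro w hw
    have h1 := ((ℓ₀ w hw).mkContinuous (B w hw) (hB w hw)).hasFDerivAt.comp_hasDerivWithinAt s₀ hΦ
    have h2 : ∀ s ∈ S, f s w = (ℓ₀ w hw) (Φ s) := fun s hs => by
      have h3 := (hf s hs).two_pi_i_inv_smul_circleIntegral_sub_inv_smul hw
      rw [← h3]
      simp only [hℓ₀, LinearMap.coe_mk, AddHom.coe_mk]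
      congr 1
      refine circleIntegral.integral_congr hr.le fun ζ hζ => ?_
      simp only [hval _ ζ hζ, hfΦ s hs ζ hζ]
    exact h1.congr h2 (h2 s₀ hs₀)

end ShortWave

namespace ShortWave

/-! ### Differentiating the jump and residue conditions with respect to a parameter -/

/-- The circle stays at distance `r` from all poles even if its centre is a pole, so Cauchy's
formula on it treats poles and regular points alike. -/
theorem RHData.exists_disc (D : RHData) {c : ℂ} (hc : c ∉ contour) :
    ∃ r > 0, Metric.sphere c r ⊆ D.away r ∧ Metric.closedBall c r \ {c} ⊆ D.domain ∧
      Metric.closedBall c r ⊆ contourᶜ := by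
  have hcl : IsClosed (contour ∪ (range D.pole \ {c})) :=
    isClosed_contour.union ((finite_range D.pole).subset sdiff_subset).isClosed
  have hmem : c ∈ (contour ∪ (range D.pole \ {c}))ᶜ := by simp [hc]
  obtain ⟨δ, hδ, hb⟩ := Metric.isOpen_iff.1 hcl.isOpen_compl c hmem
  have hsub : Metric.closedBall c (δ / 2) ⊆ Metric.ball c δ :=
    Metric.closedBall_subset_ball (by linarith)
  have h1 : Metric.closedBall c (δ / 2) ⊆ contourᶜ := fun z hz h =>
    hb (hsub hz) (Or.inl h)
  refine ⟨δ / 2, by positivity, fun z hz => ⟨h1 (Metric.sphere_subset_closedBall hz), fun k => ?_⟩,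
    fun z hz => RHData.mem_domain_iff.2 ⟨h1 hz.1, fun k hk => ?_⟩, h1⟩
  · by_cases hk : D.pole k = c
    · rw [hk, Metric.mem_sphere.1 hz]
    · have h2 : δ ≤ dist (D.pole k) c := by
        by_contra! h
        exact hb h (Or.inr ⟨mem_range_self k, hk⟩)
      have h3 := dist_triangle (D.pole k) z c
      rw [Metric.mem_sphere.1 hz, dist_comm _ z] at h3
      linarith
  · exact hb (hsub hz.1) (Or.inr ⟨⟨k, hk⟩, hz.2⟩)

/-- A one-parameter family, differentiable at `s₀` uniformly away from the poles. -/
structure DifferentiableFamily (D : RHData) (N : ℝ → ℂ → Mat) (S : Set ℝ) (s₀ : ℝ) : Prop where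
  uniqueDiff : UniqueDiffWithinAt ℝ S s₀
  mem : s₀ ∈ S
  exists_deriv : ∀ ε > 0, ∀ i j, ∃ (Φ : ℝ → D.away ε →ᵇ ℂ) (Φ' : D.away ε →ᵇ ℂ),
    (∀ s ∈ S, ∀ z, Φ s z = N s z i j) ∧ HasDerivWithinAt Φ Φ' S s₀

/-- The parameter derivative of a family of matrix functions. -/
noncomputable def paramDeriv (N : ℝ → ℂ → Mat) (S : Set ℝ) (s₀ : ℝ) (z : ℂ) : Mat :=
  Matrix.of fun i j => derivWithin (fun s => N s z i j) S s₀

namespace DifferentiableFamily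

variable {D : RHData} {N : ℝ → ℂ → Mat} {S : Set ℝ} {s₀ : ℝ}

theorem eval_hasDeriv {ε : ℝ} {i j : Fin 3} {Φ : ℝ → D.away ε →ᵇ ℂ} {Φ' : D.away ε →ᵇ ℂ}
    (hN : DifferentiableFamily D N S s₀)
    (h1 : ∀ s ∈ S, ∀ z, Φ s z = N s z i j) (h2 : HasDerivWithinAt Φ Φ' S s₀) (z : D.away ε) :
    HasDerivWithinAt (fun s => N s z i j) (Φ' z) S s₀ := by
  have := (BoundedContinuousFunction.evalCLM ℝ z).hasFDerivAt.comp_hasDerivWithinAt s₀ h2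
  exact this.congr (fun s hs => (h1 s hs z).symm) (h1 s₀ hN.mem z).symm

theorem hasDerivWithinAt (hN : DifferentiableFamily D N S s₀) {z : ℂ} (hz : z ∈ D.domain)
    (i j : Fin 3) : HasDerivWithinAt (fun s => N s z i j) (paramDeriv N S s₀ z i j) S s₀ := by
  obtain ⟨ε, hε, h⟩ := D.exists_dist_pole (RHData.mem_domain_iff.1 hz).2
  obtain ⟨Φ, Φ', h1, h2⟩ := hN.exists_deriv ε hε i j
  have := hN.eval_hasDeriv h1 h2
    ⟨z, (RHData.mem_domain_iff.1 hz).1, h z (Metric.mem_ball_self hε)⟩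
  have e : paramDeriv N S s₀ z i j = _ := this.derivWithin hN.uniqueDiff
  rw [e]
  exact this

/-- Away from the poles the parameter derivative is uniform in z, so it may be exchanged with a
limit in z. -/
theorem tendsto (hN : DifferentiableFamily D N S s₀) {l : Filter ℂ} [l.NeBot] {ε : ℝ} (hε : 0 < ε)
    (hl : ∀ᶠ z in l, z ∈ D.away ε) {i j : Fin 3} {L : ℝ → ℂ}
    (hL : ∀ s ∈ S, Tendsto (fun z => N s z i j) l (𝓝 (L s))) :
    ∃ L', Tendsto (fun z => paramDeriv N S s₀ z i j) l (𝓝 L') ∧ HasDerivWithinAt L L' S s₀ := by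
  obtain ⟨Φ, Φ', h1, h2⟩ := hN.exists_deriv ε hε i j
  have hr : range (Subtype.val : D.away ε → ℂ) ∈ l := by
    rw [Subtype.range_coe]; exact hl
  have hmap : map (Subtype.val : D.away ε → ℂ) (comap Subtype.val l) = l := map_comap_of_mem hr
  have hne : (comap (Subtype.val : D.away ε → ℂ) l).NeBot := ‹l.NeBot›.comap_of_range_mem hr
  obtain ⟨L', h3, h4⟩ := hasDerivWithinAt_limit hN.uniqueDiff hN.mem h2
    (l := comap (Subtype.val : D.away ε → ℂ) l) (L := L) (fun s hs => by
      have : (Φ s : D.away ε → ℂ) = (fun z => N s z i j) ∘ Subtype.val := by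
        ext z; exact h1 s hs z
      rw [this]
      exact (hL s hs).comp tendsto_comap)
  refine ⟨L', ?_, h4⟩
  rw [← hmap, tendsto_map'_iff]
  refine h3.congr fun z => ?_
  exact ((hN.eval_hasDeriv h1 h2 z).derivWithin hN.uniqueDiff).symm

theorem hasOriginLimits (hN : DifferentiableFamily D N S s₀)
    (h : ∀ s ∈ S, HasOriginLimits (N s)) : HasOriginLimits (paramDeriv N S s₀) := by
  intro ν
  obtain ⟨ε, hε, hb⟩ := D.exists_dist_pole
    (fun k => RHData.pole_ne_of_mem_contour (D := D) zero_mem_contour k)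
  rcases (𝓝[sector ν] (0 : ℂ)).eq_or_neBot with hbot | hne
  · exact ⟨0, by rw [hbot]; exact tendsto_bot⟩
  have hl : ∀ᶠ z in 𝓝[sector ν] (0 : ℂ), z ∈ D.away ε := by
    filter_upwards [self_mem_nhdsWithin, mem_nhdsWithin_of_mem_nhds (Metric.ball_mem_nhds 0 hε)]
      with z hz hzb using ⟨sector_subset ν hz, hb z hzb⟩
  choose! L hL using fun s hs => h s hs ν
  choose A hA _ using fun i j => hN.tendsto hε hl (i := i) (j := j) (L := fun s => L s i j)
    (fun s hs => JumpAndResidue.tendsto_entry.1 (hL s hs) i j)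
  exact ⟨Matrix.of A, JumpAndResidue.tendsto_entry.2 hA⟩

/-- The parameter derivative is taken in the uniform norm, so it is itself bounded away from the
poles. -/
theorem growth (hN : DifferentiableFamily D N S s₀) : GrowthAtInfinity D 0 (paramDeriv N S s₀) := by
  choose Φ Φ' h1 h2 using hN.exists_deriv 1 one_pos
  obtain ⟨B, hB⟩ := (finite_range D.pole).isBounded.exists_norm_le
  refine ⟨∑ i, ∑ j, ‖Φ' i j‖, B + 1, fun z hz hR i j => ?_⟩
  have hz1 : z ∈ D.away 1 := by
    refine ⟨(RHData.mem_domain_iff.1 hz).1, fun k => ?_⟩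
    have := hB _ (mem_range_self k)
    have := norm_sub_norm_le z (D.pole k)
    rw [dist_eq_norm]
    linarith
  have e : paramDeriv N S s₀ z i j = _ :=
    (hN.eval_hasDeriv (h1 i j) (h2 i j) ⟨z, hz1⟩).derivWithin hN.uniqueDiff
  rw [e, zpow_zero, mul_one]
  refine ((Φ' i j).norm_coe_le_norm _).trans ?_
  refine (Finset.single_le_sum (f := fun j => ‖Φ' i j‖) (fun _ _ => norm_nonneg _)
    (Finset.mem_univ j)).trans ?_
  exact Finset.single_le_sum (f := fun i => ∑ j, ‖Φ' i j‖)
    (fun _ _ => Finset.sum_nonneg fun _ _ => norm_nonneg _) (Finset.mem_univ i)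

/-- Holomorphy of the derivative near a point off the contour. -/
theorem exists_deriv_on_disc (hN : DifferentiableFamily D N S s₀) {c : ℂ} {r : ℝ} (hr : 0 < r)
    (hsph : Metric.sphere c r ⊆ D.away r) {i j : Fin 3} {κ : ℂ → ℂ} (hκ : Continuous κ)
    {f : ℝ → ℂ → ℂ} (hf : ∀ s ∈ S, DifferentiableOn ℂ (f s) (Metric.closedBall c r))
    (hfN : ∀ s ∈ S, ∀ z ∈ Metric.sphere c r, f s z = κ z * N s z i j) :
    ∃ g : ℂ → ℂ, DifferentiableOn ℂ g (Metric.ball c r) ∧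
      ∀ w ∈ Metric.ball c r, HasDerivWithinAt (fun s => f s w) (g w) S s₀ := by
  obtain ⟨Φ, Φ', h1, h2⟩ := hN.exists_deriv r hr i j
  refine exists_deriv_of_circle hsph hκ hN.mem (fun s hs => ?_) (fun s hs z hz => ?_) h2
  · exact DifferentiableOn.diffContOnCl_ball (hf s hs) subset_rfl
  · rw [hfN s hs z hz, h1 s hs]

variable {Y T : ℝ → ℝ} {Y' T' : ℝ}

/-- The point c may be a pole of D at which the chosen column is regular; the uniform hypothesis
says nothing there, and Cauchy's formula on a surrounding circle supplies the derivative. -/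
theorem analyticAt_paramDeriv (hN : DifferentiableFamily D N S s₀) {c : ℂ} (hc : c ∉ contour)
    {i j : Fin 3}
    (hdiff : ∀ s ∈ S, DifferentiableOn ℂ (fun z => N s z i j) D.domain)
    (han : ∀ s ∈ S, DifferentiableAt ℂ (fun z => N s z i j) c) :
    AnalyticAt ℂ (fun z => paramDeriv N S s₀ z i j) c ∧
      HasDerivWithinAt (fun s => N s c i j) (paramDeriv N S s₀ c i j) S s₀ := by
  obtain ⟨r, hr, h1, h2, h3⟩ := D.exists_disc hc
  have hdc : ∀ s ∈ S, DifferentiableOn ℂ (fun z => N s z i j) (Metric.closedBall c r) := by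
    intro s hs z hz
    by_cases hzc : z = c
    · rw [hzc]; exact (han s hs).differentiableWithinAt
    · have hzd : z ∈ D.domain := h2 ⟨hz, hzc⟩
      exact ((hdiff s hs).differentiableAt (D.isOpen_domain.mem_nhds hzd)).differentiableWithinAt
  obtain ⟨g, hg, hd⟩ := hN.exists_deriv_on_disc hr h1 (i := i) (j := j) (κ := fun _ => 1)
    continuous_const (f := fun s z => N s z i j) hdc (fun s hs z hz => by simp)
  have e : ∀ w ∈ Metric.ball c r, paramDeriv N S s₀ w i j = g w := fun w hw =>
    (hd w hw).derivWithin hN.uniqueDiff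
  refine ⟨(hg.analyticAt (Metric.ball_mem_nhds c hr)).congr ?_, ?_⟩
  · filter_upwards [Metric.ball_mem_nhds c hr] with w hw using (e w hw).symm
  · rw [e c (Metric.mem_ball_self hr)]
    exact hd c (Metric.mem_ball_self hr)

theorem hasDerivWithinAt_phase (hY : HasDerivWithinAt Y Y' S s₀) (hT : HasDerivWithinAt T T' S s₀)
    (z : ℂ) (j : Fin 3) :
    HasDerivWithinAt (fun s => phase (Y s) (T s) z j) (phase Y' T' z j) S s₀ := by
  have h1 := (hY.ofReal_comp).mul_const (lam j z)
  have h2 := (hT.ofReal_comp).mul_const (lam j z)⁻¹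
  exact h1.add h2

/-- Let Ψ be the diagonal matrix of phases. The function N exp(Ψ) has a jump and a residue relation
independent of the parameter, and so has its parameter derivative. Multiplying back by exp(-Ψ) gives
N' + NΨ'. The proof carries this out by differentiating the relations for N directly, which avoids
the essential singularity of exp(Ψ) at 0. -/
theorem jumpAndResidue (hN : DifferentiableFamily D N S s₀)
    (hJ : ∀ s ∈ S, JumpAndResidue D (Y s) (T s) (N s))
    (hY : HasDerivWithinAt Y Y' S s₀) (hT : HasDerivWithinAt T T' S s₀) :
    JumpAndResidue D (Y s₀) (T s₀)
      (fun z => paramDeriv N S s₀ z + N s₀ z * Matrix.diagonal (phase Y' T' z)) := by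
  have hψ : ∀ z ∉ contour, ∀ j, AnalyticAt ℂ (fun z => phase Y' T' z j) z := fun z hz j => by
    have hz0 : z ≠ 0 := by rintro rfl; exact hz zero_mem_contour
    have : lam j z ≠ 0 := mul_ne_zero hz0 (pow_ne_zero _ omega_ne_zero)
    have hl : AnalyticAt ℂ (lam j) z := analyticAt_id.mul analyticAt_const
    exact (analyticAt_const.mul hl).add (analyticAt_const.mul (hl.inv this))
  have hX : ∀ z i j, (paramDeriv N S s₀ z + N s₀ z * Matrix.diagonal (phase Y' T' z)) i j =
      paramDeriv N S s₀ z i j + N s₀ z i j * phase Y' T' z j := fun z i j => by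
    rw [Matrix.add_apply, Matrix.mul_diagonal]
  refine ⟨fun i j z hz => ?_, fun ν z hz => ?_, fun k i j hj => ?_, fun k i => ?_⟩
  · simp only [hX]
    have hzc := (RHData.mem_domain_iff.1 hz).1
    have hd : ∀ s ∈ S, DifferentiableAt ℂ (fun z => N s z i j) z := fun s hs =>
      ((hJ s hs).analytic i j).differentiableAt (D.isOpen_domain.mem_nhds hz)
    exact ((hN.analyticAt_paramDeriv hzc (fun s hs => (hJ s hs).analytic i j) hd).1.differentiableAt.add
      ((hd s₀ hN.mem).mul (hψ z hzc j).differentiableAt)).differentiableWithinAt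
  · have hne1 := neBot_sector_of_mem_ray hz
    have hne2 := neBot_sector_pred_of_mem_ray hz
    have hzc := ray_subset_contour ν hz
    obtain ⟨ε, hε, hb⟩ := D.exists_dist_pole (fun k => RHData.pole_ne_of_mem_contour hzc k)
    have hl : ∀ μ : ℤ, ∀ᶠ w in 𝓝[sector μ] z, w ∈ D.away ε := fun μ => by
      filter_upwards [self_mem_nhdsWithin, mem_nhdsWithin_of_mem_nhds (Metric.ball_mem_nhds z hε)]
        with w hw hwb using ⟨sector_subset μ hw, hb w hwb⟩
    choose! P Q hP hQ hPQ using fun s hs => (hJ s hs).jump ν z hz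
    choose P' hP' hPd using fun i j => hN.tendsto hε (hl ν) (i := i) (j := j)
      (L := fun s => P s i j) (fun s hs => JumpAndResidue.tendsto_entry.1 (hP s hs) i j)
    choose Q' hQ' hQd using fun i j => hN.tendsto hε (hl (ν - 1)) (i := i) (j := j)
      (L := fun s => Q s i j) (fun s hs => JumpAndResidue.tendsto_entry.1 (hQ s hs) i j)
    have hψz : ∀ j, Tendsto (fun w => phase Y' T' w j) (𝓝 z) (𝓝 (phase Y' T' z j)) := fun j => by
      have hz0 : lam j z ≠ 0 := mul_ne_zero (ne_zero_of_mem_ray hz) (pow_ne_zero _ omega_ne_zero)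
      have hl : Tendsto (lam j) (𝓝 z) (𝓝 (lam j z)) :=
        (continuous_id.mul continuous_const).tendsto z
      exact (hl.const_mul _).add ((hl.inv₀ hz0).const_mul _)
    refine ⟨Matrix.of fun i j => P' i j + P s₀ i j * phase Y' T' z j,
      Matrix.of fun i j => Q' i j + Q s₀ i j * phase Y' T' z j, ?_, ?_, ?_⟩
    · refine JumpAndResidue.tendsto_entry.2 fun i j => ?_
      simp only [hX]
      exact (hP' i j).add ((JumpAndResidue.tendsto_entry.1 (hP s₀ hN.mem) i j).mul
        ((hψz j).mono_left nhdsWithin_le_nhds))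
    · refine JumpAndResidue.tendsto_entry.2 fun i j => ?_
      simp only [hX]
      exact (hQ' i j).add ((JumpAndResidue.tendsto_entry.1 (hQ s₀ hN.mem) i j).mul
        ((hψz j).mono_left nhdsWithin_le_nhds))
    · have hjump : ∀ s i j, (Q s * D.jump (Y s) (T s) z) i j = ∑ k, Q s i k *
          (Complex.exp (phase (Y s) (T s) z k) * D.S₀ z k j *
            Complex.exp (-phase (Y s) (T s) z j)) := fun s i j => by
        simp only [RHData.jump, Matrix.mul_apply (M := Q s), Matrix.mul_diagonal,
          Matrix.diagonal_mul]
      ext i j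
      have hd : HasDerivWithinAt (fun s => ∑ k, Q s i k *
          (Complex.exp (phase (Y s) (T s) z k) * D.S₀ z k j *
            Complex.exp (-phase (Y s) (T s) z j))) _ S s₀ :=
        HasDerivWithinAt.fun_sum fun k _ => (hQd i k).fun_mul
          (((hasDerivWithinAt_phase hY hT z k).cexp.mul_const (D.S₀ z k j)).fun_mul
            (hasDerivWithinAt_phase hY hT z j).fun_neg.cexp)
      -- Both sides are the derivative of the same boundary value, once as a limit from the left
      -- sector and once through the jump relation.
      have e : P' i j = _ := hN.uniqueDiff.eq_deriv _ (hPd i j)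
        (hd.congr (fun s hs => by rw [hPQ s hs, hjump]) (by rw [hPQ s₀ hN.mem, hjump]))
      simp only [Matrix.of_apply, RHData.jump]
      rw [Matrix.mul_apply, e, hPQ s₀ hN.mem, hjump, Finset.sum_mul, ← Finset.sum_add_distrib]
      refine Finset.sum_congr rfl fun k _ => ?_
      simp only [Matrix.of_apply, Matrix.mul_diagonal, Matrix.diagonal_mul]
      ring
  · simp only [hX]
    have ha := fun s hs => (hJ s hs).regular_columns k i j hj
    exact (hN.analyticAt_paramDeriv (D.pole_notMem k) (fun s hs => (hJ s hs).analytic i j)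
      (fun s hs => (ha s hs).differentiableAt)).1.add ((ha s₀ hN.mem).mul (hψ _ (D.pole_notMem k) j))
  · set c := D.pole k with hc
    set R : ℝ → ℂ := fun s => N s c i (D.src k) * D.coef k *
      Complex.exp (phase (Y s) (T s) c (D.src k) - phase (Y s) (T s) c (D.col k)) with hR
    have hRd : HasDerivWithinAt R (paramDeriv N S s₀ c i (D.src k) * D.coef k *
        Complex.exp (phase (Y s₀) (T s₀) c (D.src k) - phase (Y s₀) (T s₀) c (D.col k)) +
        R s₀ * (phase Y' T' c (D.src k) - phase Y' T' c (D.col k))) S s₀ := by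
      have h1 := (hN.analyticAt_paramDeriv (D.pole_notMem k)
        (fun s hs => (hJ s hs).analytic i (D.src k)) (fun s hs =>
          ((hJ s hs).regular_columns k i _ (D.src_ne_col k)).differentiableAt)).2
      have h2 := (h1.mul_const (D.coef k)).fun_mul ((hasDerivWithinAt_phase hY hT c (D.src k)).fun_sub
        (hasDerivWithinAt_phase hY hT c (D.col k))).cexp
      refine h2.congr_deriv ?_
      simp only [hR]
      ring
    obtain ⟨r, hr, h1, h2, h3⟩ := D.exists_disc (D.pole_notMem k)
    rw [← hc] at h1 h2 h3
    -- The product (z - c)N, completed at the pole by its limit, has a removable singularity. Its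
    -- parameter derivative at c is then the derivative of the residue.
    set f : ℝ → ℂ → ℂ := fun s => Function.update (fun z => (z - c) * N s z i (D.col k)) c (R s)
      with hf
    have hfne : ∀ s, ∀ z ≠ c, f s z = (z - c) * N s z i (D.col k) := fun s z hz => by
      simp only [hf, Function.update_of_ne hz]
    obtain ⟨g, hg, hd⟩ := hN.exists_deriv_on_disc hr h1 (i := i) (j := D.col k)
      (κ := fun z => z - c) (continuous_id.sub continuous_const) (f := f) (fun s hs => by
        refine (Complex.differentiableOn_compl_singleton_and_continuousAt_iff
          (Metric.closedBall_mem_nhds c hr)).1 ⟨?_, ?_⟩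
        · refine DifferentiableOn.congr (f := fun z => (z - c) * N s z i (D.col k)) ?_
            fun z hz => hfne s z hz.2
          exact (differentiableOn_id.sub (differentiableOn_const c)).mul
            (((hJ s hs).analytic i (D.col k)).mono h2)
        · exact continuousAt_update_same.2 ((hJ s hs).residue k i))
      (fun s hs z hz => hfne s z fun h => by
        rw [h, Metric.mem_sphere, dist_self] at hz
        exact hr.ne hz)
    have hgc : g c = _ := hN.uniqueDiff.eq_deriv _
      ((hd c (Metric.mem_ball_self hr)).congr (f₁ := R) (fun s hs => by simp [hf]) (by simp [hf])) hRd
    have hgw : ∀ w ∈ Metric.ball c r, w ≠ c → g w = (w - c) * paramDeriv N S s₀ w i (D.col k) := by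
      intro w hw hwc
      have hwd : w ∈ D.domain := h2 ⟨Metric.ball_subset_closedBall hw, hwc⟩
      refine hN.uniqueDiff.eq_deriv _ (hd w hw) ?_
      exact ((hN.hasDerivWithinAt hwd i (D.col k)).const_mul (w - c)).congr
        (fun s _ => hfne s w hwc) (hfne s₀ w hwc)
    have hgt : Tendsto (fun z => (z - c) * paramDeriv N S s₀ z i (D.col k)) (𝓝[≠] c) (𝓝 (g c)) := by
      have := (hg.continuousOn.continuousAt (Metric.ball_mem_nhds c hr)).tendsto
      refine (this.mono_left nhdsWithin_le_nhds).congr' ?_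
      filter_upwards [self_mem_nhdsWithin, mem_nhdsWithin_of_mem_nhds (Metric.ball_mem_nhds c hr)]
        with w hw hwb using hgw w hwb hw
    have hψc : Tendsto (fun w => phase Y' T' w (D.col k)) (𝓝[≠] c) (𝓝 (phase Y' T' c (D.col k))) :=
      (hψ c (D.pole_notMem k) (D.col k)).continuousAt.tendsto.mono_left nhdsWithin_le_nhds
    have := hgt.add (((hJ s₀ hN.mem).residue k i).mul hψc)
    simp only [hX]
    refine (this.congr fun z => by ring).trans (le_of_eq ?_)
    rw [hgc]
    simp only [hR]
    congr 1
    ring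

end DifferentiableFamily

end ShortWave

namespace ShortWave

/-! ### The Lax pair -/

/-- `Λ(z) = z J`. -/
noncomputable def Jmat : Mat := Matrix.diagonal fun j => omega ^ ((j : ℕ) + 1)

/-- The inverse of `J`. -/
noncomputable def Jinv : Mat := Matrix.diagonal fun j => (omega ^ ((j : ℕ) + 1))⁻¹

theorem phase_one_zero (z : ℂ) :
    (Matrix.diagonal (phase 1 0 z) : Mat) = z • Jmat := by
  ext i j
  by_cases h : i = j
  · subst h; simp [Jmat, phase, lam]
  · simp [Jmat, h]

theorem phase_zero_one (z : ℂ) :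
    (Matrix.diagonal (phase 0 1 z) : Mat) = z⁻¹ • Jinv := by
  ext i j
  by_cases h : i = j
  · subst h; simp [Jinv, phase, lam, mul_comm]
  · simp [Jinv, h]

theorem HasOriginLimits.congr {M N : ℂ → Mat} (h : ∀ z ≠ 0, M z = N z) (hM : HasOriginLimits M) :
    HasOriginLimits N := fun ν => by
  obtain ⟨A, hA⟩ := hM ν
  refine ⟨A, hA.congr' ?_⟩
  filter_upwards [self_mem_nhdsWithin] with z hz
  exact h z fun h0 => sector_subset ν hz (h0 ▸ zero_mem_contour)

theorem HasOriginLimits.mul_const {M : ℂ → Mat} (A : Mat) (hM : HasOriginLimits M) :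
    HasOriginLimits fun z => M z * A := fun ν => by
  obtain ⟨B, hB⟩ := hM ν
  exact ⟨B * A, (continuous_id.matrix_mul continuous_const).tendsto B |>.comp hB⟩

theorem GrowthAtInfinity.congr {D : RHData} {k : ℤ} {M N : ℂ → Mat}
    (h : ∀ z ∈ D.domain, M z = N z) (hM : GrowthAtInfinity D k M) : GrowthAtInfinity D k N := by
  obtain ⟨C, R, hC⟩ := hM
  exact ⟨C, R, fun z hz hR i j => h z hz ▸ hC z hz hR i j⟩

theorem RHData.ne_zero_of_mem_domain {D : RHData} {z : ℂ} (hz : z ∈ D.domain) : z ≠ 0 := by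
  rintro rfl
  exact (RHData.mem_domain_iff.1 hz).1 zero_mem_contour

/-- The filter of neighbourhoods of infinity in the domain. -/
noncomputable def RHData.atInfinity (D : RHData) : Filter ℂ := comap norm atTop ⊓ 𝓟 D.domain

theorem RHData.atInfinity_neBot (D : RHData) : D.atInfinity.NeBot := by
  rw [RHData.atInfinity, inf_principal_neBot_iff]
  intro U hU
  obtain ⟨V, hV, hVU⟩ := mem_comap.1 hU
  obtain ⟨R, hR⟩ := mem_atTop_sets.1 hV
  obtain ⟨z, hz, hzR⟩ := D.exists_mem_domain R
  exact ⟨z, hVU (hR _ hzR), hz⟩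

theorem IsRHSolution.tendsto_atInfinity {D : RHData} {y t : ℝ} {M : ℂ → Mat}
    (hM : IsRHSolution D y t M) : Tendsto M D.atInfinity (𝓝 1) := by
  refine JumpAndResidue.tendsto_entry.2 fun i j => ?_
  obtain ⟨C, R, h⟩ := hM.normalization
  rw [tendsto_iff_norm_sub_tendsto_zero]
  have hn : Tendsto (fun z : ℂ => ‖z‖) D.atInfinity atTop := tendsto_comap.mono_left inf_le_left
  refine squeeze_zero' (Eventually.of_forall fun _ => norm_nonneg _) ?_
    (hn.const_div_atTop C)
  filter_upwards [hn.eventually_ge_atTop R, mem_inf_of_right (mem_principal_self D.domain)]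
    with z hR hz using h z hz hR i j

section Lax

variable {D : RHData} {M : ℝ → ℝ → ℂ → Mat}

theorem uniqueDiffOn_halfPlane : UniqueDiffOn ℝ halfPlane := by
  have : halfPlane = univ ×ˢ Ici (0 : ℝ) := by
    ext p; simp [halfPlane]
  rw [this]
  exact uniqueDiffOn_univ.prod (uniqueDiffOn_Ici 0)

theorem ClassicalDependence.family_y (hreg : ClassicalDependence D M) {t : ℝ} (ht : 0 ≤ t) (y : ℝ) :
    DifferentiableFamily D (fun η => M η t) univ y where
  uniqueDiff := uniqueDiffWithinAt_univ
  mem := mem_univ y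
  exists_deriv ε hε i j := by
    obtain ⟨F, h1, h2, -⟩ := hreg ε hε i j
    have hd := ((h2.differentiableOn two_ne_zero) (y, t) ht).hasFDerivWithinAt
    have hc : HasDerivWithinAt (fun η : ℝ => (η, t)) ((1 : ℝ), (0 : ℝ)) univ y :=
      (hasDerivWithinAt_id y univ).prodMk (hasDerivWithinAt_const y univ t)
    exact ⟨fun η => F (η, t), _, fun s _ z => h1 (s, t) ht z,
      hd.comp_hasDerivWithinAt (t := halfPlane) y hc fun s _ => ht⟩

theorem ClassicalDependence.family_t (hreg : ClassicalDependence D M) {t : ℝ} (ht : 0 ≤ t) (y : ℝ) :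
    DifferentiableFamily D (fun s => M y s) (Ici 0) t where
  uniqueDiff := uniqueDiffOn_Ici 0 t ht
  mem := ht
  exists_deriv ε hε i j := by
    obtain ⟨F, h1, h2, -⟩ := hreg ε hε i j
    have hd := ((h2.differentiableOn two_ne_zero) (y, t) ht).hasFDerivWithinAt
    have hc : HasDerivWithinAt (fun s : ℝ => (y, s)) ((0 : ℝ), (1 : ℝ)) (Ici 0) t :=
      (hasDerivWithinAt_const t _ y).prodMk (hasDerivWithinAt_id t _)
    exact ⟨fun s => F (y, s), _, fun s hs z => h1 (y, s) hs z,
      hd.comp_hasDerivWithinAt (t := halfPlane) t hc fun s hs => hs⟩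

theorem eventually_away_zero (D : RHData) :
    ∃ ε > 0, ∀ᶠ z in 𝓝[contourᶜ] (0 : ℂ), z ∈ D.away ε := by
  obtain ⟨ε, hε, hb⟩ := D.exists_dist_pole
    (fun k => RHData.pole_ne_of_mem_contour (D := D) zero_mem_contour k)
  refine ⟨ε, hε, ?_⟩
  filter_upwards [self_mem_nhdsWithin, mem_nhdsWithin_of_mem_nhds (Metric.ball_mem_nhds 0 hε)]
    with z hz hzb using ⟨hz, hb z hzb⟩

/-- Limits at the origin along the whole complement of the contour. -/
theorem DifferentiableFamily.tendsto_zero {N : ℝ → ℂ → Mat} {S : Set ℝ} {s₀ : ℝ}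
    (hN : DifferentiableFamily D N S s₀) {G : ℝ → Mat}
    (hG : ∀ s ∈ S, Tendsto (N s) (𝓝[contourᶜ] 0) (𝓝 (G s))) :
    ∃ G' : Mat, Tendsto (paramDeriv N S s₀) (𝓝[contourᶜ] 0) (𝓝 G') ∧
      ∀ i j, HasDerivWithinAt (fun s => G s i j) (G' i j) S s₀ := by
  have := neBot_contour_compl
  obtain ⟨ε, hε, hl⟩ := eventually_away_zero D
  choose A hA hA' using fun i j => hN.tendsto hε hl (i := i) (j := j) (L := fun s => G s i j)
    (fun s hs => JumpAndResidue.tendsto_entry.1 (hG s hs) i j)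
  exact ⟨Matrix.of A, JumpAndResidue.tendsto_entry.2 hA, hA'⟩

theorem tendsto_id_zero : Tendsto (fun z : ℂ => z) (𝓝[contourᶜ] 0) (𝓝 0) :=
  tendsto_id.mono_left nhdsWithin_le_nhds

theorem Tendsto.matrix_const_mul {l : Filter ℂ} {N : ℂ → Mat} {B : Mat} (A : Mat)
    (h : Tendsto N l (𝓝 B)) : Tendsto (fun z => A * N z) l (𝓝 (A * B)) :=
  (continuous_const.matrix_mul continuous_id).tendsto B |>.comp h

theorem Tendsto.matrix_mul_const {l : Filter ℂ} {N : ℂ → Mat} {B : Mat} (A : Mat)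
    (h : Tendsto N l (𝓝 B)) : Tendsto (fun z => N z * A) l (𝓝 (B * A)) :=
  (continuous_id.matrix_mul continuous_const).tendsto B |>.comp h

/-- The function P + zUJ - zJU satisfies the jump and residue conditions, and is bounded because U
is I + O(1/z). After subtraction of a suitable CU it has a zero, so it equals CU. At z = 0 the terms
with a factor z drop out, leaving G_y = CG. -/
theorem lax_y (hM : ∀ y t : ℝ, 0 ≤ t → IsUniqueRHSolution D y t (M y t))
    (hreg : ClassicalDependence D M) {G : ℝ → ℝ → Mat}
    (hG : ∀ y t : ℝ, 0 ≤ t → Tendsto (M y t) (𝓝[contourᶜ] 0) (𝓝 (G y t)))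
    (y : ℝ) {t : ℝ} (ht : 0 ≤ t) :
    ∃ C : Mat, (∀ z ∈ D.domain, ∀ i j, HasDerivAt (fun η => M η t z i j)
        ((z • (Jmat * M y t z - M y t z * Jmat) + C * M y t z) i j) y) ∧
      ∀ i j, HasDerivAt (fun η => G η t i j) ((C * G y t) i j) y := by
  have hfam := hreg.family_y ht y
  have hJ := hfam.jumpAndResidue (Y := fun η => η) (T := fun _ => t)
    (fun η _ => (hM η t ht).1.jumpAndResidue) (hasDerivWithinAt_id y univ)
    (hasDerivWithinAt_const y univ t)
  set P : ℂ → Mat := paramDeriv (fun η => M η t) univ y with hP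
  set U : ℂ → Mat := M y t with hU
  have hu := hM y t ht
  simp only [phase_one_zero] at hJ
  obtain ⟨z₀, hz₀, -⟩ := D.exists_mem_domain 0
  set X : ℂ → Mat := fun z => (P z + U z * z • Jmat) + (-Jmat) * (z • U z) with hX
  -- Chosen so that X - CU vanishes at `z₀`.
  set C : Mat := X z₀ * (U z₀)⁻¹ with hC
  have hXJ : JumpAndResidue D y t X :=
    hJ.add ((hu.1.jumpAndResidue.smul differentiable_id).const_mul (-Jmat))
  have hP0 : HasOriginLimits P := hfam.hasOriginLimits fun η _ => (hM η t ht).1.origin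
  have hU0 : HasOriginLimits U := hu.1.origin
  have hX0 : HasOriginLimits X := by
    refine (hP0.add ((hU0.smul continuous_id).mul_const Jmat)).add
      ((hU0.smul continuous_id).const_mul (-Jmat)) |>.congr fun z _ => ?_
    simp only [hX, id, Matrix.smul_mul, Matrix.mul_smul]
  have hXg : GrowthAtInfinity D 0 X := by
    have h1 : GrowthAtInfinity D 0 fun z => z • (U z * Jmat - Jmat * U z) := by
      obtain ⟨B, R, h⟩ := hu.1.normalization
      refine ⟨2 * B, max R 1, fun z hz hR i j => ?_⟩
      have hz1 : 0 < ‖z‖ := by linarith [(le_max_right R 1).trans hR]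
      -- The identity commutes with J, so only U - I = O(1/z) enters the commutator and absorbs the
      -- factor z.
      have e : (z • (U z * Jmat - Jmat * U z)) i j = z * ((U z i j - (1 : Mat) i j) *
          (omega ^ ((j : ℕ) + 1) - omega ^ ((i : ℕ) + 1))) := by
        rw [Matrix.smul_apply, Matrix.sub_apply, Jmat, Matrix.mul_diagonal, Matrix.diagonal_mul,
          smul_eq_mul]
        by_cases hij : i = j
        · subst hij; ring
        · rw [Matrix.one_apply_ne hij]; ring
      have hω : ‖omega‖ = 1 := by
        have := congrArg norm omega_cube
        rw [norm_pow, norm_one] at this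
        exact (pow_eq_one_iff_of_nonneg (norm_nonneg _) three_ne_zero).1 this
      have hd : ‖omega ^ ((j : ℕ) + 1) - omega ^ ((i : ℕ) + 1)‖ ≤ 2 := by
        refine (norm_sub_le _ _).trans ?_
        rw [norm_pow, norm_pow, hω, one_pow, one_pow]
        norm_num
      beta_reduce
      rw [e, norm_mul, norm_mul, zpow_zero, mul_one]
      have h2 := h z hz ((le_max_left _ _).trans hR) i j
      calc ‖z‖ * (‖U z i j - (1 : Mat) i j‖ * _) ≤ ‖z‖ * (B / ‖z‖ * 2) := by
            refine mul_le_mul_of_nonneg_left ?_ hz1.le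
            exact mul_le_mul h2 hd (norm_nonneg _) ((norm_nonneg _).trans h2)
        _ = 2 * B := by field_simp
    refine (hfam.growth.add h1).congr fun z _ => ?_
    simp only [hX, Matrix.mul_smul, neg_mul, smul_sub, ← hP]
    abel
  have hunit := hu.isUnit_det hz₀
  have hzero := hu.eq_zero_of_bounded (hXJ.add (hu.1.jumpAndResidue.const_mul (-C)))
    (hX0.add (hU0.const_mul _)) (hXg.add (hu.growth.const_mul _)) hz₀ (by
      rw [neg_mul, hC, mul_assoc, Matrix.nonsing_inv_mul _ hunit, mul_one, add_neg_cancel])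
  have hPeq : ∀ z ∈ D.domain, P z = z • (Jmat * U z - U z * Jmat) + C * U z := by
    intro z hz
    have := hzero z hz
    simp only [hX, neg_mul, Matrix.mul_smul] at this
    rw [smul_sub]
    have h2 := eq_neg_of_add_eq_zero_left this
    rw [neg_neg] at h2
    rw [← h2]
    abel
  refine ⟨C, fun z hz i j => ?_, ?_⟩
  · rw [← hPeq z hz]
    exact (hfam.hasDerivWithinAt hz i j).hasDerivAt univ_mem
  · obtain ⟨G', h1, h2⟩ := hfam.tendsto_zero (G := fun η => G η t) fun η _ => hG η t ht
    have := neBot_contour_compl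
    have h3 : Tendsto P (𝓝[contourᶜ] 0) (𝓝 (C * G y t)) := by
      have hUG := hG y t ht
      have := (tendsto_id_zero.smul ((Tendsto.matrix_const_mul Jmat hUG).sub
        (Tendsto.matrix_mul_const Jmat hUG))).add (Tendsto.matrix_const_mul C hUG)
      rw [zero_smul, zero_add] at this
      refine this.congr' ?_
      filter_upwards [RHData.eventually_mem_domain (D := D) zero_mem_contour] with z hz
        using (hPeq z hz).symm
    have e := tendsto_nhds_unique h1 h3
    intro i j
    rw [← e]
    exact (h2 i j).hasDerivAt univ_mem

/-- The phase derivative has a simple pole at 0, removed by a factor z at the price of linear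
growth. Comparison then gives z(P + z⁻¹UJ⁻¹) = (A + zC)U with two unknown matrices, fixed by two
points. At infinity C is the limit of P, which vanishes because U tends to I for every t; at 0 one
is left with AG = GJ⁻¹. -/
theorem lax_t (hM : ∀ y t : ℝ, 0 ≤ t → IsUniqueRHSolution D y t (M y t))
    (hreg : ClassicalDependence D M) {G : ℝ → ℝ → Mat}
    (hG : ∀ y t : ℝ, 0 ≤ t → Tendsto (M y t) (𝓝[contourᶜ] 0) (𝓝 (G y t)))
    (y : ℝ) {t : ℝ} (ht : 0 ≤ t) :
    ∃ A : Mat, (∀ z ∈ D.domain, ∀ i j, HasDerivWithinAt (fun s => M y s z i j)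
        ((z⁻¹ • (A * M y t z - M y t z * Jinv)) i j) (Ici 0) t) ∧
      A * G y t = G y t * Jinv := by
  have hfam := hreg.family_t ht y
  have hJ := hfam.jumpAndResidue (Y := fun _ => y) (T := fun s => s)
    (fun s hs => (hM y s hs).1.jumpAndResidue) (hasDerivWithinAt_const t _ y)
    (hasDerivWithinAt_id t _)
  set P : ℂ → Mat := paramDeriv (fun s => M y s) (Ici 0) t with hP
  set U : ℂ → Mat := M y t with hU
  have hu := hM y t ht
  simp only [phase_zero_one] at hJ
  obtain ⟨z₀, hz₀, -⟩ := D.exists_mem_domain 0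
  -- A larger modulus makes the second point distinct from the first.
  obtain ⟨z₁, hz₁, hz₁R⟩ := D.exists_mem_domain (‖z₀‖ + 1)
  have hne : z₁ - z₀ ≠ 0 := by
    rw [sub_ne_zero]
    rintro rfl
    linarith
  set X : ℂ → Mat := fun z => z • (P z + U z * z⁻¹ • Jinv) with hX
  have hXeq : ∀ z ≠ 0, z • P z + U z * Jinv = X z := fun z hz => by
    simp only [hX, smul_add, Matrix.mul_smul, smul_smul, mul_inv_cancel₀ hz, one_smul]
  set B₀ : Mat := X z₀ * (U z₀)⁻¹ with hB₀
  set B₁ : Mat := X z₁ * (U z₁)⁻¹ with hB₁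
  -- A + zC is the linear interpolant of XU⁻¹ at the two points.
  set C : Mat := (z₁ - z₀)⁻¹ • (B₁ - B₀) with hC
  set A : Mat := B₀ - z₀ • C with hA
  have hAB₁ : A + z₁ • C = B₁ := by
    have : (z₁ - z₀) • C = B₁ - B₀ := by rw [hC, smul_smul, mul_inv_cancel₀ hne, one_smul]
    rw [sub_smul] at this
    rw [hA, sub_add_eq_add_sub, add_sub_assoc, this]
    abel
  have hXJ : JumpAndResidue D y t X := hJ.smul differentiable_id
  have hP0 : HasOriginLimits P := hfam.hasOriginLimits fun s hs => (hM y s hs).1.origin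
  have hU0 : HasOriginLimits U := hu.1.origin
  have hX0 : HasOriginLimits X :=
    ((hP0.smul continuous_id).add (hU0.mul_const Jinv)).congr hXeq
  have hUJ : GrowthAtInfinity D 0 fun z => U z * Jinv := by
    obtain ⟨K, R, h⟩ := hu.growth
    refine ⟨∑ j : Fin 3, ‖(omega ^ ((j : ℕ) + 1))⁻¹‖ * K, R, fun z hz hR i j => ?_⟩
    have h1 := h z hz hR i j
    rw [zpow_zero, mul_one] at h1 ⊢
    beta_reduce
    rw [Jinv, Matrix.mul_diagonal, norm_mul, mul_comm]
    have hK : 0 ≤ K := (norm_nonneg _).trans h1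
    refine (mul_le_mul_of_nonneg_left h1 (norm_nonneg _)).trans ?_
    exact Finset.single_le_sum (f := fun j : Fin 3 => ‖(omega ^ ((j : ℕ) + 1))⁻¹‖ * K)
      (fun _ _ => by positivity) (Finset.mem_univ j)
  have hXg : GrowthAtInfinity D 1 X :=
    (hfam.growth.id_smul.add (hUJ.mono zero_le_one)).congr fun z hz =>
      hXeq z (RHData.ne_zero_of_mem_domain hz)
  have hinv : ∀ z ∈ D.domain, X z * (U z)⁻¹ * U z = X z := fun z hz => by
    rw [mul_assoc, Matrix.nonsing_inv_mul _ (hu.isUnit_det hz), mul_one]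
  have hzero := hu.eq_zero_of_linear_growth
    ((hXJ.add (hu.1.jumpAndResidue.const_mul (-A))).add
      ((hu.1.jumpAndResidue.smul differentiable_id).const_mul (-C)))
    ((hX0.add (hU0.const_mul _)).add ((hU0.smul continuous_id).const_mul _))
    ((hXg.add ((hu.growth.const_mul _).mono zero_le_one)).add (hu.growth.id_smul.const_mul _))
    hz₀ hz₁ (fun h => hne (by rw [h, sub_self])) (by
      rw [id, Matrix.mul_smul, neg_mul, neg_mul, smul_neg, ← Matrix.smul_mul, ← hinv z₀ hz₀, ← hB₀, hA,
        sub_mul]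
      abel) (by
      rw [id, Matrix.mul_smul, neg_mul, neg_mul, smul_neg, ← Matrix.smul_mul, ← hinv z₁ hz₁, ← hB₁,
        ← hAB₁, add_mul]
      abel)
  have hXAC : ∀ z ∈ D.domain, z • P z + U z * Jinv = A * U z + z • (C * U z) := by
    intro z hz
    have := hzero z hz
    simp only [id, neg_mul, Matrix.mul_smul] at this
    rw [hXeq z (RHData.ne_zero_of_mem_domain hz)]
    rw [← sub_eq_zero, ← this]
    abel
  have hC0 : C = 0 := by
    have hne := D.atInfinity_neBot
    have hn : Tendsto (fun z : ℂ => ‖z‖) D.atInfinity atTop := tendsto_comap.mono_left inf_le_left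
    have hdom : ∀ᶠ z in D.atInfinity, z ∈ D.domain := mem_inf_of_right (mem_principal_self _)
    have hinv0 : Tendsto (fun z : ℂ => z⁻¹) D.atInfinity (𝓝 0) := by
      rw [tendsto_zero_iff_norm_tendsto_zero]
      simp only [norm_inv]
      exact hn.inv_tendsto_atTop
    have hl : ∀ᶠ z in D.atInfinity, z ∈ D.away 1 := by
      obtain ⟨B, hB⟩ := (finite_range D.pole).isBounded.exists_norm_le
      filter_upwards [hdom, hn.eventually_ge_atTop (B + 1)] with z hz hR
      refine ⟨(RHData.mem_domain_iff.1 hz).1, fun k => ?_⟩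
      have := hB _ (mem_range_self k)
      have := norm_sub_norm_le z (D.pole k)
      rw [dist_eq_norm]
      linarith
    -- The limit of M at infinity is I for all t, and limits at infinity commute with the
    -- t-derivative.
    have hP1 : Tendsto P D.atInfinity (𝓝 0) := by
      refine JumpAndResidue.tendsto_entry.2 fun i j => ?_
      obtain ⟨L', h1, h2⟩ := hfam.tendsto one_pos hl (i := i) (j := j)
        (L := fun _ => (1 : Mat) i j) (fun s hs =>
          JumpAndResidue.tendsto_entry.1 (hM y s hs).1.tendsto_atInfinity i j)
      have e := hfam.uniqueDiff.eq_deriv _ h2 (hasDerivWithinAt_const t (Ici 0) ((1 : Mat) i j))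
      rw [e] at h1
      exact h1
    have hU1 : Tendsto U D.atInfinity (𝓝 1) := hu.1.tendsto_atInfinity
    have h1 : Tendsto (fun z => P z + z⁻¹ • (U z * Jinv) - z⁻¹ • (A * U z)) D.atInfinity
        (𝓝 (0 + (0 : ℂ) • (1 * Jinv) - (0 : ℂ) • (A * 1))) :=
      (hP1.add (hinv0.smul (Tendsto.matrix_mul_const Jinv hU1))).sub
        (hinv0.smul (Tendsto.matrix_const_mul A hU1))
    have h2 : Tendsto (fun z => P z + z⁻¹ • (U z * Jinv) - z⁻¹ • (A * U z)) D.atInfinity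
        (𝓝 (C * 1)) := by
      refine (Tendsto.matrix_const_mul C hU1).congr' ?_
      filter_upwards [hdom] with z hz
      have hz0 := RHData.ne_zero_of_mem_domain hz
      have h3 := congrArg (fun B => z⁻¹ • B) (hXAC z hz)
      simp only [smul_add, smul_smul, inv_mul_cancel₀ hz0, one_smul] at h3
      rw [h3]
      abel
    have := tendsto_nhds_unique h2 h1
    simpa using this
  have hPeq : ∀ z ∈ D.domain, P z = z⁻¹ • (A * U z - U z * Jinv) := by
    intro z hz
    have h3 := hXAC z hz
    rw [hC0, zero_mul, smul_zero, add_zero] at h3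
    rw [← h3, add_sub_cancel_right, smul_smul,
      inv_mul_cancel₀ (RHData.ne_zero_of_mem_domain hz), one_smul]
  refine ⟨A, fun z hz i j => ?_, ?_⟩
  · rw [← hPeq z hz]
    exact hfam.hasDerivWithinAt hz i j
  · obtain ⟨G', h1, -⟩ := hfam.tendsto_zero (G := fun s => G y s) fun s hs => hG y s hs
    have := neBot_contour_compl
    have hUG := hG y t ht
    have h3 : Tendsto (fun z => z • P z + U z * Jinv) (𝓝[contourᶜ] 0)
        (𝓝 ((0 : ℂ) • G' + G y t * Jinv)) :=
      (tendsto_id_zero.smul h1).add (Tendsto.matrix_mul_const Jinv hUG)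
    have h4 : Tendsto (fun z => z • P z + U z * Jinv) (𝓝[contourᶜ] 0) (𝓝 (A * G y t)) := by
      refine (Tendsto.matrix_const_mul A hUG).congr' ?_
      filter_upwards [RHData.eventually_mem_domain (D := D) zero_mem_contour] with z hz
      rw [hXAC z hz, hC0, zero_mul, smul_zero, add_zero]
    have := tendsto_nhds_unique h4 h3
    rwa [zero_smul, zero_add] at this

end Lax

end ShortWave

namespace ShortWave

/-! ### Functions of class `C²` on the half-plane with bounded derivatives -/

/-- Class `C²` on `t ≥ 0` with derivatives bounded on the sets `y ≥ a`, `0 ≤ t ≤ T`. -/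
def RegularOnHalfPlane {E : Type*} [NormedAddCommGroup E] [NormedSpace ℝ E] (f : ℝ × ℝ → E) :
    Prop :=
  ContDiffOn ℝ 2 f halfPlane ∧
    ∀ a T : ℝ, ∃ K : ℝ, ∀ p ∈ halfPlane, a ≤ p.1 → p.2 ≤ T → ∀ k : ℕ, k ≤ 2 →
      ‖iteratedFDerivWithin ℝ k f halfPlane p‖ ≤ K

section Regular

variable {E F : Type*} [NormedAddCommGroup E] [NormedSpace ℝ E] [NormedAddCommGroup F]
  [NormedSpace ℝ F]

theorem RegularOnHalfPlane.add {f g : ℝ × ℝ → E} (hf : RegularOnHalfPlane f)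
    (hg : RegularOnHalfPlane g) : RegularOnHalfPlane fun p => f p + g p := by
  refine ⟨hf.1.add hg.1, fun a T => ?_⟩
  obtain ⟨K, hK⟩ := hf.2 a T
  obtain ⟨L, hL⟩ := hg.2 a T
  refine ⟨K + L, fun p hp ha hT k hk => ?_⟩
  have hk' : (k : ℕ∞ω) ≤ 2 := by exact_mod_cast hk
  have := iteratedFDerivWithin_add_apply ((hf.1 p hp).of_le hk') ((hg.1 p hp).of_le hk')
    uniqueDiffOn_halfPlane hp
  have e : (fun p => f p + g p) = f + g := rfl
  rw [e, this]
  exact (norm_add_le _ _).trans (add_le_add (hK p hp ha hT k hk) (hL p hp ha hT k hk))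

theorem RegularOnHalfPlane.clm {f : ℝ × ℝ → E} (hf : RegularOnHalfPlane f) (L : E →L[ℝ] F) :
    RegularOnHalfPlane fun p => L (f p) := by
  refine ⟨L.contDiff.comp_contDiffOn hf.1, fun a T => ?_⟩
  obtain ⟨K, hK⟩ := hf.2 a T
  refine ⟨‖L‖ * K, fun p hp ha hT k hk => ?_⟩
  have hk' : (k : ℕ∞ω) ≤ 2 := by exact_mod_cast hk
  have := L.iteratedFDerivWithin_comp_left (hf.1 p hp) uniqueDiffOn_halfPlane hp hk'
  have e : (fun p => L (f p)) = L ∘ f := rfl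
  rw [e, this]
  exact (L.norm_compContinuousMultilinearMap_le _).trans
    (mul_le_mul_of_nonneg_left (hK p hp ha hT k hk) (norm_nonneg _))

theorem RegularOnHalfPlane.congr {f g : ℝ × ℝ → E} (hf : RegularOnHalfPlane f)
    (h : ∀ p ∈ halfPlane, g p = f p) : RegularOnHalfPlane g := by
  refine ⟨hf.1.congr h, fun a T => ?_⟩
  obtain ⟨K, hK⟩ := hf.2 a T
  refine ⟨K, fun p hp ha hT k hk => ?_⟩
  rw [iteratedFDerivWithin_congr h hp]
  exact hK p hp ha hT k hk

/-- The partial derivative with respect to `y`. -/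
noncomputable def partialY (f : ℝ × ℝ → E) (p : ℝ × ℝ) : E :=
  fderivWithin ℝ f halfPlane p ((1 : ℝ), (0 : ℝ))

/-- The partial derivative with respect to `t` (one-sided at `t = 0`). -/
noncomputable def partialT (f : ℝ × ℝ → E) (p : ℝ × ℝ) : E :=
  fderivWithin ℝ f halfPlane p ((0 : ℝ), (1 : ℝ))

theorem hasDerivAt_partialY {f : ℝ × ℝ → E} (hf : DifferentiableOn ℝ f halfPlane) (y : ℝ) {t : ℝ}
    (ht : 0 ≤ t) : HasDerivAt (fun η => f (η, t)) (partialY f (y, t)) y := by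
  have hc : HasDerivWithinAt (fun η : ℝ => (η, t)) ((1 : ℝ), (0 : ℝ)) univ y :=
    (hasDerivWithinAt_id y univ).prodMk (hasDerivWithinAt_const y univ t)
  exact ((hf (y, t) ht).hasFDerivWithinAt.comp_hasDerivWithinAt (t := halfPlane) y hc
    fun s _ => ht).hasDerivAt univ_mem

theorem hasDerivWithinAt_partialT {f : ℝ × ℝ → E} (hf : DifferentiableOn ℝ f halfPlane) (y : ℝ)
    {t : ℝ} (ht : 0 ≤ t) :
    HasDerivWithinAt (fun s => f (y, s)) (partialT f (y, t)) (Ici 0) t := by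
  have hc : HasDerivWithinAt (fun s : ℝ => (y, s)) ((0 : ℝ), (1 : ℝ)) (Ici 0) t :=
    (hasDerivWithinAt_const t _ y).prodMk (hasDerivWithinAt_id t _)
  exact (hf (y, t) ht).hasFDerivWithinAt.comp_hasDerivWithinAt (t := halfPlane) t hc fun s hs => hs

theorem contDiffOn_fderivWithin_halfPlane {f : ℝ × ℝ → E} (hf : ContDiffOn ℝ 2 f halfPlane) :
    ContDiffOn ℝ 1 (fderivWithin ℝ f halfPlane) halfPlane :=
  hf.fderivWithin uniqueDiffOn_halfPlane (by norm_num)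

theorem contDiffOn_partialY {f : ℝ × ℝ → E} (hf : ContDiffOn ℝ 2 f halfPlane) :
    ContDiffOn ℝ 1 (partialY f) halfPlane :=
  (contDiffOn_fderivWithin_halfPlane hf).clm_apply contDiffOn_const

theorem contDiffOn_partialT {f : ℝ × ℝ → E} (hf : ContDiffOn ℝ 2 f halfPlane) :
    ContDiffOn ℝ 1 (partialT f) halfPlane :=
  (contDiffOn_fderivWithin_halfPlane hf).clm_apply contDiffOn_const

theorem fderivWithin_fderivWithin_apply {f : ℝ × ℝ → E} (hf : ContDiffOn ℝ 2 f halfPlane)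
    {p : ℝ × ℝ} (hp : p ∈ halfPlane) (v w : ℝ × ℝ) :
    fderivWithin ℝ (fun p => fderivWithin ℝ f halfPlane p w) halfPlane p v =
      fderivWithin ℝ (fderivWithin ℝ f halfPlane) halfPlane p v w := by
  have h1 := ((contDiffOn_fderivWithin_halfPlane hf).differentiableOn one_ne_zero p
    hp).hasFDerivWithinAt
  have h2 := h1.clm_apply (hasFDerivWithinAt_const w p halfPlane)
  rw [h2.fderivWithin (uniqueDiffOn_halfPlane p hp)]
  simp

/-- Symmetry of second derivatives persists on the edge t = 0, since the half-plane lies in the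
closure of its interior. -/
theorem partialT_partialY {f : ℝ × ℝ → E} (hf : ContDiffOn ℝ 2 f halfPlane) {p : ℝ × ℝ}
    (hp : p ∈ halfPlane) : partialT (partialY f) p = partialY (partialT f) p := by
  have hsymm : IsSymmSndFDerivWithinAt ℝ f halfPlane p := by
    refine (hf p hp).isSymmSndFDerivWithinAt (by simp) uniqueDiffOn_halfPlane ?_ hp
    have hopen : IsOpen {p : ℝ × ℝ | 0 < p.2} := isOpen_lt continuous_const continuous_snd
    have hsub : {p : ℝ × ℝ | 0 < p.2} ⊆ interior halfPlane :=
      hopen.subset_interior_iff.2 fun p (hp : 0 < p.2) => (hp.le : 0 ≤ p.2)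
    refine closure_mono hsub ?_
    rw [mem_closure_iff_seq_limit]
    refine ⟨fun n => (p.1, p.2 + 1 / ((n : ℝ) + 1)), fun n => ?_, ?_⟩
    · have h1 : (0 : ℝ) ≤ p.2 := hp
      have h2 : (0 : ℝ) < 1 / ((n : ℝ) + 1) := Nat.one_div_pos_of_nat
      exact add_pos_of_nonneg_of_pos h1 h2
    · have := (tendsto_const_nhds (x := p.2)).add tendsto_one_div_add_atTop_nhds_zero_nat
      rw [add_zero] at this
      exact (tendsto_const_nhds (x := p.1)).prodMk_nhds this
  have e1 : partialT (partialY f) p = _ := fderivWithin_fderivWithin_apply hf hp (0, 1) (1, 0)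
  have e2 : partialY (partialT f) p = _ := fderivWithin_fderivWithin_apply hf hp (1, 0) (0, 1)
  rw [e1, e2]
  exact hsymm.eq _ _

theorem norm_partialT_le {f : ℝ × ℝ → E} {p : ℝ × ℝ} (hp : p ∈ halfPlane) :
    ‖partialT f p‖ ≤ ‖iteratedFDerivWithin ℝ 1 f halfPlane p‖ := by
  rw [norm_iteratedFDerivWithin_one _ (uniqueDiffOn_halfPlane p hp)]
  refine (ContinuousLinearMap.le_opNorm _ _).trans (le_of_eq ?_)
  rw [Prod.norm_mk]; simp

theorem norm_partialT_partialT_le {f : ℝ × ℝ → E} (hf : ContDiffOn ℝ 2 f halfPlane) {p : ℝ × ℝ}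
    (hp : p ∈ halfPlane) :
    ‖partialT (partialT f) p‖ ≤ ‖iteratedFDerivWithin ℝ 2 f halfPlane p‖ := by
  have e : partialT (partialT f) p = _ := fderivWithin_fderivWithin_apply hf hp (0, 1) (0, 1)
  rw [e, ← norm_iteratedFDerivWithin_fderivWithin uniqueDiffOn_halfPlane hp,
    norm_iteratedFDerivWithin_one _ (uniqueDiffOn_halfPlane p hp)]
  refine (ContinuousLinearMap.le_opNorm₂ _ _ _).trans (le_of_eq ?_)
  rw [Prod.norm_mk]; simp

end Regular

/-! ### The circulant matrix -/

theorem structured_eq (q : ℝ) : structured q =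
    !![((q : ℂ) + 1 + (q : ℂ)⁻¹) / 3, ((q : ℂ) + omega + (-1 - omega) * (q : ℂ)⁻¹) / 3,
        ((q : ℂ) + (-1 - omega) + omega * (q : ℂ)⁻¹) / 3;
      ((q : ℂ) + (-1 - omega) + omega * (q : ℂ)⁻¹) / 3, ((q : ℂ) + 1 + (q : ℂ)⁻¹) / 3,
        ((q : ℂ) + omega + (-1 - omega) * (q : ℂ)⁻¹) / 3;
      ((q : ℂ) + omega + (-1 - omega) * (q : ℂ)⁻¹) / 3,
        ((q : ℂ) + (-1 - omega) + omega * (q : ℂ)⁻¹) / 3, ((q : ℂ) + 1 + (q : ℂ)⁻¹) / 3] := by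
  have ha : alpha q = ((q : ℂ) + 1 + (q : ℂ)⁻¹) / 3 := by simp [alpha]
  have hb : beta q = ((q : ℂ) + omega + (-1 - omega) * (q : ℂ)⁻¹) / 3 := by
    rw [beta, omega_sq, Complex.ofReal_inv]
  have hs : star (beta q) = ((q : ℂ) + (-1 - omega) + omega * (q : ℂ)⁻¹) / 3 := by
    have h1 := star_omega
    have h2 : star (q : ℂ) = q := Complex.conj_ofReal q
    have h3 : star (3 : ℂ) = 3 := by simp
    rw [hb, star_div₀, star_add, star_add, star_mul', star_sub, star_neg, star_one, star_inv₀, h1,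
      h2, h3]
    ring
  rw [structured, ha, hs, hb]

/-- The eigenvalues of this circulant are q, 1 and 1/q, and they are linear in its entries. The
plain row sum is q, the sum weighted by powers of ω is 1/q. -/
theorem structured_row_sum (q : ℝ) :
    structured q 0 0 + (structured q 0 1 + structured q 0 2) = q := by
  rw [structured_eq]
  simp
  ring

theorem structured_weighted_row_sum (q : ℝ) :
    structured q 0 0 + (omega * structured q 0 1 + omega ^ 2 * structured q 0 2) = (q⁻¹ : ℝ) := by
  have h := omega_sq
  rw [structured_eq]
  simp
  linear_combination ((q : ℂ) + 1 - omega - 2 * (q : ℂ)⁻¹ + (q : ℂ)⁻¹ * omega) / 3 * h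

/-- The eigenvectors do not depend on q, and q ↦ 1/q inverts the eigenvalues q, 1, 1/q. -/
theorem structured_mul_inv {q : ℝ} (hq : q ≠ 0) : structured q * structured q⁻¹ = 1 := by
  have h := omega_sq
  have hq' : (q : ℂ) ≠ 0 := by exact_mod_cast hq
  rw [structured_eq, structured_eq]
  ext i j
  fin_cases i <;> fin_cases j <;>
  · simp [Matrix.mul_apply, Fin.sum_univ_three]
    field_simp
    ring_nf
    try rw [h]
    ring_nf

end ShortWave

namespace ShortWave

/-! ### The zero-curvature condition -/

/-- Entrywise derivative of a matrix function. -/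
def HasEntryDeriv (A : ℝ → Mat) (A' : Mat) (S : Set ℝ) (s : ℝ) : Prop :=
  ∀ i j, HasDerivWithinAt (fun σ => A σ i j) (A' i j) S s

namespace HasEntryDeriv

variable {A B : ℝ → Mat} {A' B' : Mat} {S : Set ℝ} {s : ℝ}

theorem add (hA : HasEntryDeriv A A' S s) (hB : HasEntryDeriv B B' S s) :
    HasEntryDeriv (fun σ => A σ + B σ) (A' + B') S s := fun i j => (hA i j).add (hB i j)

theorem sub (hA : HasEntryDeriv A A' S s) (hB : HasEntryDeriv B B' S s) :
    HasEntryDeriv (fun σ => A σ - B σ) (A' - B') S s := fun i j => (hA i j).sub (hB i j)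

theorem const (C : Mat) : HasEntryDeriv (fun _ => C) 0 S s :=
  fun i j => hasDerivWithinAt_const s S (C i j)

theorem mul (hA : HasEntryDeriv A A' S s) (hB : HasEntryDeriv B B' S s) :
    HasEntryDeriv (fun σ => A σ * B σ) (A' * B s + A s * B') S s := fun i j => by
  simp only [Matrix.mul_apply, Matrix.add_apply, ← Finset.sum_add_distrib]
  exact HasDerivWithinAt.fun_sum fun k _ => (hA i k).fun_mul (hB k j)

theorem unique (hS : UniqueDiffWithinAt ℝ S s) (hA : HasEntryDeriv A A' S s)
    (hB : HasEntryDeriv A B' S s) : A' = B' := by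
  ext i j
  exact hS.eq_deriv _ (hA i j) (hB i j)

theorem congr (hA : HasEntryDeriv A A' S s) (hs : s ∈ S) (h : ∀ σ ∈ S, B σ = A σ) :
    HasEntryDeriv B A' S s := fun i j =>
  (hA i j).congr (fun σ hσ => by rw [h σ hσ]) (by rw [h s hs])

theorem smul_const {f : ℝ → ℂ} {f' : ℂ} (hf : HasDerivWithinAt f f' S s) (C : Mat) :
    HasEntryDeriv (fun σ => f σ • C) (f' • C) S s := fun i j => hf.mul_const (C i j)

end HasEntryDeriv

/-- The constant matrix of the potential. -/
noncomputable def Kmat : Mat :=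
  !![0, (1 - omega ^ 2) / 3, (1 - omega) / 3;
     (1 - omega) / 3, 0, (1 - omega ^ 2) / 3;
     (1 - omega ^ 2) / 3, (1 - omega) / 3, 0]

/-- `Kmat` has eigenvalues 1, 0, -1 on the common eigenvectors, so for q > 0 the circulant is
exp((log q)K), with logarithmic derivative (q'/q)K. -/
theorem hasEntryDeriv_structured {q : ℝ → ℝ} {q' : ℝ} {S : Set ℝ} {s : ℝ}
    (hq : HasDerivWithinAt q q' S s) (h0 : q s ≠ 0) :
    HasEntryDeriv (fun σ => structured (q σ)) ((((q' / q s : ℝ) : ℂ) • Kmat) * structured (q s))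
      S s := by
  have hω := omega_sq
  have hq0 : (q s : ℂ) ≠ 0 := by exact_mod_cast h0
  have h1 : HasDerivWithinAt (fun σ => (q σ : ℂ)) (q' : ℂ) S s := hq.ofReal_comp
  have h2 : HasDerivWithinAt (fun σ => (q σ : ℂ)⁻¹) (-(q' : ℂ) / (q s : ℂ) ^ 2) S s :=
    h1.fun_inv hq0
  have key : ∀ a b : ℂ, HasDerivWithinAt (fun σ => ((q σ : ℂ) + a + b * (q σ : ℂ)⁻¹) / 3)
      ((q' + b * (-(q' : ℂ) / (q s : ℂ) ^ 2)) / 3) S s := fun a b =>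
    ((h1.add_const a).add (h2.const_mul b)).div_const 3
  have ka := key 1 1
  simp only [one_mul] at ka
  have kb := key omega (-1 - omega)
  have kc := key (-1 - omega) omega
  simp only [structured_eq]
  intro i j
  fin_cases i <;> fin_cases j <;>
  · first
      | refine (ka.congr_deriv ?_)
      | refine (kb.congr_deriv ?_)
      | refine (kc.congr_deriv ?_)
    simp [Kmat, Matrix.mul_apply, Fin.sum_univ_three]
    rw [hω]
    field_simp
    ring_nf
    rw [hω]
    ring_nf

theorem Jmat_eq : Jmat = !![omega, 0, 0; 0, -1 - omega, 0; 0, 0, 1] := by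
  have hω := omega_sq
  have hc := omega_cube
  ext i j
  fin_cases i <;> fin_cases j <;> simp [Jmat, hω, hc]

theorem Jinv_eq : Jinv = !![-1 - omega, 0, 0; 0, omega, 0; 0, 0, 1] := by
  have hω := omega_sq
  have hc := omega_cube
  have hi := omega_inv
  have hi2 : (-1 - omega)⁻¹ = omega := by rw [← hi, inv_inv]
  ext i j
  fin_cases i <;> fin_cases j <;> simp [Jinv, hω, hc, hi, hi2]

/-- The zero-curvature equation is a scalar multiple of `Kmat` on one side, so a single entry where
`Kmat` is nonzero determines the scalar. -/
theorem structured_conj_entry {q : ℝ} (hq : q ≠ 0) :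
    (structured q * Jinv * structured q⁻¹ * Jmat - Jmat * (structured q * Jinv * structured q⁻¹)) 0 1
      = ((q ^ 2 - q⁻¹ : ℝ) : ℂ) * Kmat 0 1 := by
  have hω := omega_sq
  have hω3 := omega_cube
  have hq' : (q : ℂ) ≠ 0 := by exact_mod_cast hq
  rw [structured_eq, structured_eq, Jmat_eq, Jinv_eq]
  simp [Matrix.sub_apply, Kmat]
  field_simp
  ring_nf
  simp only [hω, hω3]
  ring_nf

section Curvature

variable {D : RHData} {M : ℝ → ℝ → ℂ → Mat}

/-- The limit at the origin is a bounded linear functional of the family, so it keeps the C²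
dependence and the bounds on the derivatives. -/
theorem regular_limit (hreg : ClassicalDependence D M) {G : ℝ → ℝ → Mat}
    (hG : ∀ y t : ℝ, 0 ≤ t → Tendsto (M y t) (𝓝[contourᶜ] 0) (𝓝 (G y t))) (i j : Fin 3) :
    RegularOnHalfPlane fun p => G p.1 p.2 i j := by
  obtain ⟨ε, hε, hl⟩ := eventually_away_zero D
  obtain ⟨F, h1, h2, h3⟩ := hreg ε hε i j
  have hr : range (Subtype.val : D.away ε → ℂ) ∈ 𝓝[contourᶜ] (0 : ℂ) := by
    rw [Subtype.range_coe]; exact hl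
  have := neBot_contour_compl
  have hne : (comap (Subtype.val : D.away ε → ℂ) (𝓝[contourᶜ] (0 : ℂ))).NeBot :=
    this.comap_of_range_mem hr
  obtain ⟨ℓ, hℓ⟩ := exists_limit_functional (comap (Subtype.val : D.away ε → ℂ) (𝓝[contourᶜ] 0))
  have hF : RegularOnHalfPlane F := ⟨h2, h3⟩
  refine (hF.clm ℓ).congr fun p hp => (hℓ _ _ ?_).symm
  have e : (F p : D.away ε → ℂ) = (fun z => M p.1 p.2 z i j) ∘ Subtype.val := by
    ext z; exact h1 p hp z
  rw [e]
  exact (JumpAndResidue.tendsto_entry.1 (hG p.1 p.2 hp) i j).comp tendsto_comap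

theorem regular_eval (hreg : ClassicalDependence D M) {z : ℂ} (hz : z ∈ D.domain) (i j : Fin 3) :
    ContDiffOn ℝ 2 (fun p : ℝ × ℝ => M p.1 p.2 z i j) halfPlane := by
  obtain ⟨ε, hε, hb⟩ := D.exists_dist_pole (RHData.mem_domain_iff.1 hz).2
  obtain ⟨F, h1, h2, -⟩ := hreg ε hε i j
  set z' : D.away ε := ⟨z, (RHData.mem_domain_iff.1 hz).1, hb z (Metric.mem_ball_self hε)⟩
  exact ((BoundedContinuousFunction.evalCLM ℝ z' : (D.away ε →ᵇ ℂ) →L[ℝ] ℂ).contDiff.comp_contDiffOn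
    h2).congr fun p hp => (h1 p hp z').symm

variable {qh : ℝ → ℝ → ℝ}

theorem regular_q (hreg : ClassicalDependence D M)
    (hG : ∀ y t : ℝ, 0 ≤ t → Tendsto (M y t) (𝓝[contourᶜ] 0) (𝓝 (structured (qh y t)))) :
    RegularOnHalfPlane fun p => qh p.1 p.2 := by
  have h := regular_limit hreg (G := fun y t => structured (qh y t)) hG 0
  refine (((h 0).add ((h 1).add (h 2))).clm Complex.reCLM).congr fun p _ => ?_
  rw [structured_row_sum]
  simp

/-- Since 1/q is also linear in the entries of the limit, it is bounded on quarter-planes. This is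
the only source of a lower bound for q at positive times. -/
theorem regular_q_inv (hreg : ClassicalDependence D M)
    (hG : ∀ y t : ℝ, 0 ≤ t → Tendsto (M y t) (𝓝[contourᶜ] 0) (𝓝 (structured (qh y t)))) :
    RegularOnHalfPlane fun p => (qh p.1 p.2)⁻¹ := by
  have h := regular_limit hreg (G := fun y t => structured (qh y t)) hG 0
  have hmul : ∀ c : ℂ, ∃ L : ℂ →L[ℝ] ℂ, ∀ z, L z = c * z := fun c =>
    ⟨ContinuousLinearMap.mul ℝ ℂ c, fun z => rfl⟩
  obtain ⟨L₁, hL₁⟩ := hmul omega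
  obtain ⟨L₂, hL₂⟩ := hmul (omega ^ 2)
  refine (((h 0).add (((h 1).clm L₁).add ((h 2).clm L₂))).clm Complex.reCLM).congr fun p _ => ?_
  rw [hL₁, hL₂, structured_weighted_row_sum]
  simp

/-- The noncommutative computation behind the zero-curvature condition. -/
theorem zero_curvature_algebra {R : Type*} [Ring R] {L L' A K U Kt At : R} (hLL : L * L' = 1)
    (hL'L : L' * L = 1) (hA : At = K * A - A * K)
    (h : (L * (A * U - U * L') - (A * U - U * L') * L) + (Kt * U + K * (A * U - U * L')) =
      (At * U + A * (L * U - U * L + K * U)) - (L * U - U * L + K * U) * L') :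
    Kt * U = (A * L - L * A) * U := by
  have e1 : U * L' * L = U := by rw [mul_assoc, hL'L, mul_one]
  have e2 : U * L * L' = U := by rw [mul_assoc, hLL, mul_one]
  rw [hA] at h
  have h' := sub_eq_zero.2 h
  rw [← sub_eq_zero, ← h']
  simp only [sub_mul, mul_sub, add_mul, mul_add, ← mul_assoc, e1, e2]
  abel

/-- The limits at the origin turn the Lax pair into explicit coefficients (q_y/q)K and GL'G⁻¹, where
L = zJ and L' = z⁻¹J⁻¹ are mutually inverse. Equality of the mixed derivatives of M at one point z,
with M(z) invertible, leaves a matrix equation whose (0,1) entry is the claim. -/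
theorem tzitzeica (hM : ∀ y t : ℝ, 0 ≤ t → IsUniqueRHSolution D y t (M y t))
    (hreg : ClassicalDependence D M) (hq : ∀ y t : ℝ, 0 ≤ t → 0 < qh y t)
    (hG : ∀ y t : ℝ, 0 ≤ t → Tendsto (M y t) (𝓝[contourᶜ] 0) (𝓝 (structured (qh y t))))
    (y : ℝ) {t : ℝ} (ht : 0 ≤ t) :
    HasDerivWithinAt (fun s => deriv (fun η => qh η s) y / qh y s)
      (qh y t ^ 2 - (qh y t)⁻¹) (Ici 0) t := by
  set Q : ℝ × ℝ → ℝ := fun p => qh p.1 p.2 with hQ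
  have hQ2 : ContDiffOn ℝ 2 Q halfPlane := (regular_q hreg hG).1
  have hQy : ∀ y t, 0 ≤ t → HasDerivAt (fun η => qh η t) (partialY Q (y, t)) y := fun y t ht =>
    hasDerivAt_partialY (hQ2.differentiableOn two_ne_zero) y ht
  set a : ℝ → ℝ → ℝ := fun y t => partialY Q (y, t) / qh y t with ha
  have hGy : ∀ y t, 0 ≤ t → HasEntryDeriv (fun η => structured (qh η t))
      (((a y t : ℝ) : ℂ) • Kmat * structured (qh y t)) univ y := fun y t ht =>
    hasEntryDeriv_structured (hQy y t ht).hasDerivWithinAt (hq y t ht).ne'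
  have hinv : ∀ y t, 0 ≤ t → structured (qh y t) * structured (qh y t)⁻¹ = 1 := fun y t ht =>
    structured_mul_inv (hq y t ht).ne'
  obtain ⟨z, hz, -⟩ := D.exists_mem_domain 0
  have hz0 := RHData.ne_zero_of_mem_domain hz
  set L : Mat := z • Jmat with hL
  set L' : Mat := z⁻¹ • Jinv with hL'
  have hJJ : Jmat * Jinv = 1 := by
    simp only [Jmat, Jinv, Matrix.diagonal_mul_diagonal, mul_inv_cancel₀ (pow_ne_zero _ omega_ne_zero),
      Matrix.diagonal_one]
  have hJJ' : Jinv * Jmat = 1 := by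
    simp only [Jmat, Jinv, Matrix.diagonal_mul_diagonal, inv_mul_cancel₀ (pow_ne_zero _ omega_ne_zero),
      Matrix.diagonal_one]
  have hLL : L * L' = 1 := by
    rw [hL, hL', smul_mul_smul_comm, mul_inv_cancel₀ hz0, hJJ, one_smul]
  have hL'L : L' * L = 1 := by
    rw [hL, hL', smul_mul_smul_comm, inv_mul_cancel₀ hz0, hJJ', one_smul]
  set A : ℝ → ℝ → Mat := fun y t => structured (qh y t) * L' * structured (qh y t)⁻¹ with hA
  set U : ℝ → ℝ → Mat := fun y t => M y t z with hU
  have hUy : ∀ y t, 0 ≤ t → HasEntryDeriv (fun η => U η t)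
      (L * U y t - U y t * L + ((a y t : ℝ) : ℂ) • Kmat * U y t) univ y := by
    intro y t ht
    obtain ⟨C, h1, h2⟩ := lax_y hM hreg (G := fun y t => structured (qh y t)) hG y ht
    have e := HasEntryDeriv.unique uniqueDiffWithinAt_univ
      (fun i j => (h2 i j).hasDerivWithinAt) (hGy y t ht)
    have hC : C = ((a y t : ℝ) : ℂ) • Kmat := by
      have := congrArg (fun B => B * structured (qh y t)⁻¹) e
      simpa only [mul_assoc, hinv y t ht, mul_one] using this
    intro i j
    refine (h1 z hz i j).hasDerivWithinAt.congr_deriv ?_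
    simp only [hC, hL, hU, smul_sub, Matrix.smul_mul, Matrix.mul_smul]
  have hUt : ∀ y t, 0 ≤ t → HasEntryDeriv (fun s => U y s) (A y t * U y t - U y t * L') (Ici 0) t := by
    intro y t ht
    obtain ⟨B, h1, h2⟩ := lax_t hM hreg (G := fun y t => structured (qh y t)) hG y ht
    have hB : z⁻¹ • B = A y t := by
      have := congrArg (fun X => z⁻¹ • (X * structured (qh y t)⁻¹)) h2
      simp only [mul_assoc, hinv y t ht, mul_one] at this
      rw [this, hA, hL']
      simp only [Matrix.mul_smul, Matrix.smul_mul, mul_assoc]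
    intro i j
    refine (h1 z hz i j).congr_deriv ?_
    rw [← hB, hL', smul_sub, Matrix.smul_mul, Matrix.mul_smul]
  -- the derivative of `A` in `y`
  have hq0 := (hq y t ht).ne'
  set K : Mat := ((a y t : ℝ) : ℂ) • Kmat with hK
  have hAG : ∀ η, A η t * structured (qh η t) = structured (qh η t) * L' := fun η => by
    have : structured (qh η t)⁻¹ * structured (qh η t) = 1 := by
      have := structured_mul_inv (q := (qh η t)⁻¹) (inv_ne_zero (hq η t ht).ne')
      rwa [inv_inv] at this
    simp only [hA]
    rw [mul_assoc, this, mul_one]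
  obtain ⟨Ay, hAy⟩ : ∃ Ay, HasEntryDeriv (fun η => A η t) Ay univ y :=
    ⟨_, ((hGy y t ht).mul (HasEntryDeriv.const L')).mul
      (hasEntryDeriv_structured ((hQy y t ht).hasDerivWithinAt.fun_inv hq0) (inv_ne_zero hq0))⟩
  -- Obtained by differentiating AG = GL' in y with G_y = KG, which avoids differentiating G⁻¹
  -- explicitly.
  have hAyK : Ay = K * A y t - A y t * K := by
    have h1 := hAy.mul (hGy y t ht)
    have h2 := ((hGy y t ht).mul (HasEntryDeriv.const L')).congr (mem_univ y)
      (fun η _ => hAG η)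
    have e := HasEntryDeriv.unique uniqueDiffWithinAt_univ h1 h2
    rw [mul_zero, add_zero, ← hK] at e
    have e2 := congrArg (fun X => X * structured (qh y t)⁻¹) e
    simp only [add_mul, mul_assoc, hinv y t ht, mul_one] at e2
    rw [eq_sub_iff_add_eq, e2]
    simp only [hA, mul_assoc]
  -- the derivative of the potential in `t`
  have hQyt : HasDerivWithinAt (fun s => partialY Q (y, s)) (partialT (partialY Q) (y, t)) (Ici 0) t :=
    hasDerivWithinAt_partialT ((contDiffOn_partialY hQ2).differentiableOn one_ne_zero) y ht
  have hQt : HasDerivWithinAt (fun s => qh y s) (partialT Q (y, t)) (Ici 0) t :=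
    hasDerivWithinAt_partialT (hQ2.differentiableOn two_ne_zero) y ht
  have hat := hQyt.fun_div hQt hq0
  set a' : ℝ := (partialT (partialY Q) (y, t) * qh y t - partialY Q (y, t) * partialT Q (y, t)) /
    qh y t ^ 2 with ha'
  have hKt : HasEntryDeriv (fun s => ((a y s : ℝ) : ℂ) • Kmat) ((a' : ℂ) • Kmat) (Ici 0) t :=
    HasEntryDeriv.smul_const hat.ofReal_comp Kmat
  -- equality of the mixed derivatives
  have hS : UniqueDiffWithinAt ℝ (Ici (0 : ℝ)) t := uniqueDiffOn_Ici 0 t ht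
  have h1 := ((((HasEntryDeriv.const L).mul (hUt y t ht)).sub
    ((hUt y t ht).mul (HasEntryDeriv.const L))).add (hKt.mul (hUt y t ht)))
  have h2 := ((hAy.mul (hUy y t ht)).sub ((hUy y t ht).mul (HasEntryDeriv.const L')))
  -- Both sides are mixed second derivatives of M, computed from the two Lax equations; they agree
  -- because M is C² up to the edge.
  have hmixed : (0 * U y t + L * (A y t * U y t - U y t * L')) -
      ((A y t * U y t - U y t * L') * L + U y t * 0) +
      ((a' : ℂ) • Kmat * U y t + K * (A y t * U y t - U y t * L')) =
      (Ay * U y t + A y t * (L * U y t - U y t * L + K * U y t)) -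
      ((L * U y t - U y t * L + K * U y t) * L' + U y t * 0) := by
    ext i j
    have hf := regular_eval (M := M) hreg hz i j
    have eY : ∀ s, 0 ≤ s → partialY (fun p : ℝ × ℝ => M p.1 p.2 z i j) (y, s) =
        (L * U y s - U y s * L + ((a y s : ℝ) : ℂ) • Kmat * U y s) i j := fun s hs =>
      (hasDerivAt_partialY (hf.differentiableOn two_ne_zero) y hs).unique
        ((hUy y s hs i j).hasDerivAt univ_mem)
    have eT : ∀ η, partialT (fun p : ℝ × ℝ => M p.1 p.2 z i j) (η, t) =
        (A η t * U η t - U η t * L') i j := fun η =>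
      hS.eq_deriv _ (hasDerivWithinAt_partialT (hf.differentiableOn two_ne_zero) η ht) (hUt η t ht i j)
    have d1 := hasDerivWithinAt_partialT ((contDiffOn_partialY hf).differentiableOn one_ne_zero) y ht
    have d2 := hasDerivAt_partialY ((contDiffOn_partialT hf).differentiableOn one_ne_zero) y ht
    have hsym := partialT_partialY hf (p := (y, t)) ht
    have c1 := hS.eq_deriv _ d1 ((h1 i j).congr (fun s hs => eY s hs) (eY t ht))
    have c2 := d2.unique (((h2 i j).hasDerivAt univ_mem).congr_of_eventuallyEq
      (Eventually.of_forall fun η => eT η))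
    rw [← c1, ← c2, hsym]
  simp only [zero_mul, mul_zero, zero_add, add_zero] at hmixed
  have hcurv := zero_curvature_algebra hLL hL'L hAyK hmixed
  have hunit := (hM y t ht).isUnit_det hz
  have hcurv' : (a' : ℂ) • Kmat = A y t * L - L * A y t := by
    have := congrArg (fun X => X * (U y t)⁻¹) hcurv
    rwa [mul_assoc, mul_assoc, Matrix.mul_nonsing_inv _ hunit, mul_one, mul_one] at this
  have hAL : A y t * L - L * A y t = structured (qh y t) * Jinv * structured (qh y t)⁻¹ * Jmat -
      Jmat * (structured (qh y t) * Jinv * structured (qh y t)⁻¹) := by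
    simp only [hA, hL, hL', Matrix.mul_smul, Matrix.smul_mul, smul_smul, mul_inv_cancel₀ hz0,
      inv_mul_cancel₀ hz0, one_smul]
  have hentry := congrFun (congrFun (hcurv'.trans hAL) 0) 1
  rw [structured_conj_entry hq0, Matrix.smul_apply, smul_eq_mul] at hentry
  have hK01 : Kmat 0 1 ≠ 0 := by
    have : omega ^ 2 ≠ 1 := fun h => by
      have h3 := omega_cube
      have : omega = 1 := by linear_combination h3 - omega * h
      have h4 := omega_sq
      rw [this] at h4
      norm_num at h4
    have h1 : (1 - omega ^ 2) / 3 ≠ 0 := div_ne_zero (sub_ne_zero.2 this.symm) three_ne_zero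
    simpa [Kmat] using h1
  have hfin : a' = qh y t ^ 2 - (qh y t)⁻¹ := by
    exact_mod_cast mul_right_cancel₀ hK01 hentry
  rw [← hfin]
  exact hat.congr (fun s hs => by rw [(hQy y s hs).deriv]) (by rw [(hQy y t ht).deriv])

end Curvature

end ShortWave

namespace ShortWave

/-! ### Calculus of improper integrals -/

section Improper

variable {E : Type*} [NormedAddCommGroup E] [NormedSpace ℝ E] [CompleteSpace E]

open MeasureTheory

theorem hasDerivAt_integral_Ioi {f : ℝ → E} (hf : Continuous f)
    (hi : ∀ a, IntegrableOn f (Ioi a)) (x : ℝ) :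
    HasDerivAt (fun x => ∫ ξ in Ioi x, f ξ) (-f x) x := by
  have e : (fun x => ∫ ξ in Ioi x, f ξ) = fun x => (∫ ξ in Ioi 0, f ξ) - ∫ ξ in (0 : ℝ)..x, f ξ := by
    funext x
    rw [← intervalIntegral.integral_Ioi_sub_Ioi' (hi 0) (hi x)]
    abel
  rw [e]
  exact (hf.integral_hasStrictDerivAt 0 x).hasDerivAt.const_sub _

theorem hasDerivAt_integral_Iic {f : ℝ → E} (hf : Continuous f)
    (hi : ∀ a, IntegrableOn f (Iic a)) (x : ℝ) :
    HasDerivAt (fun x => ∫ ξ in Iic x, f ξ) (f x) x := by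
  have e : (fun x => ∫ ξ in Iic x, f ξ) = fun x => (∫ ξ in Iic 0, f ξ) + ∫ ξ in (0 : ℝ)..x, f ξ := by
    funext x
    rw [← intervalIntegral.integral_Iic_sub_Iic (hi 0) (hi x)]
    abel
  rw [e]
  exact (hf.integral_hasStrictDerivAt 0 x).hasDerivAt.const_add _

/-- The weight `(1 + |x|)⁻⁴`. -/
noncomputable def wt (x : ℝ) : ℝ := ((1 + |x|) ^ 4)⁻¹

theorem wt_pos (x : ℝ) : 0 < wt x := by unfold wt; positivity

theorem wt_le_one (x : ℝ) : wt x ≤ 1 :=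
  inv_le_one_of_one_le₀ (one_le_pow₀ (by linarith [abs_nonneg x]))

theorem continuous_wt : Continuous wt :=
  ((continuous_const.add continuous_abs).pow 4).inv₀ fun x =>
    (show ((1 : ℝ) + |x|) ^ 4 ≠ 0 by positivity)

theorem integrable_wt : Integrable wt := by
  have := integrable_one_add_norm (E := ℝ) (μ := volume) (r := 4) (by simp)
  refine this.congr (Eventually.of_forall fun x => ?_)
  have h : (0 : ℝ) ≤ 1 + |x| := by positivity
  simp only [wt, Real.norm_eq_abs]
  rw [Real.rpow_neg h]
  norm_cast

theorem tendsto_wt_atTop : Tendsto wt atTop (𝓝 0) := by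
  have h : Tendsto (fun x : ℝ => (1 + |x|) ^ 4) atTop atTop :=
    (tendsto_pow_atTop four_ne_zero).comp (tendsto_atTop_add_const_left _ _ tendsto_abs_atTop_atTop)
  exact h.inv_tendsto_atTop

theorem tendsto_wt_atBot : Tendsto wt atBot (𝓝 0) := by
  have h : Tendsto (fun x : ℝ => (1 + |x|) ^ 4) atBot atTop :=
    (tendsto_pow_atTop four_ne_zero).comp (tendsto_atTop_add_const_left _ _ tendsto_abs_atBot_atTop)
  exact h.inv_tendsto_atTop

/-- Continuous functions bounded by a multiple of the weight are integrable. -/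
theorem integrable_of_le_wt {E : Type*} [NormedAddCommGroup E] {f : ℝ → E} (hf : Continuous f) {C : ℝ} (h : ∀ x, ‖f x‖ ≤ C * wt x) :
    Integrable f :=
  (integrable_wt.const_mul C).mono' hf.aestronglyMeasurable (Eventually.of_forall h)

end Improper

/-! ### The initial data -/

namespace Admissible

variable {u₀ : ℝ → ℝ}

open MeasureTheory

theorem exists_decay (hu : Admissible u₀) {k : ℕ} (hk : k ≤ 4) :
    ∃ C, 0 ≤ C ∧ ∀ x, |iteratedDeriv k u₀ x| ≤ C * wt x := by
  obtain ⟨C, hC⟩ := hu.decay k hk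
  have h0 : 0 ≤ C := (by positivity : (0 : ℝ) ≤ (1 + |(0 : ℝ)|) ^ 4 * |iteratedDeriv k u₀ 0|).trans (hC 0)
  refine ⟨C, h0, fun x => ?_⟩
  rw [wt, ← div_eq_mul_inv, le_div_iff₀ (by positivity), mul_comm]
  exact hC x

theorem hasDerivAt_iteratedDeriv (hu : Admissible u₀) (k : ℕ) (x : ℝ) :
    HasDerivAt (iteratedDeriv k u₀) (iteratedDeriv (k + 1) u₀ x) x := by
  rw [iteratedDeriv_succ]
  exact (hu.smooth.differentiable_iteratedDeriv k (by exact_mod_cast WithTop.coe_lt_top _)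
    x).hasDerivAt

theorem q_pos (hu : Admissible u₀) (x : ℝ) : 0 < q₀ u₀ x := Real.rpow_pos_of_pos (hu.pos x) _

theorem q_cube (hu : Admissible u₀) (x : ℝ) : q₀ u₀ x ^ 3 = 1 - iteratedDeriv 2 u₀ x := by
  rw [q₀, ← Real.rpow_natCast, ← Real.rpow_mul (hu.pos x).le]
  norm_num

theorem contDiff_q (hu : Admissible u₀) : ContDiff ℝ 2 (q₀ u₀) := by
  have h : ContDiff ℝ 2 (iteratedDeriv 2 u₀) := by
    refine ContDiff.iterate_deriv' 2 2 ?_ |> fun h => by rwa [iteratedDeriv_eq_iterate]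
    have := contDiff_infty.1 hu.smooth 4
    exact_mod_cast this
  exact (contDiff_const.sub h).rpow_const_of_ne fun x => (hu.pos x).ne'

theorem hasDerivAt_q (hu : Admissible u₀) (x : ℝ) :
    HasDerivAt (q₀ u₀) (deriv (q₀ u₀) x) x :=
  (hu.contDiff_q.differentiable two_ne_zero x).hasDerivAt

theorem continuous_q (hu : Admissible u₀) : Continuous (q₀ u₀) := hu.contDiff_q.continuous

theorem contDiff_deriv_q (hu : Admissible u₀) : ContDiff ℝ 1 (deriv (q₀ u₀)) := by
  have := hu.contDiff_q
  rw [show (2 : ℕ∞ω) = 1 + 1 by norm_num] at this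
  exact (contDiff_succ_iff_deriv.1 this).2.2

theorem hasDerivAt_deriv_q (hu : Admissible u₀) (x : ℝ) :
    HasDerivAt (deriv (q₀ u₀)) (deriv (deriv (q₀ u₀)) x) x :=
  (hu.contDiff_deriv_q.differentiable one_ne_zero x).hasDerivAt

theorem continuous_deriv_deriv_q (hu : Admissible u₀) : Continuous (deriv (deriv (q₀ u₀))) :=
  hu.contDiff_deriv_q.continuous_deriv le_rfl

theorem deriv_q_eq (hu : Admissible u₀) (x : ℝ) :
    3 * q₀ u₀ x ^ 2 * deriv (q₀ u₀) x = -iteratedDeriv 3 u₀ x := by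
  have h1 := (hu.hasDerivAt_q x).fun_pow 3
  have h2 := (hu.hasDerivAt_iteratedDeriv 2 x).const_sub 1
  rw [funext fun x => hu.q_cube x] at h1
  have := h1.unique h2
  simpa using this

theorem deriv_deriv_q_eq (hu : Admissible u₀) (x : ℝ) :
    6 * q₀ u₀ x * deriv (q₀ u₀) x ^ 2 + 3 * q₀ u₀ x ^ 2 * deriv (deriv (q₀ u₀)) x =
      -iteratedDeriv 4 u₀ x := by
  have h1 := (((hu.hasDerivAt_q x).fun_pow 2).const_mul 3).fun_mul (hu.hasDerivAt_deriv_q x)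
  have h2 := (hu.hasDerivAt_iteratedDeriv 3 x).fun_neg
  rw [funext fun x => hu.deriv_q_eq x] at h1
  have := h1.unique h2
  rw [← this]
  push_cast
  ring

/-- Factor q³ - 1 = (q - 1)(q² + q + 1); for q > 0 the second factor exceeds 1. -/
theorem exists_abs_q_sub_one_le (hu : Admissible u₀) :
    ∃ C, 0 ≤ C ∧ ∀ x, |q₀ u₀ x - 1| ≤ C * wt x := by
  obtain ⟨C, hC0, hC⟩ := hu.exists_decay (k := 2) (by norm_num)
  refine ⟨C, hC0, fun x => le_trans ?_ (hC x)⟩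
  have hq := hu.q_pos x
  have e : (q₀ u₀ x - 1) * (q₀ u₀ x ^ 2 + q₀ u₀ x + 1) = -iteratedDeriv 2 u₀ x := by
    linear_combination hu.q_cube x
  have h1 : |iteratedDeriv 2 u₀ x| = |q₀ u₀ x - 1| * (q₀ u₀ x ^ 2 + q₀ u₀ x + 1) := by
    rw [← abs_neg, ← e, abs_mul, abs_of_pos (a := q₀ u₀ x ^ 2 + q₀ u₀ x + 1) (by positivity)]
  rw [h1]
  exact le_mul_of_one_le_right (abs_nonneg _) (by nlinarith)

theorem tendsto_q_atTop (hu : Admissible u₀) : Tendsto (q₀ u₀) atTop (𝓝 1) := by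
  obtain ⟨C, -, hC⟩ := hu.exists_abs_q_sub_one_le
  rw [tendsto_iff_norm_sub_tendsto_zero]
  refine squeeze_zero (fun _ => norm_nonneg _) hC ?_
  simpa using tendsto_wt_atTop.const_mul C

theorem tendsto_q_atBot (hu : Admissible u₀) : Tendsto (q₀ u₀) atBot (𝓝 1) := by
  obtain ⟨C, -, hC⟩ := hu.exists_abs_q_sub_one_le
  rw [tendsto_iff_norm_sub_tendsto_zero]
  refine squeeze_zero (fun _ => norm_nonneg _) hC ?_
  simpa using tendsto_wt_atBot.const_mul C

/-- The limit 1 at both ends controls q outside a compact interval, on which positivity and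
continuity suffice for the lower bound. -/
theorem exists_q_bounds (hu : Admissible u₀) :
    ∃ c C, 0 < c ∧ ∀ x, c ≤ q₀ u₀ x ∧ q₀ u₀ x ≤ C := by
  have h1 := hu.tendsto_q_atTop.eventually_const_le (show (1 / 2 : ℝ) < 1 by norm_num)
  have h2 := hu.tendsto_q_atBot.eventually_const_le (show (1 / 2 : ℝ) < 1 by norm_num)
  obtain ⟨b, hb⟩ := eventually_atTop.1 h1
  obtain ⟨a, ha⟩ := eventually_atBot.1 h2
  obtain ⟨C, hC0, hC⟩ := hu.exists_abs_q_sub_one_le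
  have hup : ∀ x, q₀ u₀ x ≤ 1 + C := fun x => by
    have h3 := (le_abs_self _).trans (hC x)
    have h4 := mul_le_mul_of_nonneg_left (wt_le_one x) hC0
    linarith
  rcases lt_or_ge b a with hba | hab
  · refine ⟨1 / 2, 1 + C, by norm_num, fun x => ⟨?_, hup x⟩⟩
    rcases le_total x a with h | h
    · exact ha x h
    · exact hb x (hba.le.trans h)
  · obtain ⟨x₁, -, hmin⟩ := isCompact_Icc.exists_isMinOn (nonempty_Icc.2 hab)
      hu.continuous_q.continuousOn
    refine ⟨min (1 / 2) (q₀ u₀ x₁), 1 + C, lt_min (by norm_num) (hu.q_pos _), fun x => ⟨?_, hup x⟩⟩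
    by_cases hxa : x ≤ a
    · exact (min_le_left _ _).trans (ha x hxa)
    · by_cases hxb : b ≤ x
      · exact (min_le_left _ _).trans (hb x hxb)
      · exact (min_le_right _ _).trans (hmin ⟨(not_le.1 hxa).le, (not_le.1 hxb).le⟩)

theorem exists_abs_deriv_q_le (hu : Admissible u₀) :
    ∃ C, 0 ≤ C ∧ ∀ x, |deriv (q₀ u₀) x| ≤ C * wt x := by
  obtain ⟨c, _, hc, hq⟩ := hu.exists_q_bounds
  obtain ⟨C, hC0, hC⟩ := hu.exists_decay (k := 3) (by norm_num)
  refine ⟨C / (3 * c ^ 2), by positivity, fun x => ?_⟩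
  have h1 : 3 * c ^ 2 * |deriv (q₀ u₀) x| ≤ C * wt x := by
    refine le_trans ?_ (hC x)
    rw [← abs_neg (iteratedDeriv 3 u₀ x), ← hu.deriv_q_eq, abs_mul,
      abs_of_nonneg (a := 3 * q₀ u₀ x ^ 2) (by positivity)]
    have := pow_le_pow_left₀ hc.le (hq x).1 2
    exact mul_le_mul_of_nonneg_right (by linarith) (abs_nonneg _)
  rw [div_mul_eq_mul_div, le_div_iff₀ (by positivity)]
  linarith

theorem exists_abs_deriv_deriv_q_le (hu : Admissible u₀) :
    ∃ C, 0 ≤ C ∧ ∀ x, |deriv (deriv (q₀ u₀)) x| ≤ C * wt x := by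
  obtain ⟨c, b, hc, hq⟩ := hu.exists_q_bounds
  obtain ⟨C, hC0, hC⟩ := hu.exists_decay (k := 4) (by norm_num)
  obtain ⟨B, hB0, hB⟩ := hu.exists_abs_deriv_q_le
  have hb : 0 ≤ b := hc.le.trans ((hq 0).1.trans (hq 0).2)
  refine ⟨(C + 6 * b * B ^ 2) / (3 * c ^ 2), by positivity, fun x => ?_⟩
  have hw := wt_pos x
  have h1 : |3 * q₀ u₀ x ^ 2 * deriv (deriv (q₀ u₀)) x| ≤ (C + 6 * b * B ^ 2) * wt x := by
    have e : 3 * q₀ u₀ x ^ 2 * deriv (deriv (q₀ u₀)) x =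
        -(iteratedDeriv 4 u₀ x + 6 * q₀ u₀ x * deriv (q₀ u₀) x ^ 2) := by
      linear_combination hu.deriv_deriv_q_eq x
    have h2 : deriv (q₀ u₀) x ^ 2 ≤ B ^ 2 * wt x := by
      rw [← sq_abs]
      calc |deriv (q₀ u₀) x| ^ 2 ≤ (B * wt x) ^ 2 := pow_le_pow_left₀ (abs_nonneg _) (hB x) 2
        _ = B ^ 2 * wt x * wt x := by ring
        _ ≤ B ^ 2 * wt x * 1 := mul_le_mul_of_nonneg_left (wt_le_one x) (by positivity)
        _ = B ^ 2 * wt x := mul_one _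
    have h3 : |6 * q₀ u₀ x * deriv (q₀ u₀) x ^ 2| ≤ 6 * b * (B ^ 2 * wt x) := by
      have := hu.q_pos x
      rw [abs_of_nonneg (by positivity)]
      exact mul_le_mul (by linarith [(hq x).2]) h2 (by positivity) (by positivity)
    rw [e, abs_neg]
    refine (abs_add_le _ _).trans ((add_le_add (hC x) h3).trans (le_of_eq (by ring)))
  rw [abs_mul, abs_of_nonneg (by positivity)] at h1
  have h4 : 3 * c ^ 2 * |deriv (deriv (q₀ u₀)) x| ≤ (C + 6 * b * B ^ 2) * wt x := by
    refine le_trans (mul_le_mul_of_nonneg_right ?_ (abs_nonneg _)) h1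
    have := pow_le_pow_left₀ hc.le (hq x).1 2
    linarith
  rw [div_mul_eq_mul_div, le_div_iff₀ (by positivity)]
  linarith

theorem integrable_q_sub_one (hu : Admissible u₀) : Integrable fun x => q₀ u₀ x - 1 := by
  obtain ⟨C, -, hC⟩ := hu.exists_abs_q_sub_one_le
  exact integrable_of_le_wt (hu.continuous_q.sub continuous_const) hC

theorem hasDerivAt_y (hu : Admissible u₀) (x : ℝ) : HasDerivAt (y₀ u₀) (q₀ u₀ x) x := by
  have h := hasDerivAt_integral_Ioi (f := fun ξ => q₀ u₀ ξ - 1) (hu.continuous_q.sub continuous_const)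
    (fun a => hu.integrable_q_sub_one.integrableOn) x
  have := (hasDerivAt_id x).sub h
  exact this.congr_deriv (by ring)

theorem continuous_y (hu : Admissible u₀) : Continuous (y₀ u₀) :=
  continuous_iff_continuousAt.2 fun x => (hu.hasDerivAt_y x).continuousAt

theorem strictMono_y (hu : Admissible u₀) : StrictMono (y₀ u₀) :=
  strictMono_of_deriv_pos fun x => by rw [(hu.hasDerivAt_y x).deriv]; exact hu.q_pos x

theorem exists_abs_y_sub_le (hu : Admissible u₀) : ∃ B, 0 ≤ B ∧ ∀ x, |y₀ u₀ x - x| ≤ B := by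
  refine ⟨∫ ξ, |q₀ u₀ ξ - 1|, integral_nonneg fun _ => abs_nonneg _, fun x => ?_⟩
  have e : y₀ u₀ x - x = -∫ ξ in Ioi x, (q₀ u₀ ξ - 1) := by rw [y₀]; ring
  rw [e, abs_neg]
  refine (abs_integral_le_integral_abs).trans ?_
  exact setIntegral_le_integral hu.integrable_q_sub_one.abs
    (Eventually.of_forall fun _ => abs_nonneg _)

theorem tendsto_y_sub (u₀ : ℝ → ℝ) : Tendsto (fun x => y₀ u₀ x - x) atTop (𝓝 0) := by
  have e : (fun x => y₀ u₀ x - x) = fun x => -∫ ξ in Ioi x, (q₀ u₀ ξ - 1) := by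
    funext x; rw [y₀]; ring
  rw [e, ← neg_zero]
  exact (tendsto_integral_Ioi_zero tendsto_id).neg

theorem tendsto_y_atTop (u₀ : ℝ → ℝ) : Tendsto (y₀ u₀) atTop atTop := by
  have := (tendsto_y_sub u₀).add_atTop tendsto_id
  simpa using this

theorem surjective_y (hu : Admissible u₀) : Function.Surjective (y₀ u₀) := by
  refine hu.continuous_y.surjective (tendsto_y_atTop u₀) ?_
  obtain ⟨B, -, hB⟩ := hu.exists_abs_y_sub_le
  refine tendsto_atBot_mono (f := fun x => x + B) (fun x => ?_)
    (tendsto_atBot_add_const_right _ _ tendsto_id)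
  have := (le_abs_self _).trans (hB x)
  linarith

end Admissible

end ShortWave

namespace ShortWave

/-! ### The integral equation and gauge transformations -/

open MeasureTheory

theorem norm_mul_apply_le {A B : Mat} {a b : ℝ} (hA : ∀ i j, ‖A i j‖ ≤ a) (hB : ∀ i j, ‖B i j‖ ≤ b)
    (i j : Fin 3) : ‖(A * B) i j‖ ≤ 3 * (a * b) := by
  rw [Matrix.mul_apply]
  have ha : 0 ≤ a := (norm_nonneg _).trans (hA 0 0)
  refine (norm_sum_le _ _).trans ?_
  refine (Finset.sum_le_sum fun k _ => (norm_mul_le _ _).trans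
    (mul_le_mul (hA i k) (hB k j) (norm_nonneg _) ha)).trans (le_of_eq ?_)
  rw [Finset.sum_const, Finset.card_univ, Fintype.card_fin, nsmul_eq_mul]
  norm_num

theorem potential_eq (u₀ : ℝ → ℝ) (x : ℝ) :
    potential u₀ x = ((deriv (q₀ u₀) x / q₀ u₀ x : ℝ) : ℂ) • Kmat := by
  have e : (!![0, 1 - omega ^ 2, 1 - omega; 1 - omega, 0, 1 - omega ^ 2;
      1 - omega ^ 2, 1 - omega, 0] : Mat) = (3 : ℂ) • Kmat := by
    ext i j
    fin_cases i <;> fin_cases j <;> simp [Kmat] <;> ring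
  rw [potential, e, smul_smul]
  congr 1
  push_cast
  rw [mul_comm, ← mul_div_assoc, mul_div_mul_left _ _ three_ne_zero]

theorem exists_norm_le (A : Mat) : ∃ κ, 0 ≤ κ ∧ ∀ i j, ‖A i j‖ ≤ κ :=
  ⟨∑ i, ∑ j, ‖A i j‖, Finset.sum_nonneg fun _ _ => Finset.sum_nonneg fun _ _ => norm_nonneg _,
    fun i j => (Finset.single_le_sum (f := fun j => ‖A i j‖) (fun _ _ => norm_nonneg _)
      (Finset.mem_univ j)).trans (Finset.single_le_sum (f := fun i => ∑ j, ‖A i j‖)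
      (fun _ _ => Finset.sum_nonneg fun _ _ => norm_nonneg _) (Finset.mem_univ i))⟩

variable {u₀ : ℝ → ℝ}

theorem Admissible.exists_potential_le (hu : Admissible u₀) :
    ∃ C, 0 ≤ C ∧ ∀ x i j, ‖potential u₀ x i j‖ ≤ C * wt x := by
  obtain ⟨c, _, hc, hq⟩ := hu.exists_q_bounds
  obtain ⟨B, hB0, hB⟩ := hu.exists_abs_deriv_q_le
  obtain ⟨κ, hκ0, hκ⟩ := exists_norm_le Kmat
  refine ⟨B / c * κ, by positivity, fun x i j => ?_⟩
  have hw := wt_pos x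
  rw [potential_eq, Matrix.smul_apply, smul_eq_mul, norm_mul, Complex.norm_real, Real.norm_eq_abs,
    abs_div, abs_of_pos (hu.q_pos x)]
  calc |deriv (q₀ u₀) x| / q₀ u₀ x * ‖Kmat i j‖ ≤ (B * wt x / c) * κ :=
        mul_le_mul (div_le_div₀ (by positivity) (hB x) hc (hq x).1) (hκ i j) (norm_nonneg _)
          (by positivity)
    _ = B / c * κ * wt x := by ring

theorem Admissible.continuous_potential (hu : Admissible u₀) : Continuous (potential u₀) := by
  have h : Continuous fun x => ((deriv (q₀ u₀) x / q₀ u₀ x : ℝ) : ℂ) :=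
    Complex.continuous_ofReal.comp (hu.contDiff_deriv_q.continuous.div hu.continuous_q
      fun x => (hu.q_pos x).ne')
  rw [funext (potential_eq u₀)]
  exact h.smul continuous_const

theorem norm_cexp_le {a : ℂ} {r : ℝ} (h : a.re * r ≤ 0) : ‖Complex.exp (a * (r : ℂ))‖ ≤ 1 := by
  rw [Complex.norm_exp, Complex.mul_re, Complex.ofReal_re, Complex.ofReal_im, mul_zero, sub_zero]
  exact Real.exp_le_one_iff.2 h

namespace SolvesIntegralEquation

variable {z : ℂ} {m : ℝ → Mat}

/-- The entries of `U m` decay. -/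
theorem exists_source_le (hu : Admissible u₀) (hm : SolvesIntegralEquation u₀ z m) :
    ∃ C, ∀ x j l, ‖(potential u₀ x * m x) j l‖ ≤ C * wt x := by
  obtain ⟨C, hC0, hC⟩ := hu.exists_potential_le
  obtain ⟨B, hB⟩ := hm.2.1
  refine ⟨3 * (C * B), fun x j l => (norm_mul_apply_le (hC x) (hB x) j l).trans (le_of_eq ?_)⟩
  ring

theorem continuous_source (hu : Admissible u₀) (hm : SolvesIntegralEquation u₀ z m) (j l : Fin 3) :
    Continuous fun x => (potential u₀ x * m x) j l := by
  have h := hu.continuous_potential.matrix_mul hm.1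
  exact (continuous_apply l).comp ((continuous_apply j).comp h)

theorem kernelTerm_eq (j l : Fin 3) (x ξ : ℝ) :
    kernelTerm u₀ z m j l x ξ = Complex.exp ((lam j z - lam l z) * (y₀ u₀ x : ℂ)) *
      (Complex.exp (-(lam j z - lam l z) * (y₀ u₀ ξ : ℂ)) * (potential u₀ ξ * m ξ) j l) := by
  rw [kernelTerm, ← mul_assoc, ← Complex.exp_add]
  congr 2
  push_cast
  ring

theorem sub_mul_one_apply (j l : Fin 3) : (lam j z - lam l z) * (1 : Mat) j l = 0 := by
  by_cases h : j = l
  · subst h; simp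
  · rw [Matrix.one_apply_ne h, mul_zero]

theorem norm_weighted_le (j l : Fin 3) {x ξ : ℝ}
    (h : 0 ≤ (lam j z - lam l z).re * (y₀ u₀ ξ - y₀ u₀ x)) :
    ‖Complex.exp (-(lam j z - lam l z) * (y₀ u₀ ξ : ℂ))‖ ≤
      ‖Complex.exp (-(lam j z - lam l z) * (y₀ u₀ x : ℂ))‖ := by
  simp only [Complex.norm_exp, Complex.mul_re, Complex.ofReal_re, Complex.ofReal_im, mul_zero,
    sub_zero, Complex.neg_re]
  exact Real.exp_le_exp.2 (by nlinarith)

/-- The integral equation is the variation-of-constants form of a linear ODE. The constant δ_{jl}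
contributes nothing because (λ_j - λ_l)δ_{jl} = 0. -/
theorem hasDerivAt_entry (hu : Admissible u₀) (hm : SolvesIntegralEquation u₀ z m) (x : ℝ)
    (j l : Fin 3) : HasDerivAt (fun x => m x j l)
      ((lam j z - lam l z) * q₀ u₀ x * m x j l + (potential u₀ x * m x) j l) x := by
  set a : ℂ := lam j z - lam l z with ha
  set g : ℝ → ℂ := fun ξ => (potential u₀ ξ * m ξ) j l with hg
  set h : ℝ → ℂ := fun ξ => Complex.exp (-a * (y₀ u₀ ξ : ℂ)) * g ξ with hh
  obtain ⟨C, hC⟩ := hm.exists_source_le hu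
  have hgc : Continuous g := hm.continuous_source hu j l
  have hyc : Continuous fun ξ => (y₀ u₀ ξ : ℂ) := Complex.continuous_ofReal.comp hu.continuous_y
  have hhc : Continuous h := ((continuous_const.mul hyc).cexp).mul hgc
  have hexp : HasDerivAt (fun x => Complex.exp (a * (y₀ u₀ x : ℂ)))
      (Complex.exp (a * (y₀ u₀ x : ℂ)) * (a * q₀ u₀ x)) x :=
    ((hu.hasDerivAt_y x).ofReal_comp.const_mul a).cexp
  have hcancel : Complex.exp (a * (y₀ u₀ x : ℂ)) * h x = g x := by
    rw [hh]
    simp only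
    rw [← mul_assoc, ← Complex.exp_add, neg_mul, add_neg_cancel, Complex.exp_zero, one_mul]
  have hbound : ∀ s : Set ℝ, MeasurableSet s → ∀ b, (∀ ξ ∈ s, 0 ≤ a.re * (y₀ u₀ ξ - y₀ u₀ b)) →
      IntegrableOn h s := fun s hs b hb => by
    refine ((integrable_wt.const_mul (‖Complex.exp (-a * (y₀ u₀ b : ℂ))‖ * C)).integrableOn).mono'
      hhc.aestronglyMeasurable ?_
    filter_upwards [ae_restrict_mem hs] with ξ hξ
    rw [hh, norm_mul, mul_assoc]
    exact mul_le_mul (norm_weighted_le j l (hb ξ hξ)) (hC ξ j l) (norm_nonneg _) (norm_nonneg _)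
  have hδ : a * (1 : Mat) j l = 0 := sub_mul_one_apply j l
  have hmono := hu.strictMono_y.monotone
  by_cases hre : (lam l z).re ≤ (lam j z).re
  · have hare : 0 ≤ a.re := by rw [ha, Complex.sub_re]; linarith
    have hm' : ∀ x, m x j l = (1 : Mat) j l - Complex.exp (a * (y₀ u₀ x : ℂ)) * ∫ ξ in Ioi x, h ξ := by
      intro x
      rw [hm.2.2 x j l, if_pos hre, ← sub_eq_add_neg, ← integral_const_mul]
      congr 1
      exact integral_congr_ae (Eventually.of_forall fun ξ => kernelTerm_eq j l x ξ)
    have hi : ∀ b, IntegrableOn h (Ioi b) := fun b => hbound _ measurableSet_Ioi b fun ξ hξ =>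
      mul_nonneg hare (sub_nonneg.2 (hmono (le_of_lt hξ)))
    have := (hexp.fun_mul (hasDerivAt_integral_Ioi hhc hi x)).const_sub ((1 : Mat) j l)
    rw [← funext hm'] at this
    refine this.congr_deriv ?_
    have e := hm' x
    linear_combination (-a * q₀ u₀ x) * e + hcancel - q₀ u₀ x * hδ
  · have hare : a.re ≤ 0 := by rw [ha, Complex.sub_re]; linarith
    have hm' : ∀ x, m x j l = (1 : Mat) j l + Complex.exp (a * (y₀ u₀ x : ℂ)) * ∫ ξ in Iic x, h ξ := by
      intro x
      rw [hm.2.2 x j l, if_neg hre, ← integral_const_mul]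
      congr 1
      exact integral_congr_ae (Eventually.of_forall fun ξ => kernelTerm_eq j l x ξ)
    have hi : ∀ b, IntegrableOn h (Iic b) := fun b => hbound _ measurableSet_Iic b fun ξ hξ =>
      mul_nonneg_of_nonpos_of_nonpos hare (sub_nonpos.2 (hmono hξ))
    have := (hexp.fun_mul (hasDerivAt_integral_Iic hhc hi x)).const_add ((1 : Mat) j l)
    rw [← funext hm'] at this
    refine this.congr_deriv ?_
    have e := hm' x
    linear_combination (-a * q₀ u₀ x) * e + hcancel - q₀ u₀ x * hδ

/-- The end point ∞_{jl} is selected so that the exponential is at most 1 in modulus on the range of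
integration. -/
theorem norm_sub_le_setIntegral (hu : Admissible u₀) (hm : SolvesIntegralEquation u₀ z m) :
    ∃ C, ∀ x j l, ‖m x j l - (1 : Mat) j l‖ ≤ if (lam l z).re ≤ (lam j z).re then
      ∫ ξ in Ioi x, C * wt ξ else ∫ ξ in Iic x, C * wt ξ := by
  obtain ⟨C, hC⟩ := hm.exists_source_le hu
  have hmono := hu.strictMono_y.monotone
  have hk : ∀ j l x ξ, (lam j z - lam l z).re * (y₀ u₀ x - y₀ u₀ ξ) ≤ 0 →
      ‖kernelTerm u₀ z m j l x ξ‖ ≤ C * wt ξ := fun j l x ξ h => by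
    rw [kernelTerm, norm_mul, ← one_mul (C * wt ξ)]
    exact mul_le_mul (norm_cexp_le h) (hC ξ j l) (norm_nonneg _) zero_le_one
  refine ⟨C, fun x j l => ?_⟩
  rw [hm.2.2 x j l, add_sub_cancel_left]
  split_ifs with hre
  · rw [norm_neg]
    refine norm_integral_le_of_norm_le (integrable_wt.const_mul C).integrableOn ?_
    filter_upwards [ae_restrict_mem measurableSet_Ioi] with ξ hξ
    refine hk j l x ξ (mul_nonpos_of_nonneg_of_nonpos ?_ (sub_nonpos.2 (hmono (le_of_lt hξ))))
    rw [Complex.sub_re]; linarith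
  · refine norm_integral_le_of_norm_le (integrable_wt.const_mul C).integrableOn ?_
    filter_upwards [ae_restrict_mem measurableSet_Iic] with ξ hξ
    refine hk j l x ξ (mul_nonpos_of_nonpos_of_nonneg ?_ (sub_nonneg.2 (hmono hξ)))
    rw [Complex.sub_re]; linarith

theorem tendsto_entry_atTop (hu : Admissible u₀) (hm : SolvesIntegralEquation u₀ z m) {j l : Fin 3}
    (hre : (lam l z).re ≤ (lam j z).re) :
    Tendsto (fun x => m x j l) atTop (𝓝 ((1 : Mat) j l)) := by
  obtain ⟨C, hC⟩ := hm.norm_sub_le_setIntegral hu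
  rw [tendsto_iff_norm_sub_tendsto_zero]
  refine squeeze_zero (fun _ => norm_nonneg _) (fun x => ?_)
    (tendsto_integral_Ioi_zero (f := fun ξ => C * wt ξ) (μ := volume) tendsto_id)
  have h := hC x j l
  rw [if_pos hre] at h
  exact h

theorem tendsto_entry_atBot (hu : Admissible u₀) (hm : SolvesIntegralEquation u₀ z m) {j l : Fin 3}
    (hre : ¬ (lam l z).re ≤ (lam j z).re) :
    Tendsto (fun x => m x j l) atBot (𝓝 ((1 : Mat) j l)) := by
  obtain ⟨C, hC⟩ := hm.norm_sub_le_setIntegral hu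
  rw [tendsto_iff_norm_sub_tendsto_zero]
  refine squeeze_zero (fun _ => norm_nonneg _) (fun x => ?_)
    (tendsto_integral_Iic_zero (f := fun ξ => C * wt ξ) (μ := volume) tendsto_id)
  have h := hC x j l
  rw [if_neg hre] at h
  exact h

theorem hasEntryDeriv (hu : Admissible u₀) (hm : SolvesIntegralEquation u₀ z m) (x : ℝ) :
    HasEntryDeriv m ((z * q₀ u₀ x) • (Jmat * m x - m x * Jmat) + potential u₀ x * m x) univ x := by
  intro j l
  refine (hm.hasDerivAt_entry hu x j l).hasDerivWithinAt.congr_deriv ?_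
  rw [Matrix.add_apply, Matrix.smul_apply, Matrix.sub_apply, Jmat, Matrix.mul_diagonal,
    Matrix.diagonal_mul, smul_eq_mul, lam, lam]
  ring

/-- The basic estimate: a gauge transformation `S` with small remainder `R` brings the solution
close to the identity. -/
theorem gauge_estimate (hu : Admissible u₀) (hm : SolvesIntegralEquation u₀ z m) {B : ℝ}
    (hB : ∀ x j l, ‖m x j l‖ ≤ B) {S S' R : ℝ → Mat} (hS : ∀ x, HasEntryDeriv S (S' x) univ x)
    (hS' : Continuous S') (hSt : Tendsto S atTop (𝓝 1)) (hSb : Tendsto S atBot (𝓝 1))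
    (hR : ∀ x, R x = S' x + S x * potential u₀ x + (z * q₀ u₀ x) • (S x * Jmat - Jmat * S x))
    {ρ : ℝ} (hRρ : ∀ x i j, ‖R x i j‖ ≤ ρ * wt x) (x : ℝ) (j l : Fin 3) :
    ‖(S x * m x) j l - (1 : Mat) j l‖ ≤ 3 * B * ρ * ∫ ξ, wt ξ := by
  set a : ℂ := lam j z - lam l z with ha
  set n : ℝ → ℂ := fun ξ => (S ξ * m ξ) j l with hn
  have hδ : a * (1 : Mat) j l = 0 := sub_mul_one_apply j l
  have hnd : ∀ ξ, HasDerivAt n (a * q₀ u₀ ξ * n ξ + (R ξ * m ξ) j l) ξ := by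
    intro ξ
    have h := ((hS ξ).mul (hm.hasEntryDeriv hu ξ) j l).hasDerivAt univ_mem
    refine h.congr_deriv ?_
    have e : S' ξ * m ξ + S ξ * ((z * q₀ u₀ ξ) • (Jmat * m ξ - m ξ * Jmat) + potential u₀ ξ * m ξ) =
        (z * q₀ u₀ ξ) • (Jmat * (S ξ * m ξ) - S ξ * m ξ * Jmat) + R ξ * m ξ := by
      rw [hR]
      simp only [add_mul, mul_add, sub_mul, mul_sub, smul_sub, Matrix.mul_smul, Matrix.smul_mul,
        mul_assoc]
      abel
    rw [e, Matrix.add_apply, Matrix.smul_apply, Matrix.sub_apply, Jmat, Matrix.mul_diagonal,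
      Matrix.diagonal_mul, smul_eq_mul, ha, lam, lam]
    ring
  -- An integrating factor normalized to 1 at ξ = x: it removes the λ-term from the equation of the
  -- gauged solution Sm, so the derivative of k contains the remainder R only.
  set k : ℝ → ℂ := fun ξ => Complex.exp (a * ((y₀ u₀ x - y₀ u₀ ξ : ℝ) : ℂ)) *
    (n ξ - (1 : Mat) j l) with hk
  set k' : ℝ → ℂ := fun ξ => Complex.exp (a * ((y₀ u₀ x - y₀ u₀ ξ : ℝ) : ℂ)) * (R ξ * m ξ) j l
    with hk'
  have hkd : ∀ ξ, HasDerivAt k (k' ξ) ξ := by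
    intro ξ
    have h1 : HasDerivAt (fun ξ => Complex.exp (a * ((y₀ u₀ x - y₀ u₀ ξ : ℝ) : ℂ))) _ ξ :=
      (((hu.hasDerivAt_y ξ).const_sub (y₀ u₀ x)).ofReal_comp.const_mul a).cexp
    refine (h1.fun_mul ((hnd ξ).sub_const ((1 : Mat) j l))).congr_deriv ?_
    simp only [hk']
    push_cast
    linear_combination (Complex.exp (a * ((y₀ u₀ x : ℂ) - (y₀ u₀ ξ : ℂ))) * q₀ u₀ ξ) * hδ
  have hScont : Continuous S := continuous_pi fun i => continuous_pi fun j' =>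
    continuous_iff_continuousAt.2 fun ξ => ((hS ξ i j').hasDerivAt univ_mem).continuousAt
  have hyc : Continuous fun ξ => ((y₀ u₀ x - y₀ u₀ ξ : ℝ) : ℂ) :=
    Complex.continuous_ofReal.comp (continuous_const.sub hu.continuous_y)
  have hRc : Continuous R := by
    have hq : Continuous fun ξ => z * (q₀ u₀ ξ : ℂ) :=
      continuous_const.mul (Complex.continuous_ofReal.comp hu.continuous_q)
    rw [funext hR]
    exact (hS'.add (hScont.matrix_mul hu.continuous_potential)).add
      (hq.smul ((hScont.matrix_mul continuous_const).sub (continuous_const.matrix_mul hScont)))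
  have hk'c : Continuous k' := by
    have h1 : Continuous fun ξ => (R ξ * m ξ) j l :=
      (continuous_apply l).comp ((continuous_apply j).comp (hRc.matrix_mul hm.1))
    exact ((continuous_const.mul hyc).cexp).mul h1
  have hB0 : 0 ≤ B := (norm_nonneg _).trans (hB 0 0 0)
  have hρ0 : 0 ≤ ρ := by
    have h1 := (norm_nonneg _).trans (hRρ 0 0 0)
    exact nonneg_of_mul_nonneg_left h1 (wt_pos 0)
  have hk'b : ∀ ξ, a.re * (y₀ u₀ x - y₀ u₀ ξ) ≤ 0 → ‖k' ξ‖ ≤ 3 * B * ρ * wt ξ := fun ξ h => by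
    simp only [hk']
    rw [norm_mul]
    calc _ ≤ 1 * (3 * (ρ * wt ξ * B)) := mul_le_mul (norm_cexp_le h)
          (norm_mul_apply_le (hRρ ξ) (hB ξ) j l) (norm_nonneg _) zero_le_one
      _ = 3 * B * ρ * wt ξ := by ring
  have hkx : k x = (S x * m x) j l - (1 : Mat) j l := by simp [hk, hn]
  have hlim : ∀ f : Filter ℝ, Tendsto S f (𝓝 1) → Tendsto (fun ξ => m ξ j l) f (𝓝 ((1 : Mat) j l)) →
      Tendsto (fun ξ => ‖n ξ - (1 : Mat) j l‖) f (𝓝 0) := by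
    intro f h1 h2
    have e : ∀ ξ, n ξ - (1 : Mat) j l = (∑ i, (S ξ j i - (1 : Mat) j i) * m ξ i l) +
        (m ξ j l - (1 : Mat) j l) := fun ξ => by
      have h3 : ∑ i, (1 : Mat) j i * m ξ i l = m ξ j l := by
        rw [← Matrix.mul_apply, one_mul]
      simp only [hn, Matrix.mul_apply, sub_mul, Finset.sum_sub_distrib, h3]
      ring
    have h4 : ∀ i, Tendsto (fun ξ => (S ξ j i - (1 : Mat) j i) * m ξ i l) f (𝓝 0) := fun i => by
      have h5 : Tendsto (fun ξ => S ξ j i) f (𝓝 ((1 : Mat) j i)) :=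
        (continuous_id.matrix_elem j i).tendsto (1 : Mat) |>.comp h1
      have h6 : Tendsto (fun ξ => S ξ j i - (1 : Mat) j i) f (𝓝 0) := by
        simpa using h5.sub_const ((1 : Mat) j i)
      exact h6.zero_mul_isBoundedUnder_le ⟨B, eventually_map.2 (Eventually.of_forall fun ξ => hB ξ i l)⟩
    have h7 := (tendsto_finsetSum Finset.univ fun i _ => h4 i).add (h2.sub_const ((1 : Mat) j l))
    simp only [Finset.sum_const_zero, sub_self, add_zero] at h7
    rw [← tendsto_zero_iff_norm_tendsto_zero]
    exact h7.congr fun ξ => (e ξ).symm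
  have hmono := hu.strictMono_y.monotone
  have hftc : ∀ X, k X - k x = ∫ ξ in x..X, k' ξ := fun X =>
    (intervalIntegral.integral_eq_sub_of_hasDerivAt (fun ξ _ => hkd ξ)
      (hk'c.intervalIntegrable _ _)).symm
  have hwtint : ∀ s : Set ℝ, ∫ ξ in s, 3 * B * ρ * wt ξ ≤ 3 * B * ρ * ∫ ξ, wt ξ := fun s => by
    rw [integral_const_mul]
    refine mul_le_mul_of_nonneg_left ?_ (by positivity)
    exact setIntegral_le_integral integrable_wt (Eventually.of_forall fun ξ => (wt_pos ξ).le)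
  have hint : ∀ s : Set ℝ, IntegrableOn (fun ξ => 3 * B * ρ * wt ξ) s := fun s =>
    (integrable_wt.const_mul _).integrableOn
  -- Integrate k from x towards ∞_{jl}: on that side the factor is bounded by 1, and Sm - I tends to
  -- 0 in this entry, so only the integral of the remainder survives.
  have hfin : ∀ f : Filter ℝ, f.NeBot → Tendsto (fun ξ => ‖n ξ - (1 : Mat) j l‖) f (𝓝 0) →
      (∀ᶠ X in f, a.re * (y₀ u₀ x - y₀ u₀ X) ≤ 0 ∧
        ‖∫ ξ in x..X, k' ξ‖ ≤ 3 * B * ρ * ∫ ξ, wt ξ) →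
      ‖k x‖ ≤ 3 * B * ρ * ∫ ξ, wt ξ := by
    intro f hf h1 h2
    have h3 := h1.add_const (3 * B * ρ * ∫ ξ, wt ξ)
    rw [zero_add] at h3
    refine ge_of_tendsto h3 ?_
    filter_upwards [h2] with X hX
    have h4 : k x = k X - ∫ ξ in x..X, k' ξ := by rw [← hftc X]; ring
    rw [h4]
    refine (norm_sub_le _ _).trans (add_le_add ?_ hX.2)
    simp only [hk]
    rw [norm_mul]
    exact mul_le_of_le_one_left (norm_nonneg _) (norm_cexp_le hX.1)
  rw [← hkx]
  by_cases hre : (lam l z).re ≤ (lam j z).re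
  · have hare : 0 ≤ a.re := by rw [ha, Complex.sub_re]; linarith
    have hsgn : ∀ ξ, x ≤ ξ → a.re * (y₀ u₀ x - y₀ u₀ ξ) ≤ 0 := fun ξ hξ =>
      mul_nonpos_of_nonneg_of_nonpos hare (sub_nonpos.2 (hmono hξ))
    refine hfin atTop inferInstance (hlim _ hSt (hm.tendsto_entry_atTop hu hre)) ?_
    filter_upwards [eventually_ge_atTop x] with X hX
    refine ⟨hsgn X hX, ?_⟩
    rw [intervalIntegral.integral_of_le hX]
    refine (norm_integral_le_of_norm_le (hint _) ?_).trans (hwtint _)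
    filter_upwards [ae_restrict_mem measurableSet_Ioc] with ξ hξ
    exact hk'b ξ (hsgn ξ hξ.1.le)
  · have hare : a.re ≤ 0 := by rw [ha, Complex.sub_re]; linarith
    have hsgn : ∀ ξ, ξ ≤ x → a.re * (y₀ u₀ x - y₀ u₀ ξ) ≤ 0 := fun ξ hξ =>
      mul_nonpos_of_nonpos_of_nonneg hare (sub_nonneg.2 (hmono hξ))
    refine hfin atBot inferInstance (hlim _ hSb (hm.tendsto_entry_atBot hu hre)) ?_
    filter_upwards [eventually_le_atBot x] with X hX
    refine ⟨hsgn X hX, ?_⟩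
    rw [intervalIntegral.integral_symm, norm_neg, intervalIntegral.integral_of_le hX]
    refine (norm_integral_le_of_norm_le (hint _) ?_).trans (hwtint _)
    filter_upwards [ae_restrict_mem measurableSet_Ioc] with ξ hξ
    exact hk'b ξ (hsgn ξ hξ.2)

end SolvesIntegralEquation

end ShortWave

namespace ShortWave

/-! ### Behaviour of the direct solution for large and for small spectral parameter -/

open MeasureTheory

/-- Take B to be the supremum s: then s ≤ α + s/2. Finiteness of s, assumed qualitatively, becomes
quantitative. -/
theorem le_two_mul_of_absorb {ι : Type*} [Nonempty ι] {f : ι → ℝ} {α : ℝ} (hb : ∃ B, ∀ i, f i ≤ B)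
    (h : ∀ B, (∀ i, f i ≤ B) → ∀ i, f i ≤ α + B / 2) (i : ι) : f i ≤ 2 * α := by
  obtain ⟨B, hB⟩ := hb
  have hbd : BddAbove (range f) := ⟨B, by rintro _ ⟨i, rfl⟩; exact hB i⟩
  have h1 := ciSup_le (h (⨆ i, f i) fun i => le_ciSup hbd i)
  have h2 := le_ciSup hbd i
  linarith

/-- The solution of `[J, W] = K`. -/
noncomputable def Wmat : Mat :=
  !![0, -omega / 3, -1 / 3; (1 + omega) / 3, 0, -1 / 3; (1 + omega) / 3, -omega / 3, 0]

theorem Wmat_comm : Wmat * Jmat - Jmat * Wmat = -Kmat := by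
  have hω := omega_sq
  rw [Jmat_eq]
  ext i j
  fin_cases i <;> fin_cases j <;> simp [Wmat, Kmat, hω] <;> ring_nf <;> simp only [hω] <;> ring_nf

variable {u₀ : ℝ → ℝ}

namespace Admissible

/-- The gauge S = I + z⁻¹wW, with w = q'/q² and [J, W] = K, cancels the potential to leading order:
zq(SJ - JS) = -(q'/q)K. The remainder is O(1/z) times an integrable weight, which uses two
derivatives of q. For large z the a priori unknown bound on m is absorbed. -/
theorem exists_large_bound (hu : Admissible u₀) :
    ∃ C R : ℝ, ∀ z m, SolvesIntegralEquation u₀ z m → R ≤ ‖z‖ →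
      ∀ x j l, ‖m x j l - (1 : Mat) j l‖ ≤ C / ‖z‖ := by
  obtain ⟨c, _, hc, hq⟩ := hu.exists_q_bounds
  obtain ⟨B₁, hB₁0, hB₁⟩ := hu.exists_abs_deriv_q_le
  obtain ⟨B₂, hB₂0, hB₂⟩ := hu.exists_abs_deriv_deriv_q_le
  obtain ⟨κ, hκ0, hκ⟩ := exists_norm_le Wmat
  obtain ⟨κ', hκ'0, hκ'⟩ := exists_norm_le (Wmat * Kmat)
  set w : ℝ → ℝ := fun x => deriv (q₀ u₀) x / q₀ u₀ x ^ 2 with hw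
  set v : ℝ → ℝ := fun x => deriv (q₀ u₀) x / q₀ u₀ x with hv
  set w' : ℝ → ℝ := fun x => deriv (deriv (q₀ u₀)) x / q₀ u₀ x ^ 2 - 2 * w x * v x with hw'
  have hq0 : ∀ x, q₀ u₀ x ≠ 0 := fun x => (hu.q_pos x).ne'
  have hwd : ∀ x, HasDerivAt w (w' x) x := fun x => by
    refine ((hu.hasDerivAt_deriv_q x).fun_div ((hu.hasDerivAt_q x).fun_pow 2)
      (pow_ne_zero 2 (hq0 x))).congr_deriv ?_
    have := hq0 x
    simp only [hw', hw, hv]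
    field_simp
    push_cast
    ring
  have hwt := wt_pos
  have hwb : ∀ x, |w x| ≤ B₁ / c ^ 2 * wt x := fun x => by
    simp only [hw]
    rw [abs_div, abs_of_pos (pow_pos (hu.q_pos x) 2), div_mul_eq_mul_div]
    exact div_le_div₀ (by have := hwt x; positivity) (hB₁ x) (by positivity)
      (pow_le_pow_left₀ hc.le (hq x).1 2)
  have hvb : ∀ x, |v x| ≤ B₁ / c := fun x => by
    simp only [hv]
    rw [abs_div, abs_of_pos (hu.q_pos x)]
    refine div_le_div₀ hB₁0 ((hB₁ x).trans ?_) hc (hq x).1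
    exact mul_le_of_le_one_right hB₁0 (wt_le_one x)
  have hwv : ∀ x, |w x * v x| ≤ B₁ / c ^ 2 * (B₁ / c) * wt x := fun x => by
    rw [abs_mul]
    refine (mul_le_mul (hwb x) (hvb x) (abs_nonneg _) (by have := hwt x; positivity)).trans
      (le_of_eq (by ring))
  have hw'b : ∀ x, |w' x| ≤ (B₂ / c ^ 2 + 2 * (B₁ / c ^ 2 * (B₁ / c))) * wt x := fun x => by
    have h1 : |deriv (deriv (q₀ u₀)) x / q₀ u₀ x ^ 2| ≤ B₂ / c ^ 2 * wt x := by
      rw [abs_div, abs_of_pos (pow_pos (hu.q_pos x) 2), div_mul_eq_mul_div]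
      exact div_le_div₀ (by have := hwt x; positivity) (hB₂ x) (by positivity)
        (pow_le_pow_left₀ hc.le (hq x).1 2)
    have h2 : |2 * w x * v x| ≤ 2 * (B₁ / c ^ 2 * (B₁ / c) * wt x) := by
      rw [mul_assoc, abs_mul, abs_two]
      exact mul_le_mul_of_nonneg_left (hwv x) zero_le_two
    refine (abs_sub _ _).trans ((add_le_add h1 h2).trans (le_of_eq (by ring)))
  set D₁ : ℝ := (B₂ / c ^ 2 + 2 * (B₁ / c ^ 2 * (B₁ / c))) * κ + B₁ / c ^ 2 * (B₁ / c) * κ' with hD₁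
  -- The first term comes from the gauge estimate with remainder w'W + (wq'/q)WK, the second from
  -- undoing the gauge.
  set C₁ : ℝ := 3 * D₁ * (∫ ξ, wt ξ) + B₁ / c ^ 2 * (3 * κ) with hC₁
  have hI : 0 ≤ ∫ ξ, wt ξ := integral_nonneg fun ξ => (hwt ξ).le
  have hC₁0 : 0 ≤ C₁ := by positivity
  have step : ∀ z m, SolvesIntegralEquation u₀ z m → z ≠ 0 → ∀ B, (∀ x j l, ‖m x j l‖ ≤ B) →
      ∀ x j l, ‖m x j l - (1 : Mat) j l‖ ≤ C₁ * B / ‖z‖ := by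
    intro z m hm hz B hB x j l
    have hz' : 0 < ‖z‖ := norm_pos_iff.2 hz
    have hB0 : 0 ≤ B := (norm_nonneg _).trans (hB 0 0 0)
    have hlim : ∀ f : Filter ℝ, Tendsto wt f (𝓝 0) →
        Tendsto (fun x => (1 : Mat) + (z⁻¹ * (w x : ℂ)) • Wmat) f (𝓝 1) := fun f hf => by
      have h1 : Tendsto w f (𝓝 0) :=
        squeeze_zero_norm (fun x => hwb x) (by simpa using hf.const_mul (B₁ / c ^ 2))
      have h2 : Tendsto (fun x => (w x : ℂ)) f (𝓝 0) := by
        have := (Complex.continuous_ofReal.tendsto 0).comp h1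
        rw [Complex.ofReal_zero] at this
        exact this
      have h3 := ((h2.const_mul z⁻¹).smul_const Wmat).const_add (1 : Mat)
      simpa using h3
    have hw'c : Continuous w' := by
      have h1 := hu.contDiff_deriv_q.continuous
      have h2 := hu.continuous_q
      have h3 := hu.continuous_deriv_deriv_q
      exact (h3.div (h2.pow 2) fun x => pow_ne_zero 2 (hq0 x)).sub
        ((continuous_const.mul (h1.div (h2.pow 2) fun x => pow_ne_zero 2 (hq0 x))).mul
          (h1.div h2 hq0))
    have est := hm.gauge_estimate hu hB (S := fun x => 1 + (z⁻¹ * (w x : ℂ)) • Wmat)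
      (S' := fun x => (z⁻¹ * (w' x : ℂ)) • Wmat)
      (R := fun x => (z⁻¹ * (w' x : ℂ)) • Wmat + (z⁻¹ * ((w x * v x : ℝ) : ℂ)) • (Wmat * Kmat))
      (ρ := ‖z‖⁻¹ * D₁)
      (fun x => by
        have h1 := (HasEntryDeriv.const (S := univ) (s := x) (1 : Mat)).add
          (HasEntryDeriv.smul_const (((hwd x).ofReal_comp.const_mul z⁻¹).hasDerivWithinAt
            (s := univ)) Wmat)
        rwa [zero_add] at h1)
      ((continuous_const.mul (Complex.continuous_ofReal.comp hw'c)).smul continuous_const)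
      (hlim _ tendsto_wt_atTop) (hlim _ tendsto_wt_atBot)
      (fun x => by
        have e1 : (1 + (z⁻¹ * (w x : ℂ)) • Wmat) * Jmat - Jmat * (1 + (z⁻¹ * (w x : ℂ)) • Wmat) =
            -((z⁻¹ * (w x : ℂ)) • Kmat) := by
          rw [← smul_neg, ← Wmat_comm, add_mul, mul_add, one_mul, mul_one, smul_sub,
            Matrix.smul_mul, Matrix.mul_smul]
          abel
        have e2 : z * (q₀ u₀ x : ℂ) * (z⁻¹ * (w x : ℂ)) = (v x : ℂ) := by
          have h0 : (q₀ u₀ x : ℂ) ≠ 0 := by exact_mod_cast hq0 x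
          simp only [hw, hv]
          push_cast
          field_simp
        have e3 : potential u₀ x = (v x : ℂ) • Kmat := potential_eq u₀ x
        rw [e1, smul_neg, smul_smul, e2, e3, add_mul, one_mul, Matrix.smul_mul, Matrix.mul_smul,
          smul_smul]
        push_cast
        rw [mul_assoc]
        abel)
      (fun x i k => by
        rw [Matrix.add_apply, Matrix.smul_apply, Matrix.smul_apply, smul_eq_mul, smul_eq_mul,
          mul_assoc, mul_assoc, ← mul_add, norm_mul, norm_inv, mul_assoc]
        refine mul_le_mul_of_nonneg_left ?_ (by positivity)
        refine (norm_add_le _ _).trans ?_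
        rw [norm_mul, norm_mul, Complex.norm_real, Complex.norm_real, Real.norm_eq_abs,
          Real.norm_eq_abs, hD₁, add_mul]
        have := hwt x
        refine (add_le_add (mul_le_mul (hw'b x) (hκ i k) (norm_nonneg _) (by positivity))
          (mul_le_mul (hwv x) (hκ' i k) (norm_nonneg _) (by positivity))).trans (le_of_eq (by ring)))
      x j l
    have e : m x j l - (1 : Mat) j l = (((1 + (z⁻¹ * (w x : ℂ)) • Wmat) * m x) j l - (1 : Mat) j l) -
        z⁻¹ * (w x : ℂ) * (Wmat * m x) j l := by
      rw [add_mul, one_mul, Matrix.smul_mul, Matrix.add_apply, Matrix.smul_apply, smul_eq_mul]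
      ring
    have h2 : ‖z⁻¹ * (w x : ℂ) * (Wmat * m x) j l‖ ≤ ‖z‖⁻¹ * (B₁ / c ^ 2) * (3 * (κ * B)) := by
      rw [norm_mul, norm_mul, norm_inv, Complex.norm_real, Real.norm_eq_abs]
      refine mul_le_mul (mul_le_mul_of_nonneg_left ((hwb x).trans ?_) (by positivity))
        (norm_mul_apply_le hκ (hB x) j l) (norm_nonneg _) (by positivity)
      exact mul_le_of_le_one_right (by positivity) (wt_le_one x)
    rw [e]
    refine (norm_sub_le _ _).trans ((add_le_add est h2).trans (le_of_eq ?_))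
    rw [hC₁]
    field_simp
  refine ⟨2 * C₁, 2 * C₁ + 1, fun z m hm hR x j l => ?_⟩
  have hzpos : 0 < ‖z‖ := by linarith
  have hz : z ≠ 0 := norm_pos_iff.1 hzpos
  obtain ⟨B, hB⟩ := hm.2.1
  -- For ‖z‖ ≥ 2C₁ + 1 the error C₁B/‖z‖ is at most B/2, so every entry of m is at most 2 uniformly
  -- in z.
  have habs : ∀ i : ℝ × Fin 3 × Fin 3, ‖m i.1 i.2.1 i.2.2‖ ≤ 2 * 1 := by
    refine le_two_mul_of_absorb ⟨B, fun i => hB _ _ _⟩ fun B' hB' i => ?_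
    have h1 := step z m hm hz B' (fun x j l => hB' (x, j, l)) i.1 i.2.1 i.2.2
    have hB'0 : 0 ≤ B' := (norm_nonneg _).trans (hB' (0, 0, 0))
    have h2 : C₁ * B' / ‖z‖ ≤ B' / 2 := by
      rw [div_le_div_iff₀ hzpos two_pos]
      nlinarith
    have h3 : ‖(1 : Mat) i.2.1 i.2.2‖ ≤ 1 := by
      rw [Matrix.one_apply]
      split_ifs <;> simp
    have h4 := norm_add_le (m i.1 i.2.1 i.2.2 - (1 : Mat) i.2.1 i.2.2) ((1 : Mat) i.2.1 i.2.2)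
    rw [sub_add_cancel] at h4
    linarith
  refine (step z m hm hz (2 * 1) (fun x j l => habs (x, j, l)) x j l).trans (le_of_eq ?_)
  ring

theorem commute_structured (q : ℝ) : Kmat * structured q = structured q * Kmat := by
  rw [structured_eq]
  ext i j
  fin_cases i <;> fin_cases j <;> simp [Kmat, Matrix.mul_apply, Fin.sum_univ_three] <;> ring_nf

/-- The gauge S = G(q₀)⁻¹ removes the potential exactly: it is a circulant with logarithmic
derivative -(q'/q)K. What is left is zq(SJ - JS), of size O(z) times an integrable weight, so Sm = I
+ O(z). -/
theorem exists_small_bound (hu : Admissible u₀) :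
    ∃ C δ : ℝ, 0 < δ ∧ ∀ z m, SolvesIntegralEquation u₀ z m → ‖z‖ ≤ δ →
      ∀ x j l, ‖m x j l - structured (q₀ u₀ x) j l‖ ≤ C * ‖z‖ := by
  obtain ⟨c, b, hc, hq⟩ := hu.exists_q_bounds
  obtain ⟨E, hE0, hE⟩ := hu.exists_abs_q_sub_one_le
  have hω : ‖omega‖ = 1 := by
    have := congrArg norm omega_cube
    rw [norm_pow, norm_one] at this
    exact (pow_eq_one_iff_of_nonneg (norm_nonneg _) three_ne_zero).1 this
  have hω' : ‖-1 - omega‖ = 1 := by rw [← omega_sq, norm_pow, hω, one_pow]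
  have hb0 : 0 < b := hc.trans_le ((hq 0).1.trans (hq 0).2)
  set g : ℝ := (b + 1 + c⁻¹) with hg
  have hg0 : 0 < g := by positivity
  have hGb : ∀ x i j, ‖structured (q₀ u₀ x) i j‖ ≤ g := by
    intro x i j
    have key : ∀ α β : ℂ, ‖α‖ = 1 → ‖β‖ = 1 →
        ‖((q₀ u₀ x : ℂ) + α + β * (q₀ u₀ x : ℂ)⁻¹) / 3‖ ≤ g := fun α β hα hβ => by
      rw [norm_div, Complex.norm_ofNat, div_le_iff₀ three_pos]
      have h1 : ‖(q₀ u₀ x : ℂ)‖ ≤ b := by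
        rw [Complex.norm_real, Real.norm_of_nonneg (hu.q_pos x).le]; exact (hq x).2
      have h2 : ‖β * (q₀ u₀ x : ℂ)⁻¹‖ ≤ c⁻¹ := by
        rw [norm_mul, hβ, one_mul, norm_inv, Complex.norm_real, Real.norm_of_nonneg (hu.q_pos x).le]
        exact inv_anti₀ hc (hq x).1
      have h3 := norm_add₃_le (a := (q₀ u₀ x : ℂ)) (b := α) (c := β * (q₀ u₀ x : ℂ)⁻¹)
      rw [hα] at h3
      linarith
    have k1 := key 1 1 norm_one norm_one
    have k2 := key omega (-1 - omega) hω hω'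
    have k3 := key (-1 - omega) omega hω' hω
    rw [one_mul] at k1
    rw [structured_eq]
    fin_cases i <;> fin_cases j <;> first | exact k1 | exact k2 | exact k3
  -- Commuting with the diagonal J kills diagonal entries, and the off-diagonal entries of S vanish
  -- at q = 1, hence decay like q - 1.
  have hJ : ∀ x i j, ‖(structured (q₀ u₀ x)⁻¹ * Jmat - Jmat * structured (q₀ u₀ x)⁻¹) i j‖ ≤
      2 * (E * (1 + c⁻¹)) * wt x := by
    intro x i j
    have hJd : ‖omega ^ ((j : ℕ) + 1) - omega ^ ((i : ℕ) + 1)‖ ≤ 2 := by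
      refine (norm_sub_le _ _).trans ?_
      rw [norm_pow, norm_pow, hω, one_pow, one_pow]
      norm_num
    have hwx := wt_pos x
    by_cases hij : i = j
    · subst hij
      rw [Jmat, Matrix.sub_apply, Matrix.mul_diagonal, Matrix.diagonal_mul, mul_comm, sub_self,
        norm_zero]
      positivity
    · have h1 : |(q₀ u₀ x)⁻¹ - 1| ≤ c⁻¹ * (E * wt x) := by
        have h2 : (q₀ u₀ x)⁻¹ - 1 = -((q₀ u₀ x)⁻¹ * (q₀ u₀ x - 1)) := by
          have := (hu.q_pos x).ne'
          field_simp
          ring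
        rw [h2, abs_neg, abs_mul, abs_of_pos (inv_pos.2 (hu.q_pos x))]
        exact mul_le_mul (inv_anti₀ hc (hq x).1) (hE x) (abs_nonneg _) (by positivity)
      have key : ∀ β : ℂ, ‖β‖ = 1 → ‖((((q₀ u₀ x)⁻¹ : ℝ) : ℂ) - 1 + β * (((q₀ u₀ x : ℝ) : ℂ) - 1)) / 3‖ ≤
          E * (1 + c⁻¹) * wt x := fun β hβ => by
        rw [norm_div, Complex.norm_ofNat, div_le_iff₀ three_pos]
        have h3 := norm_add_le ((((q₀ u₀ x)⁻¹ : ℝ) : ℂ) - 1) (β * (((q₀ u₀ x : ℝ) : ℂ) - 1))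
        rw [norm_mul, hβ, one_mul, ← Complex.ofReal_one, ← Complex.ofReal_sub, ← Complex.ofReal_sub,
          Complex.norm_real, Complex.norm_real, Real.norm_eq_abs, Real.norm_eq_abs] at h3
        have h4 := hE x
        have h5 : 0 ≤ E * (1 + c⁻¹) * wt x := by positivity
        have h6 : E * (1 + c⁻¹) * wt x = c⁻¹ * (E * wt x) + E * wt x := by ring
        push_cast at h3 ⊢
        linarith
      have hent : ‖structured (q₀ u₀ x)⁻¹ i j‖ ≤ E * (1 + c⁻¹) * wt x := by
        have k1 := key omega hω
        have k2 := key (-1 - omega) hω'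
        have e1 : ((((q₀ u₀ x)⁻¹ : ℝ) : ℂ) - 1 + omega * (((q₀ u₀ x : ℝ) : ℂ) - 1)) =
            ((((q₀ u₀ x)⁻¹ : ℝ) : ℂ) + (-1 - omega) + omega * ((((q₀ u₀ x)⁻¹ : ℝ) : ℂ))⁻¹) := by
          push_cast; rw [inv_inv]; ring
        have e2 : ((((q₀ u₀ x)⁻¹ : ℝ) : ℂ) - 1 + (-1 - omega) * (((q₀ u₀ x : ℝ) : ℂ) - 1)) =
            ((((q₀ u₀ x)⁻¹ : ℝ) : ℂ) + omega + (-1 - omega) * ((((q₀ u₀ x)⁻¹ : ℝ) : ℂ))⁻¹) := by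
          push_cast; rw [inv_inv]; ring
        rw [e1] at k1
        rw [e2] at k2
        rw [structured_eq]
        fin_cases i <;> fin_cases j <;>
          first | exact k1 | exact k2 | exact absurd rfl hij
      have e : (structured (q₀ u₀ x)⁻¹ * Jmat - Jmat * structured (q₀ u₀ x)⁻¹) i j =
          structured (q₀ u₀ x)⁻¹ i j * (omega ^ ((j : ℕ) + 1) - omega ^ ((i : ℕ) + 1)) := by
        rw [Jmat, Matrix.sub_apply, Matrix.mul_diagonal, Matrix.diagonal_mul]
        ring
      rw [e, norm_mul]
      refine (mul_le_mul hent hJd (norm_nonneg _) (by positivity)).trans (le_of_eq (by ring))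
  have hcont : Continuous fun q : {q : ℝ // q ≠ 0} => structured q := by
    have hinv : Continuous fun q : {q : ℝ // q ≠ 0} => ((q : ℝ) : ℂ)⁻¹ :=
      (Complex.continuous_ofReal.comp continuous_subtype_val).inv₀ fun q =>
        Complex.ofReal_ne_zero.2 q.2
    have hid : Continuous fun q : {q : ℝ // q ≠ 0} => ((q : ℝ) : ℂ) :=
      Complex.continuous_ofReal.comp continuous_subtype_val
    have hk : ∀ α β : ℂ, Continuous fun q : {q : ℝ // q ≠ 0} =>
        (((q : ℝ) : ℂ) + α + β * ((q : ℝ) : ℂ)⁻¹) / 3 := fun α β =>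
      ((hid.add continuous_const).add (continuous_const.mul hinv)).div_const 3
    have k1 := hk 1 1
    simp only [one_mul] at k1
    have k2 := hk omega (-1 - omega)
    have k3 := hk (-1 - omega) omega
    simp only [structured_eq]
    refine continuous_matrix fun i j => ?_
    fin_cases i <;> fin_cases j <;> first | exact k1 | exact k2 | exact k3
  have hinv0 : ∀ x, (q₀ u₀ x)⁻¹ ≠ 0 := fun x => inv_ne_zero (hu.q_pos x).ne'
  have hSc : Continuous fun x => structured (q₀ u₀ x)⁻¹ := by
    have h1 : Continuous fun x => (⟨(q₀ u₀ x)⁻¹, hinv0 x⟩ : {q : ℝ // q ≠ 0}) :=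
      (hu.continuous_q.inv₀ fun x => (hu.q_pos x).ne').subtype_mk _
    exact hcont.comp h1
  have hlim : ∀ f : Filter ℝ, Tendsto (q₀ u₀) f (𝓝 1) →
      Tendsto (fun x => structured (q₀ u₀ x)⁻¹) f (𝓝 1) := fun f hf => by
    have h1 : Tendsto (fun x => (⟨(q₀ u₀ x)⁻¹, hinv0 x⟩ : {q : ℝ // q ≠ 0})) f
        (𝓝 ⟨1, one_ne_zero⟩) := by
      rw [tendsto_subtype_rng]
      simpa using hf.inv₀ one_ne_zero
    have h2 := (hcont.tendsto ⟨1, one_ne_zero⟩).comp h1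
    have h3 : structured 1 = 1 := by
      have hω2 := omega_sq
      rw [structured_eq]
      ext i j
      fin_cases i <;> fin_cases j <;> norm_num <;> ring
    rw [← h3]
    exact h2
  -- The gauge estimate for Sm, multiplied by the cost 3g of passing back from Sm - I to m - G(q₀).
  set C₁ : ℝ := 3 * (g * (3 * (2 * b * (E * (1 + c⁻¹))) * ∫ ξ, wt ξ)) with hC₁
  have hI : 0 ≤ ∫ ξ, wt ξ := integral_nonneg fun ξ => (wt_pos ξ).le
  have hC₁0 : 0 ≤ C₁ := by positivity
  have step : ∀ z m, SolvesIntegralEquation u₀ z m → ∀ B, (∀ x j l, ‖m x j l‖ ≤ B) →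
      ∀ x j l, ‖m x j l - structured (q₀ u₀ x) j l‖ ≤ C₁ * B * ‖z‖ := by
    intro z m hm B hB x j l
    have hB0 : 0 ≤ B := (norm_nonneg _).trans (hB 0 0 0)
    have hSd : ∀ x, HasEntryDeriv (fun x => structured (q₀ u₀ x)⁻¹)
        (((-(deriv (q₀ u₀) x / q₀ u₀ x) : ℝ) : ℂ) • Kmat * structured (q₀ u₀ x)⁻¹) univ x := fun x => by
      have h0 := (hu.q_pos x).ne'
      have h1 := hasEntryDeriv_structured (((hu.hasDerivAt_q x).fun_inv h0).hasDerivWithinAt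
        (s := univ)) (hinv0 x)
      have e : -deriv (q₀ u₀) x / q₀ u₀ x ^ 2 / (q₀ u₀ x)⁻¹ = -(deriv (q₀ u₀) x / q₀ u₀ x) := by
        field_simp
      rwa [e] at h1
    have hvc : Continuous fun x => ((-(deriv (q₀ u₀) x / q₀ u₀ x) : ℝ) : ℂ) :=
      Complex.continuous_ofReal.comp (hu.contDiff_deriv_q.continuous.div hu.continuous_q
        fun x => (hu.q_pos x).ne').neg
    have est := fun j l => hm.gauge_estimate hu hB (S := fun x => structured (q₀ u₀ x)⁻¹)
      (S' := fun x => ((-(deriv (q₀ u₀) x / q₀ u₀ x) : ℝ) : ℂ) • Kmat * structured (q₀ u₀ x)⁻¹)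
      (R := fun x => (z * q₀ u₀ x) • (structured (q₀ u₀ x)⁻¹ * Jmat - Jmat * structured (q₀ u₀ x)⁻¹))
      (ρ := ‖z‖ * (b * (2 * (E * (1 + c⁻¹)))))
      hSd ((hvc.smul continuous_const).matrix_mul hSc)
      (hlim _ hu.tendsto_q_atTop) (hlim _ hu.tendsto_q_atBot)
      (fun x => by
        rw [potential_eq, Matrix.smul_mul, Matrix.mul_smul, commute_structured, ← add_smul,
          Complex.ofReal_neg, neg_add_cancel, zero_smul, zero_add])
      (fun x i k => by
        rw [Matrix.smul_apply, smul_eq_mul, norm_mul, norm_mul, Complex.norm_real,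
          Real.norm_of_nonneg (hu.q_pos x).le, mul_assoc, mul_assoc, mul_assoc]
        refine mul_le_mul_of_nonneg_left ?_ (norm_nonneg _)
        exact mul_le_mul (hq x).2 (hJ x i k) (norm_nonneg _) hb0.le)
      x j l
    have hone : structured (q₀ u₀ x) * structured (q₀ u₀ x)⁻¹ = 1 :=
      structured_mul_inv (hu.q_pos x).ne'
    have e : m x - structured (q₀ u₀ x) =
        structured (q₀ u₀ x) * (structured (q₀ u₀ x)⁻¹ * m x - 1) := by
      rw [mul_sub, ← mul_assoc, hone, one_mul, mul_one]
    have h1 := norm_mul_apply_le (hGb x) (B := structured (q₀ u₀ x)⁻¹ * m x - 1) (fun i k => by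
      rw [Matrix.sub_apply]; exact est i k) j l
    rw [← e, Matrix.sub_apply] at h1
    refine h1.trans (le_of_eq ?_)
    rw [hC₁]
    ring
  -- The radius gives C₁‖z‖ ≤ 1/2, so half of the unknown bound is absorbed and m is bounded by 2g.
  refine ⟨C₁ * (2 * g), 1 / (2 * C₁ + 1), by positivity, fun z m hm hz x j l => ?_⟩
  obtain ⟨B, hB⟩ := hm.2.1
  have habs : ∀ i : ℝ × Fin 3 × Fin 3, ‖m i.1 i.2.1 i.2.2‖ ≤ 2 * g := by
    refine le_two_mul_of_absorb ⟨B, fun i => hB _ _ _⟩ fun B' hB' i => ?_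
    have h1 := step z m hm B' (fun x j l => hB' (x, j, l)) i.1 i.2.1 i.2.2
    have hB'0 : 0 ≤ B' := (norm_nonneg _).trans (hB' (0, 0, 0))
    rw [le_div_iff₀ (by positivity)] at hz
    have h2 : C₁ * B' * ‖z‖ ≤ B' / 2 := by
      have h5 : C₁ * ‖z‖ ≤ 1 / 2 := by nlinarith [norm_nonneg z]
      nlinarith
    have h3 := hGb i.1 i.2.1 i.2.2
    have h4 := norm_add_le (m i.1 i.2.1 i.2.2 - structured (q₀ u₀ i.1) i.2.1 i.2.2)
      (structured (q₀ u₀ i.1) i.2.1 i.2.2)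
    rw [sub_add_cancel] at h4
    linarith
  exact step z m hm (2 * g) (fun x j l => habs (x, j, l)) x j l

end Admissible

/-- At `t = 0` the direct solution solves the Riemann–Hilbert problem, so that the solution of the
latter reproduces `q₀`. -/
theorem initial_value (hu : Admissible u₀) {D : RHData} (hD : IsScatteringData u₀ D)
    {M : ℝ → ℝ → ℂ → Mat} (hM : ∀ y t : ℝ, 0 ≤ t → IsUniqueRHSolution D y t (M y t))
    {qh : ℝ → ℝ → ℝ}
    (hG : ∀ y t : ℝ, 0 ≤ t → Tendsto (M y t) (𝓝[contourᶜ] 0) (𝓝 (structured (qh y t)))) (x : ℝ) :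
    qh (y₀ u₀ x) 0 = q₀ u₀ x := by
  obtain ⟨m, hm, hJ⟩ := hD
  obtain ⟨C, R, hlarge⟩ := hu.exists_large_bound
  obtain ⟨C', δ, hδ, hsmall⟩ := hu.exists_small_bound
  have hev := RHData.eventually_mem_domain (D := D) zero_mem_contour
  have hlim : Tendsto (m x) (𝓝[contourᶜ] 0) (𝓝 (structured (q₀ u₀ x))) := by
    refine JumpAndResidue.tendsto_entry.2 fun i j => ?_
    rw [tendsto_iff_norm_sub_tendsto_zero]
    have h0 : Tendsto (fun z : ℂ => C' * ‖z‖) (𝓝[contourᶜ] 0) (𝓝 0) := by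
      have := (continuous_norm (E := ℂ)).tendsto 0 |>.const_mul C'
      rw [norm_zero, mul_zero] at this
      exact this.mono_left nhdsWithin_le_nhds
    refine squeeze_zero' (Eventually.of_forall fun _ => norm_nonneg _) ?_ h0
    filter_upwards [hev, mem_nhdsWithin_of_mem_nhds (Metric.closedBall_mem_nhds 0 hδ)] with z hz hzb
    exact hsmall z _ (hm z hz) (by simpa using hzb) x i j
  -- The two asymptotic estimates supply what the scattering data do not state: limits at the origin
  -- and normalization at infinity.
  have hsol : IsRHSolution D (y₀ u₀ x) 0 (m x) :=
    ⟨hJ x, fun ν => ⟨_, hlim.mono_left (nhdsWithin_mono _ (sector_subset ν))⟩,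
      C, R, fun z hz hR i j => hlarge z _ (hm z hz) hR x i j⟩
  have heq := (hM (y₀ u₀ x) 0 le_rfl).2 (m x) hsol
  have hlim' : Tendsto (m x) (𝓝[contourᶜ] 0) (𝓝 (structured (qh (y₀ u₀ x) 0))) := by
    refine (hG (y₀ u₀ x) 0 le_rfl).congr' ?_
    filter_upwards [hev] with z hz using (heq z hz).symm
  have := neBot_contour_compl
  have e := tendsto_nhds_unique hlim' hlim
  have h1 := structured_row_sum (qh (y₀ u₀ x) 0)
  rw [e, structured_row_sum] at h1
  exact_mod_cast h1.symm

end ShortWave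
namespace ShortWave

open MeasureTheory

/-! ### Energy conservation for the Tzitzeica flow -/

section Energy

/-- A positive solution `q` of `(log q)_t = φ`, `φ_y = q² - 1/q` on the half-plane, with bounds on
quarter-planes, and with limit `1` as `y → ∞`, integrably at the initial time. -/
structure TzitzeicaFlow (q φ : ℝ → ℝ → ℝ) : Prop where
  pos : ∀ y t, 0 ≤ t → 0 < q y t
  continuousOn_q : ContinuousOn (fun p : ℝ × ℝ => q p.1 p.2) halfPlane
  continuousOn_φ : ContinuousOn (fun p : ℝ × ℝ => φ p.1 p.2) halfPlane
  hasDerivAt_φ : ∀ y t, 0 ≤ t → HasDerivAt (fun η => φ η t) (q y t ^ 2 - (q y t)⁻¹) y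
  hasDerivWithinAt_q : ∀ y t, 0 ≤ t →
    HasDerivWithinAt (fun s => q y s) (φ y t * q y t) (Ici 0) t
  bound : ∀ a T : ℝ, ∃ K : ℝ, 1 ≤ K ∧ ∀ y, a ≤ y → ∀ t ∈ Icc 0 T,
    q y t ≤ K ∧ (q y t)⁻¹ ≤ K ∧ |φ y t| ≤ K ∧ ∀ s ∈ Icc 0 T, |φ y s - φ y t| ≤ K * |s - t|
  tendsto_q : ∀ t, 0 ≤ t → Tendsto (fun y => q y t) atTop (𝓝 1)
  initial : ∃ c C : ℝ, 0 < c ∧ ∀ y, c ≤ q y 0 ∧ |q y 0 - 1| ≤ C * wt y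

/-- The potential energy density `q²/2 + 1/q - 3/2`. -/
noncomputable def energy (q : ℝ) : ℝ := q ^ 2 / 2 + q⁻¹ - 3 / 2

/-- The density has a double zero at q = 1, so it is nonnegative and initially decays like the
square of q - 1. -/
theorem energy_eq {q : ℝ} (hq : 0 < q) : energy q = (q - 1) ^ 2 * (1 / 2 + q⁻¹) := by
  unfold energy; field_simp; ring

theorem energy_nonneg {q : ℝ} (hq : 0 < q) : 0 ≤ energy q := by
  rw [energy_eq hq]; positivity

/-- The reciprocal 1/q can be small only where the energy is large. With finite total energy, ∫1/q
therefore diverges towards -∞. -/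
theorem half_le_inv_add_energy {q : ℝ} (hq : 0 < q) : 1 / 2 ≤ q⁻¹ + energy q := by
  have h : q⁻¹ + energy q - 1 / 2 = (q ^ 3 - 4 * q + 4) * (q⁻¹ / 2) := by
    unfold energy; field_simp; ring
  -- For q > 0 the cubic is minimal at 2/√3; 6/5 is a rational approximation to it.
  have : 0 ≤ q ^ 3 - 4 * q + 4 := by nlinarith [sq_nonneg (q - 6/5), mul_pos hq hq]
  have : 0 ≤ (q ^ 3 - 4 * q + 4) * (q⁻¹ / 2) := by positivity
  linarith

namespace TzitzeicaFlow

variable {q φ : ℝ → ℝ → ℝ}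

theorem continuous_q (h : TzitzeicaFlow q φ) {t : ℝ} (ht : 0 ≤ t) : Continuous fun y => q y t :=
  h.continuousOn_q.comp_continuous (f := fun y => (y, t)) (by fun_prop) fun _ => ht

theorem continuous_φ (h : TzitzeicaFlow q φ) {t : ℝ} (ht : 0 ≤ t) : Continuous fun y => φ y t :=
  h.continuousOn_φ.comp_continuous (f := fun y => (y, t)) (by fun_prop) fun _ => ht

theorem continuous_q_inv (h : TzitzeicaFlow q φ) {t : ℝ} (ht : 0 ≤ t) :
    Continuous fun y => (q y t)⁻¹ := (h.continuous_q ht).inv₀ fun y => (h.pos y t ht).ne'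

theorem continuous_energy (h : TzitzeicaFlow q φ) {t : ℝ} (ht : 0 ≤ t) :
    Continuous fun y => energy (q y t) :=
  ((((h.continuous_q ht).pow 2).div_const 2).add (h.continuous_q_inv ht)).sub continuous_const

theorem continuousOn_φ_time (h : TzitzeicaFlow q φ) (y : ℝ) : ContinuousOn (φ y) (Ici 0) :=
  h.continuousOn_φ.comp (f := fun t => (y, t)) (by fun_prop) fun _ ht => ht

theorem intervalIntegrable_φ_time (h : TzitzeicaFlow q φ) (y : ℝ) {s t : ℝ} (hs : 0 ≤ s)
    (ht : 0 ≤ t) : IntervalIntegrable (fun s => φ y s ^ 2) volume s t :=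
  (((h.continuousOn_φ_time y).pow 2).mono fun _ hx =>
    (le_min hs ht).trans hx.1).intervalIntegrable

theorem hasDerivWithinAt_energy (h : TzitzeicaFlow q φ) (y : ℝ) {t : ℝ} (ht : 0 ≤ t) :
    HasDerivWithinAt (fun s => energy (q y s)) (φ y t * (q y t ^ 2 - (q y t)⁻¹)) (Ici 0) t := by
  have hq := h.hasDerivWithinAt_q y t ht
  have h0 := (h.pos y t ht).ne'
  have := (((hq.fun_pow 2).div_const 2).fun_add (hq.fun_inv h0)).sub_const (3 / 2)
  refine this.congr_deriv ?_
  field_simp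
  push_cast
  ring

theorem hasDerivAt_φ_sq (h : TzitzeicaFlow q φ) (y : ℝ) {t : ℝ} (ht : 0 ≤ t) :
    HasDerivAt (fun η => φ η t ^ 2 / 2) (φ y t * (q y t ^ 2 - (q y t)⁻¹)) y := by
  refine (((h.hasDerivAt_φ y t ht).fun_pow 2).div_const 2).congr_deriv ?_
  simp; ring

/-- Conservation of energy on a rectangle. -/
theorem integral_energy_sub (h : TzitzeicaFlow q φ) (y Y : ℝ) {t : ℝ} (ht : 0 ≤ t) :
    (∫ η in y..Y, energy (q η t)) - ∫ η in y..Y, energy (q η 0) =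
      (∫ s in (0 : ℝ)..t, φ Y s ^ 2 / 2) - ∫ s in (0 : ℝ)..t, φ y s ^ 2 / 2 := by
  -- This function is both the t-derivative of the energy density and the y-derivative of φ²/2. Its
  -- double integral over the rectangle, in the two orders, is the claim.
  have hF : ContinuousOn (fun p : ℝ × ℝ => φ p.1 p.2 * (q p.1 p.2 ^ 2 - (q p.1 p.2)⁻¹))
      halfPlane :=
    h.continuousOn_φ.mul ((h.continuousOn_q.pow 2).sub
      (h.continuousOn_q.inv₀ fun p hp => (h.pos p.1 p.2 hp).ne'))
  have h1 : ∀ η, ∫ s in (0 : ℝ)..t, φ η s * (q η s ^ 2 - (q η s)⁻¹) =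
      energy (q η t) - energy (q η 0) := fun η => by
    refine intervalIntegral.integral_eq_sub_of_hasDerivAt_of_le (f := fun s => energy (q η s)) ht
      (fun s hs => (h.hasDerivWithinAt_energy η hs.1).continuousWithinAt.mono fun x hx => hx.1)
      (fun s hs => (h.hasDerivWithinAt_energy η hs.1.le).hasDerivAt (Ici_mem_nhds hs.1)) ?_
    refine ContinuousOn.intervalIntegrable ?_
    rw [uIcc_of_le ht]
    exact hF.comp (f := fun s => (η, s)) (by fun_prop) fun s hs => hs.1
  have h2 : ∀ s, 0 ≤ s → ∫ η in y..Y, φ η s * (q η s ^ 2 - (q η s)⁻¹) =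
      φ Y s ^ 2 / 2 - φ y s ^ 2 / 2 := fun s hs => by
    refine intervalIntegral.integral_eq_sub_of_hasDerivAt (f := fun η => φ η s ^ 2 / 2)
      (fun η _ => h.hasDerivAt_φ_sq η hs) (Continuous.intervalIntegrable ?_ _ _)
    exact hF.comp_continuous (f := fun η => (η, s)) (by fun_prop) fun η => hs
  rw [← intervalIntegral.integral_sub ((h.continuous_energy ht).intervalIntegrable _ _)
    ((h.continuous_energy le_rfl).intervalIntegrable _ _),
    ← intervalIntegral.integral_sub ((h.intervalIntegrable_φ_time Y le_rfl ht).div_const 2)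
    ((h.intervalIntegrable_φ_time y le_rfl ht).div_const 2)]
  have e1 : ∫ η in y..Y, (energy (q η t) - energy (q η 0)) =
      ∫ η in y..Y, ∫ s in (0 : ℝ)..t, φ η s * (q η s ^ 2 - (q η s)⁻¹) := by simp_rw [h1]
  have e2 : ∫ s in (0 : ℝ)..t, (φ Y s ^ 2 / 2 - φ y s ^ 2 / 2) =
      ∫ s in (0 : ℝ)..t, ∫ η in y..Y, φ η s * (q η s ^ 2 - (q η s)⁻¹) :=
    intervalIntegral.integral_congr fun s hs => (h2 s (by rw [uIcc_of_le ht] at hs; exact hs.1)).symm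
  rw [e1, e2]
  refine intervalIntegral_intervalIntegral_swap (F := fun η s => φ η s * (q η s ^ 2 - (q η s)⁻¹)) ?_
  refine IntegrableOn.mono_set ?_ (prod_mono uIoc_subset_uIcc uIoc_subset_uIcc)
  refine ContinuousOn.integrableOn_compact (isCompact_uIcc.prod isCompact_uIcc) ?_
  refine hF.mono fun p hp => ?_
  have := hp.2
  rw [uIcc_of_le ht] at this
  exact this.1

/-- The initial energy density decays like the square of the weight. -/
theorem exists_energy_initial_le (h : TzitzeicaFlow q φ) :
    ∃ C, 0 ≤ C ∧ ∀ y, energy (q y 0) ≤ C * wt y ^ 2 := by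
  obtain ⟨c, C, hc, hi⟩ := h.initial
  refine ⟨C ^ 2 * (1 / 2 + c⁻¹), by positivity, fun y => ?_⟩
  have hq := h.pos y 0 le_rfl
  rw [energy_eq hq]
  have h1 : (q y 0 - 1) ^ 2 ≤ (C * wt y) ^ 2 := sq_le_sq' (by linarith [abs_le.1 (hi y).2]) (abs_le.1 (hi y).2).2
  have h2 : (q y 0)⁻¹ ≤ c⁻¹ := inv_anti₀ hc (hi y).1
  calc _ ≤ (C * wt y) ^ 2 * (1 / 2 + c⁻¹) :=
        mul_le_mul h1 (by linarith) (by positivity) (by positivity)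
    _ = _ := by ring

/-- `φ` vanishes as `y → ∞`. -/
theorem tendsto_φ (h : TzitzeicaFlow q φ) {t : ℝ} (ht : 0 ≤ t) :
    Tendsto (fun y => φ y t) atTop (𝓝 0) := by
  obtain ⟨K, hK1, hK⟩ := h.bound 0 (t + 1)
  rw [Metric.tendsto_nhds]
  intro ε hε
  -- φ is the t-derivative of log q and is K-Lipschitz in t. Hence |φ| is at most Kδ ≤ ε/2 plus the
  -- increment of log q over [t, t + δ] divided by δ, and that increment tends to 0 as y → ∞. The
  -- cap 1 keeps the interval where the bound K applies.
  set δ : ℝ := min 1 (ε / (2 * K)) with hδ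
  have hδ0 : 0 < δ := by positivity
  have hKδ : K * δ ≤ ε / 2 := by
    calc K * δ ≤ K * (ε / (2 * K)) := by gcongr; exact min_le_right _ _
      _ = ε / 2 := by field_simp
  have hlog : ∀ s, 0 ≤ s → Tendsto (fun y => Real.log (q y s)) atTop (𝓝 0) := fun s hs => by
    have := (h.tendsto_q s hs).log one_ne_zero
    rwa [Real.log_one] at this
  have hd : Tendsto (fun y => Real.log (q y (t + δ)) - Real.log (q y t)) atTop (𝓝 0) := by
    simpa using (hlog _ (by positivity)).sub (hlog t ht)
  have hev := (Metric.tendsto_nhds.1 hd) (δ * (ε / 2)) (by positivity)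
  filter_upwards [hev, eventually_ge_atTop 0] with y hy hy0
  rw [Real.dist_eq, sub_zero] at hy ⊢
  have hcv := (convex_Icc t (t + δ)).norm_image_sub_le_of_norm_hasDerivWithin_le
    (f := fun s => Real.log (q y s) - s * φ y t) (f' := fun s => φ y s - φ y t) (C := K * δ)
    (x := t) (y := t + δ) (fun s hs => ?_) (fun s hs => ?_) (by simp [hδ0.le]) (by simp [hδ0.le])
  · have e : (Real.log (q y (t + δ)) - (t + δ) * φ y t) - (Real.log (q y t) - t * φ y t) =
        (Real.log (q y (t + δ)) - Real.log (q y t)) - δ * φ y t := by ring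
    beta_reduce at hcv
    rw [e, Real.norm_eq_abs, Real.norm_eq_abs, show t + δ - t = δ by ring, abs_of_pos hδ0] at hcv
    have h1 : |δ * φ y t| ≤ K * δ * δ + |Real.log (q y (t + δ)) - Real.log (q y t)| := by
      have := abs_sub_abs_le_abs_sub (δ * φ y t) (Real.log (q y (t + δ)) - Real.log (q y t))
      rw [abs_sub_comm (δ * φ y t)] at this
      linarith
    rw [abs_mul, abs_of_pos hδ0] at h1
    have h2 : K * δ * δ ≤ ε / 2 * δ := by gcongr
    have : δ * |φ y t| < δ * ε := by linarith
    exact lt_of_mul_lt_mul_left this hδ0.le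
  · have hs0 : 0 ≤ s := ht.trans hs.1
    have h1 := (h.hasDerivWithinAt_q y s hs0).log (h.pos y s hs0).ne'
    have h2 := h1.fun_sub ((hasDerivWithinAt_id s (Ici 0)).mul_const (φ y t))
    refine (h2.congr_deriv ?_).mono fun x hx => ht.trans hx.1
    rw [one_mul, mul_div_assoc, div_self (h.pos y s hs0).ne', mul_one]
  · have hδ1 : δ ≤ 1 := min_le_left _ _
    have := (hK y hy0 t ⟨ht, by linarith⟩).2.2.2 s ⟨ht.trans hs.1, hs.2.trans (by linarith)⟩
    refine this.trans ?_
    rw [abs_of_nonneg (by linarith [hs.1])]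
    gcongr
    linarith [hs.2]

end TzitzeicaFlow

end Energy

end ShortWave
namespace ShortWave

open MeasureTheory

/-! ### Quadratic decay of φ and of 1/q - 1 -/

section Decay

/-- An integrable weight of quadratic decay. -/
noncomputable def wtTwo (y : ℝ) : ℝ := (1 + y ^ 2)⁻¹

theorem wtTwo_pos (y : ℝ) : 0 < wtTwo y := by unfold wtTwo; positivity

theorem wt_sq_le {y : ℝ} (hy : 1 ≤ y) : wt y ^ 2 ≤ y ^ (-8 : ℤ) := by
  rw [wt, inv_pow, ← pow_mul, zpow_neg]
  have h : y ≤ 1 + |y| := by linarith [le_abs_self y]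
  refine inv_anti₀ (by positivity) ?_
  exact_mod_cast pow_le_pow_left₀ (by linarith) h 8

theorem integral_wt_sq_le {y Y : ℝ} (hy : 1 ≤ y) (hY : y ≤ Y) :
    ∫ η in y..Y, wt η ^ 2 ≤ (y ^ 6)⁻¹ := by
  have h0 : (0 : ℝ) ∉ uIcc y Y := by
    rw [uIcc_of_le hY]; exact fun h => by linarith [h.1]
  have h1 : ∫ η in y..Y, wt η ^ 2 ≤ ∫ η in y..Y, η ^ (-8 : ℤ) := by
    refine intervalIntegral.integral_mono_on hY ((continuous_wt.pow 2).intervalIntegrable _ _)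
      (intervalIntegral.intervalIntegrable_zpow (Or.inr h0)) fun η hη => wt_sq_le (hy.trans hη.1)
  refine h1.trans ?_
  rw [integral_zpow (Or.inr ⟨by norm_num, h0⟩)]
  have hy0 : 0 < y := by linarith
  have hY0 : 0 < Y := by linarith
  have e : (Y ^ (-8 + 1 : ℤ) - y ^ (-8 + 1 : ℤ)) / ((-8 : ℤ) + 1) =
      ((y ^ 7)⁻¹ - (Y ^ 7)⁻¹) / 7 := by
    rw [show (-8 + 1 : ℤ) = -(7 : ℕ) by norm_num, zpow_neg, zpow_neg, zpow_natCast, zpow_natCast]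
    push_cast; ring
  rw [e]
  have h2 : (y ^ 7)⁻¹ ≤ (y ^ 6)⁻¹ :=
    inv_anti₀ (by positivity) (pow_le_pow_right₀ hy (by norm_num))
  have h3 : 0 < (Y ^ 7)⁻¹ := by positivity
  have h4 : 0 < (y ^ 6)⁻¹ := by positivity
  linarith

/-- Functions bounded on `[a, ∞)` and of quadratic decay are bounded by the weight. -/
theorem le_wtTwo {K C a y v : ℝ} (hK : 0 ≤ K) (hC : 0 ≤ C) (ha : a ≤ y)
    (hv : v ≤ K) (h : 1 ≤ y → v ≤ C * (y ^ 2)⁻¹) : v ≤ (K * (2 + a ^ 2) + 2 * C) * wtTwo y := by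
  rw [wtTwo, ← div_eq_mul_inv, le_div_iff₀ (by positivity)]
  rcases le_or_gt 1 y with hy | hy
  · have h1 := h hy
    rw [← div_eq_mul_inv, le_div_iff₀ (by positivity)] at h1
    have hy2 : 1 ≤ y ^ 2 := by nlinarith
    rcases le_or_gt 0 v with h0 | h0
    · have : v ≤ C := by nlinarith
      nlinarith [mul_nonneg hK (add_nonneg zero_le_two (sq_nonneg a))]
    · have : v * (1 + y ^ 2) ≤ 0 := by nlinarith
      nlinarith [mul_nonneg hK (add_nonneg zero_le_two (sq_nonneg a))]
  · have hy2 : 1 + y ^ 2 ≤ 2 + a ^ 2 := by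
      rcases le_or_gt 0 y with h0 | h0 <;> nlinarith [sq_nonneg a]
    have h1 : v * (1 + y ^ 2) ≤ K * (1 + y ^ 2) := by gcongr
    have h2 : K * (1 + y ^ 2) ≤ K * (2 + a ^ 2) := by gcongr
    linarith

namespace TzitzeicaFlow

variable {q φ : ℝ → ℝ → ℝ}

/-- On [y, Y] the energy at time t is nonnegative, so the flux through y is at most the flux through
Y plus the initial energy. As Y → ∞ the flux through Y vanishes by dominated convergence, and the
initial energy beyond y is O(y⁻⁶). -/
theorem exists_integral_φ_sq_le (h : TzitzeicaFlow q φ) :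
    ∃ C, 0 ≤ C ∧ ∀ y, 1 ≤ y → ∀ t, 0 ≤ t →
      ∫ s in (0 : ℝ)..t, φ y s ^ 2 ≤ C * (y ^ 6)⁻¹ := by
  obtain ⟨C, hC0, hC⟩ := h.exists_energy_initial_le
  refine ⟨2 * C, by positivity, fun y hy t ht => ?_⟩
  obtain ⟨K, hK1, hK⟩ := h.bound 0 t
  have hlim : Tendsto (fun Y => ∫ s in (0 : ℝ)..t, φ Y s ^ 2 / 2) atTop
      (𝓝 (∫ _ in (0 : ℝ)..t, (0 : ℝ))) := by
    refine intervalIntegral.tendsto_integral_filter_of_dominated_convergence (fun _ => K ^ 2 / 2)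
      (Eventually.of_forall fun Y => ?_) ?_ (by simp) (Eventually.of_forall fun s hs => ?_)
    · exact (intervalIntegrable_iff.1
        ((h.intervalIntegrable_φ_time Y le_rfl ht).div_const 2)).aestronglyMeasurable
    · filter_upwards [eventually_ge_atTop 0] with Y hY
      refine Eventually.of_forall fun s hs => ?_
      rw [uIoc_of_le ht] at hs
      have := (hK Y hY s ⟨hs.1.le, hs.2⟩).2.2.1
      rw [Real.norm_eq_abs, abs_of_nonneg (by positivity), ← sq_abs]
      gcongr
    · rw [uIoc_of_le ht] at hs
      simpa using ((h.tendsto_φ hs.1.le).pow 2).div_const 2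
  rw [intervalIntegral.integral_zero] at hlim
  have hle : ∀ Y, y ≤ Y → ∫ s in (0 : ℝ)..t, φ y s ^ 2 / 2 ≤
      (∫ s in (0 : ℝ)..t, φ Y s ^ 2 / 2) + C * (y ^ 6)⁻¹ := fun Y hY => by
    have h1 := h.integral_energy_sub y Y ht
    have h2 : 0 ≤ ∫ η in y..Y, energy (q η t) :=
      intervalIntegral.integral_nonneg hY fun η _ => energy_nonneg (h.pos η t ht)
    have h3 : ∫ η in y..Y, energy (q η 0) ≤ ∫ η in y..Y, C * wt η ^ 2 :=
      intervalIntegral.integral_mono_on hY ((h.continuous_energy le_rfl).intervalIntegrable _ _)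
        ((continuous_const.mul (continuous_wt.pow 2)).intervalIntegrable _ _) fun η _ => hC η
    rw [intervalIntegral.integral_const_mul] at h3
    have h4 := mul_le_mul_of_nonneg_left (integral_wt_sq_le hy hY) hC0
    linarith
  have := ge_of_tendsto (hlim.add_const (C * (y ^ 6)⁻¹))
    ((eventually_ge_atTop y).mono hle)
  rw [intervalIntegral.integral_div] at this
  linarith

/-- Quadratic decay of `φ`. -/
theorem exists_abs_φ_le_inv_sq (h : TzitzeicaFlow q φ) (T : ℝ) :
    ∃ C, 0 ≤ C ∧ ∀ y, 1 ≤ y → ∀ t ∈ Icc 0 T, |φ y t| ≤ C * (y ^ 2)⁻¹ := by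
  obtain ⟨C, hC0, hC⟩ := h.exists_integral_φ_sq_le
  -- One extra unit of time leaves room for the interval [t, t + δ] with δ ≤ 1.
  obtain ⟨K, hK1, hK⟩ := h.bound 1 (T + 1)
  have hK0 : 0 < K := by linarith
  refine ⟨1 + 8 * K * C, by positivity, fun y hy t ht => ?_⟩
  have ht1 : t ∈ Icc 0 (T + 1) := ⟨ht.1, by linarith [ht.2]⟩
  obtain ⟨-, -, hb, hl⟩ := hK y hy t ht1
  set m := |φ y t| with hm
  have hm0 : 0 ≤ m := abs_nonneg _
  -- Being K-Lipschitz, φ keeps at least half its size m on [t, t + δ]. So δm²/4, a multiple of m³,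
  -- is bounded by the integral of φ².
  set δ := m / (2 * K) with hδ
  have hδ0 : 0 ≤ δ := by positivity
  have hδ1 : δ ≤ 1 := by rw [hδ, div_le_one (by positivity)]; linarith
  have hKδ : K * δ = m / 2 := by rw [hδ]; field_simp
  have hlow : δ * (m ^ 2 / 4) ≤ ∫ s in t..t + δ, φ y s ^ 2 := by
    have e : ∫ _ in t..t + δ, m ^ 2 / 4 = δ * (m ^ 2 / 4) := by
      rw [intervalIntegral.integral_const]; simp
    rw [← e]
    refine intervalIntegral.integral_mono_on (by linarith) (by simp)
      (h.intervalIntegrable_φ_time y ht.1 (by linarith [ht.1])) fun s hs => ?_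
    have h1 := hl s ⟨ht.1.trans hs.1, by linarith [hs.2, ht.2]⟩
    rw [abs_of_nonneg (sub_nonneg.2 hs.1)] at h1
    have h2 : K * (s - t) ≤ K * δ := by gcongr; linarith [hs.2]
    have h3 := abs_sub_abs_le_abs_sub (φ y t) (φ y s)
    rw [abs_sub_comm (φ y t) (φ y s), ← hm] at h3
    have h4 : m / 2 ≤ |φ y s| := by linarith
    have h5 : (m / 2) ^ 2 ≤ |φ y s| ^ 2 := by gcongr
    rw [sq_abs] at h5
    linarith
  have hup : ∫ s in t..t + δ, φ y s ^ 2 ≤ C * (y ^ 6)⁻¹ := by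
    refine le_trans ?_ (hC y hy (t + δ) (by linarith [ht.1]))
    exact intervalIntegral.integral_mono_interval ht.1 (by linarith) le_rfl
      (Eventually.of_forall fun s => sq_nonneg _)
      (h.intervalIntegrable_φ_time y le_rfl (by linarith [ht.1]))
  have hcube : m ^ 3 ≤ 8 * K * C * (y ^ 6)⁻¹ := by
    have e : δ * (m ^ 2 / 4) * (8 * K) = m ^ 3 := by rw [hδ]; field_simp; ring
    rw [← e]
    calc _ ≤ C * (y ^ 6)⁻¹ * (8 * K) := 
          mul_le_mul_of_nonneg_right (hlow.trans hup) (by positivity)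
      _ = _ := by ring
  -- Replaces the cube root of 8KC by the larger 1 + 8KC.
  have hA : 8 * K * C ≤ (1 + 8 * K * C) ^ 3 := by
    have : 0 ≤ 8 * K * C := by positivity
    nlinarith [mul_nonneg this this, mul_nonneg this (mul_nonneg this this)]
  refine le_of_pow_le_pow_left₀ three_ne_zero (by positivity) (hcube.trans ?_)
  rw [mul_pow, inv_pow, ← pow_mul]
  gcongr

theorem exists_abs_φ_le (h : TzitzeicaFlow q φ) (a T : ℝ) :
    ∃ C, 0 ≤ C ∧ ∀ y, a ≤ y → ∀ t ∈ Icc 0 T, |φ y t| ≤ C * wtTwo y := by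
  obtain ⟨K, hK1, hK⟩ := h.bound a T
  obtain ⟨C, hC0, hC⟩ := h.exists_abs_φ_le_inv_sq T
  exact ⟨K * (2 + a ^ 2) + 2 * C, by positivity, fun y hy t ht =>
    le_wtTwo (by linarith) hC0 hy (hK y hy t ht).2.2.1 fun h1 => hC y h1 t ht⟩

theorem hasDerivWithinAt_q_inv (h : TzitzeicaFlow q φ) (y : ℝ) {t : ℝ} (ht : 0 ≤ t) :
    HasDerivWithinAt (fun s => (q y s)⁻¹) (-(φ y t * (q y t)⁻¹)) (Ici 0) t := by
  have h0 := (h.pos y t ht).ne'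
  refine ((h.hasDerivWithinAt_q y t ht).fun_inv h0).congr_deriv ?_
  field_simp

theorem exists_abs_φ_div_q_le (h : TzitzeicaFlow q φ) (a T : ℝ) :
    ∃ C, 0 ≤ C ∧ ∀ y, a ≤ y → ∀ t ∈ Icc 0 T, |φ y t * (q y t)⁻¹| ≤ C * wtTwo y := by
  obtain ⟨K, hK1, hK⟩ := h.bound a T
  obtain ⟨C, hC0, hC⟩ := h.exists_abs_φ_le a T
  refine ⟨C * K, by positivity, fun y hy t ht => ?_⟩
  have hp := inv_pos.2 (h.pos y t ht.1)
  have := wtTwo_pos y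
  rw [abs_mul, abs_of_pos hp]
  calc _ ≤ C * wtTwo y * K := by
        gcongr
        exacts [hC y hy t ht, (hK y hy t ht).2.1]
    _ = _ := by ring

/-- Integrate (1/q)_t = -φ/q from the initial time, where the decay of q - 1 is known. -/
theorem exists_abs_q_inv_sub_one_le (h : TzitzeicaFlow q φ) (a T : ℝ) :
    ∃ C, 0 ≤ C ∧ ∀ y, a ≤ y → ∀ t ∈ Icc 0 T, |(q y t)⁻¹ - 1| ≤ C * wtTwo y := by
  obtain ⟨C, hC0, hC⟩ := h.exists_abs_φ_div_q_le a T
  obtain ⟨c, E, hc, hi⟩ := h.initial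
  refine ⟨C * |T| + |E| * c⁻¹ * 2, by positivity, fun y hy t ht => ?_⟩
  have hw := wtTwo_pos y
  have h1 := (convex_Icc (0 : ℝ) T).norm_image_sub_le_of_norm_hasDerivWithin_le
    (f := fun s => (q y s)⁻¹) (C := C * wtTwo y) (x := 0) (y := t)
    (fun s hs => (h.hasDerivWithinAt_q_inv y hs.1).mono fun x hx => hx.1)
    (fun s hs => by rw [norm_neg]; exact hC y hy s hs) ⟨le_rfl, ht.1.trans ht.2⟩ ht
  rw [Real.norm_eq_abs, Real.norm_eq_abs, sub_zero, abs_of_nonneg ht.1] at h1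
  have hT : t ≤ |T| := ht.2.trans (le_abs_self T)
  have h2 : |(q y t)⁻¹ - (q y 0)⁻¹| ≤ C * wtTwo y * |T| := h1.trans (by gcongr)
  have hq0 := h.pos y 0 le_rfl
  have h3 : |(q y 0)⁻¹ - 1| ≤ |E| * (2 * wtTwo y) * c⁻¹ := by
    have e : (q y 0)⁻¹ - 1 = -((q y 0 - 1) * (q y 0)⁻¹) := by field_simp; ring
    have hwt : wt y ≤ 2 * wtTwo y := by
      rw [wt, wtTwo, ← div_eq_mul_inv, inv_eq_one_div,
        div_le_div_iff₀ (by positivity) (by positivity), one_mul]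
      have h4 : 1 + y ^ 2 ≤ (1 + |y|) ^ 2 := by nlinarith [sq_abs y, abs_nonneg y]
      have h5 : (1 + |y|) ^ 2 ≤ (1 + |y|) ^ 4 :=
        pow_le_pow_right₀ (by linarith [abs_nonneg y]) (by norm_num)
      have h6 : 0 ≤ (1 + |y|) ^ 4 := by positivity
      linarith
    have hwt0 := wt_pos y
    rw [e, abs_neg, abs_mul, abs_of_pos (inv_pos.2 hq0)]
    have h7 : |q y 0 - 1| ≤ |E| * (2 * wtTwo y) :=
      (hi y).2.trans (mul_le_mul (le_abs_self E) hwt hwt0.le (abs_nonneg E))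
    exact mul_le_mul h7 (inv_anti₀ hc (hi y).1) (inv_pos.2 hq0).le (by positivity)
  calc _ ≤ |(q y t)⁻¹ - (q y 0)⁻¹| + |(q y 0)⁻¹ - 1| := abs_sub_le _ _ _
    _ ≤ C * wtTwo y * |T| + |E| * (2 * wtTwo y) * c⁻¹ := add_le_add h2 h3
    _ = _ := by ring

end TzitzeicaFlow

end Decay

end ShortWave
namespace ShortWave

open MeasureTheory

/-! ### The map y ↦ x(y,t) and its time derivative -/

section ChangeOfVariables

/-- Differentiation under the integral sign within a convex set of parameters. -/
theorem hasDerivWithinAt_integral_of_bound {α : Type*} [MeasurableSpace α] {μ : Measure α}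
    {f f' : α → ℝ → ℝ} {S : Set ℝ} (hS : Convex ℝ S) {s₀ : ℝ} (hs₀ : s₀ ∈ S) {b : α → ℝ}
    (hb : Integrable b μ) (hi : ∀ s ∈ S, Integrable (fun η => f η s) μ)
    (hd : ∀ᵐ η ∂μ, ∀ s ∈ S, HasDerivWithinAt (f η) (f' η s) S s ∧ |f' η s| ≤ b η) :
    HasDerivWithinAt (fun s => ∫ η, f η s ∂μ) (∫ η, f' η s₀ ∂μ) S s₀ := by
  rw [hasDerivWithinAt_iff_tendsto_slope]
  have hmem : ∀ᶠ s in 𝓝[S \ {s₀}] s₀, s ∈ S \ {s₀} := self_mem_nhdsWithin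
  have e : ∀ᶠ s in 𝓝[S \ {s₀}] s₀, ∫ η, slope (f η) s₀ s ∂μ =
      slope (fun s => ∫ η, f η s ∂μ) s₀ s := by
    filter_upwards [hmem] with s hs
    simp only [slope_def_field]
    rw [integral_div, integral_sub (hi s hs.1) (hi s₀ hs₀)]
  refine Tendsto.congr' e ?_
  refine tendsto_integral_filter_of_dominated_convergence b ?_ ?_ hb ?_
  · filter_upwards [hmem] with s hs
    simp only [slope_def_field]
    exact (((hi s hs.1).sub (hi s₀ hs₀)).div_const _).aestronglyMeasurable
  · filter_upwards [hmem] with s hs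
    filter_upwards [hd] with η hη
    have h1 := hS.norm_image_sub_le_of_norm_hasDerivWithin_le (f := f η) (f' := f' η) (C := b η)
      (fun s hs => (hη s hs).1) (fun s hs => (hη s hs).2) hs₀ hs.1
    have h2 : 0 < ‖s - s₀‖ := norm_pos_iff.2 (sub_ne_zero.2 hs.2)
    rwa [slope_def_field, norm_div, div_le_iff₀ h2]
  · filter_upwards [hd] with η hη
    exact hasDerivWithinAt_iff_tendsto_slope.1 (hη s₀ hs₀).1

theorem integrable_wtTwo : Integrable wtTwo := integrable_inv_one_add_sq

/-- The change of variables `x(y,t)`. -/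
noncomputable def xOf (q : ℝ → ℝ → ℝ) (y t : ℝ) : ℝ := y - ∫ η in Ioi y, ((q η t)⁻¹ - 1)

/-- The solution `u` in the variables `(y,t)`. -/
noncomputable def uOf (q φ : ℝ → ℝ → ℝ) (y t : ℝ) : ℝ := ∫ η in Ioi y, φ η t * (q η t)⁻¹

namespace TzitzeicaFlow

variable {q φ : ℝ → ℝ → ℝ}

theorem integrableOn_of_abs_le {f : ℝ → ℝ} (hf : Continuous f) {C a : ℝ}
    (h : ∀ y, a ≤ y → |f y| ≤ C * wtTwo y) : IntegrableOn f (Ioi a) :=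
  Integrable.mono' (integrable_wtTwo.const_mul C).integrableOn hf.aestronglyMeasurable
    ((ae_restrict_iff' measurableSet_Ioi).2 (Eventually.of_forall fun y hy => h y (le_of_lt hy)))

theorem integrableOn_q_inv_sub_one (h : TzitzeicaFlow q φ) {t : ℝ} (ht : 0 ≤ t) (a : ℝ) :
    IntegrableOn (fun η => (q η t)⁻¹ - 1) (Ioi a) := by
  obtain ⟨C, -, hC⟩ := h.exists_abs_q_inv_sub_one_le a t
  exact integrableOn_of_abs_le ((h.continuous_q_inv ht).sub continuous_const)
    fun y hy => hC y hy t ⟨ht, le_rfl⟩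

theorem integrableOn_φ_div_q (h : TzitzeicaFlow q φ) {t : ℝ} (ht : 0 ≤ t) (a : ℝ) :
    IntegrableOn (fun η => φ η t * (q η t)⁻¹) (Ioi a) := by
  obtain ⟨C, -, hC⟩ := h.exists_abs_φ_div_q_le a t
  exact integrableOn_of_abs_le ((h.continuous_φ ht).mul (h.continuous_q_inv ht))
    fun y hy => hC y hy t ⟨ht, le_rfl⟩

theorem hasDerivAt_xOf (h : TzitzeicaFlow q φ) (y : ℝ) {t : ℝ} (ht : 0 ≤ t) :
    HasDerivAt (fun η => xOf q η t) (q y t)⁻¹ y := by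
  have h1 := hasDerivAt_integral_Ioi (f := fun η => (q η t)⁻¹ - 1)
    ((h.continuous_q_inv ht).sub continuous_const) (h.integrableOn_q_inv_sub_one ht) y
  exact ((hasDerivAt_id y).fun_sub h1).congr_deriv (by ring)

theorem hasDerivAt_uOf (h : TzitzeicaFlow q φ) (y : ℝ) {t : ℝ} (ht : 0 ≤ t) :
    HasDerivAt (fun η => uOf q φ η t) (-(φ y t * (q y t)⁻¹)) y :=
  hasDerivAt_integral_Ioi (f := fun η => φ η t * (q η t)⁻¹)
    ((h.continuous_φ ht).mul (h.continuous_q_inv ht)) (h.integrableOn_φ_div_q ht) y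

theorem tendsto_xOf_sub (q : ℝ → ℝ → ℝ) (t : ℝ) :
    Tendsto (fun y => xOf q y t - y) atTop (𝓝 0) := by
  have e : (fun y => xOf q y t - y) = fun y => -∫ η in Ioi y, ((q η t)⁻¹ - 1) := by
    funext y; rw [xOf]; ring
  rw [e, ← neg_zero]
  exact (tendsto_integral_Ioi_zero tendsto_id).neg

theorem tendsto_uOf (q φ : ℝ → ℝ → ℝ) (t : ℝ) :
    Tendsto (fun y => uOf q φ y t) atTop (𝓝 0) := tendsto_integral_Ioi_zero tendsto_id

/-- Differentiating under the integral, -(1/q)_t = φ/q. The time window [0, t + 1] is a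
neighbourhood of t in t ≥ 0 on which one integrable majorant works. -/
theorem hasDerivWithinAt_xOf (h : TzitzeicaFlow q φ) (y : ℝ) {t : ℝ} (ht : 0 ≤ t) :
    HasDerivWithinAt (fun s => xOf q y s) (uOf q φ y t) (Ici 0) t := by
  obtain ⟨C, hC0, hC⟩ := h.exists_abs_φ_div_q_le y (t + 1)
  have ht1 : t ∈ Icc 0 (t + 1) := ⟨ht, by linarith⟩
  have h1 := hasDerivWithinAt_integral_of_bound (μ := volume.restrict (Ioi y))
    (f := fun η s => (q η s)⁻¹ - 1) (f' := fun η s => -(φ η s * (q η s)⁻¹))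
    (convex_Icc 0 (t + 1)) ht1 (integrable_wtTwo.const_mul C).integrableOn
    (fun s hs => h.integrableOn_q_inv_sub_one hs.1 y)
    ((ae_restrict_iff' measurableSet_Ioi).2 (Eventually.of_forall fun η hη s hs =>
      ⟨((h.hasDerivWithinAt_q_inv η hs.1).sub_const 1).mono fun _ hx => hx.1, by
        rw [abs_neg]; exact hC η (le_of_lt hη) s hs⟩))
  have h2 := h1.const_sub y
  rw [integral_neg, neg_neg] at h2
  refine h2.mono_of_mem_nhdsWithin ?_
  rw [← Ici_inter_Iic]
  exact inter_mem self_mem_nhdsWithin (mem_nhdsWithin_of_mem_nhds (Iic_mem_nhds (by linarith)))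

theorem strictMono_xOf (h : TzitzeicaFlow q φ) {t : ℝ} (ht : 0 ≤ t) :
    StrictMono fun y => xOf q y t :=
  strictMono_of_deriv_pos fun y => by
    rw [(h.hasDerivAt_xOf y ht).deriv]; exact inv_pos.2 (h.pos y t ht)

theorem tendsto_xOf_atTop (q : ℝ → ℝ → ℝ) (t : ℝ) : Tendsto (fun y => xOf q y t) atTop atTop := by
  have := (tendsto_xOf_sub q t).add_atTop tendsto_id
  simpa using this

/-- The energy to the left of the origin is finite at all times. -/
theorem exists_integral_energy_le (h : TzitzeicaFlow q φ) {t : ℝ} (ht : 0 ≤ t) :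
    ∃ C, ∀ a ≤ 0, ∫ η in a..0, energy (q η t) ≤ C := by
  obtain ⟨C, hC0, hC⟩ := h.exists_energy_initial_le
  -- Initial energy plus the flux through the origin; the flux through the left end has a favourable
  -- sign and is dropped.
  refine ⟨C * (∫ η, wt η) + ∫ s in (0 : ℝ)..t, φ 0 s ^ 2 / 2, fun a ha => ?_⟩
  have h1 := h.integral_energy_sub a 0 ht
  have h2 : 0 ≤ ∫ s in (0 : ℝ)..t, φ a s ^ 2 / 2 :=
    intervalIntegral.integral_nonneg ht fun s _ => by positivity
  have h3 : ∫ η in a..0, energy (q η 0) ≤ ∫ η in a..0, C * wt η := by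
    refine intervalIntegral.integral_mono_on ha ((h.continuous_energy le_rfl).intervalIntegrable _ _)
      ((continuous_const.mul continuous_wt).intervalIntegrable _ _) fun η _ => (hC η).trans ?_
    have := wt_le_one η
    have := wt_pos η
    gcongr
    nlinarith
  rw [intervalIntegral.integral_const_mul] at h3
  have h4 : ∫ η in a..0, wt η ≤ ∫ η, wt η := by
    rw [intervalIntegral.integral_of_le ha]
    exact setIntegral_le_integral integrable_wt (Eventually.of_forall fun η => (wt_pos η).le)
  have h5 := mul_le_mul_of_nonneg_left h4 hC0
  linarith

/-- Integrating 1/2 ≤ 1/q + energy over [a, 0] bounds x(0) - x(a) below by -a/2 minus the finite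
energy. -/
theorem tendsto_xOf_atBot (h : TzitzeicaFlow q φ) {t : ℝ} (ht : 0 ≤ t) :
    Tendsto (fun y => xOf q y t) atBot atBot := by
  obtain ⟨C, hC⟩ := h.exists_integral_energy_le ht
  have key : ∀ a ≤ 0, xOf q a t ≤ a / 2 + (xOf q 0 t + C) := fun a ha => by
    have h1 : ∫ η in a..0, (q η t)⁻¹ = xOf q 0 t - xOf q a t :=
      intervalIntegral.integral_eq_sub_of_hasDerivAt (fun η _ => h.hasDerivAt_xOf η ht)
        ((h.continuous_q_inv ht).intervalIntegrable _ _)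
    have h2 : ∫ _ in a..0, (1 / 2 : ℝ) ≤ ∫ η in a..0, ((q η t)⁻¹ + energy (q η t)) :=
      intervalIntegral.integral_mono_on ha (by simp)
        (((h.continuous_q_inv ht).add (h.continuous_energy ht)).intervalIntegrable _ _)
        fun η _ => half_le_inv_add_energy (h.pos η t ht)
    rw [intervalIntegral.integral_add ((h.continuous_q_inv ht).intervalIntegrable _ _)
      ((h.continuous_energy ht).intervalIntegrable _ _), h1, intervalIntegral.integral_const,
      smul_eq_mul] at h2
    linarith [hC a ha]
  refine tendsto_atBot_mono' atBot ((eventually_le_atBot 0).mono key) ?_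
  exact tendsto_atBot_add_const_right _ _ (tendsto_id.atBot_div_const two_pos)

theorem bijective_xOf (h : TzitzeicaFlow q φ) {t : ℝ} (ht : 0 ≤ t) :
    Function.Bijective fun y => xOf q y t :=
  ⟨(h.strictMono_xOf ht).injective,
    (continuous_iff_continuousAt.2 fun y => (h.hasDerivAt_xOf y ht).continuousAt).surjective
      (tendsto_xOf_atTop q t) (h.tendsto_xOf_atBot ht)⟩

end TzitzeicaFlow

end ChangeOfVariables

end ShortWave
namespace ShortWave

open MeasureTheory

/-! ### Inversion of the change of variables, the system, and the initial value -/

section Inverse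

/-- Continuity of the inverse of a family of strictly increasing functions. -/
theorem tendsto_of_strictMono {ι : Type*} {l : Filter ι} {X : ι → ℝ → ℝ} {X₀ : ℝ → ℝ}
    {Y Ξ : ι → ℝ} {y₀ : ℝ} (hX : ∀ᶠ i in l, StrictMono (X i) ∧ X i (Y i) = Ξ i)
    (hX₀ : StrictMono X₀) (hl : ∀ y, Tendsto (fun i => X i y) l (𝓝 (X₀ y)))
    (hΞ : Tendsto Ξ l (𝓝 (X₀ y₀))) : Tendsto Y l (𝓝 y₀) := by
  refine tendsto_order.2 ⟨fun a ha => ?_, fun a ha => ?_⟩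
  · filter_upwards [hX, (hl a).eventually_lt hΞ (hX₀ ha)] with i hi h1
    rw [← hi.2] at h1
    exact hi.1.lt_iff_lt.1 h1
  · filter_upwards [hX, hΞ.eventually_lt (hl a) (hX₀ ha)] with i hi h1
    rw [← hi.2] at h1
    exact hi.1.lt_iff_lt.1 h1

namespace TzitzeicaFlow

variable {q φ : ℝ → ℝ → ℝ} {Y : ℝ → ℝ → ℝ}

/-- The mean value theorem for x in y, with slope 1/q. It lets the inverse be differentiated in t
without joint differentiability of x. -/
theorem exists_xOf_sub (h : TzitzeicaFlow q φ) {t : ℝ} (ht : 0 ≤ t) (y y' : ℝ) :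
    ∃ η, |η - y| ≤ |y' - y| ∧ y' - y = q η t * (xOf q y' t - xOf q y t) := by
  have key : ∀ a b, a < b → ∃ η ∈ Ioo a b, b - a = q η t * (xOf q b t - xOf q a t) :=
    fun a b hab => by
      obtain ⟨η, hη, e⟩ := exists_hasDerivAt_eq_slope (fun η => xOf q η t) (fun η => (q η t)⁻¹) hab
        (fun η _ => (h.hasDerivAt_xOf η ht).continuousAt.continuousWithinAt)
        fun η _ => h.hasDerivAt_xOf η ht
      refine ⟨η, hη, ?_⟩
      have h1 := h.pos η t ht
      have h2 := sub_pos.2 hab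
      rw [eq_div_iff h2.ne'] at e
      rw [← e, mul_inv_cancel_left₀ h1.ne']
  rcases lt_trichotomy y y' with hy | rfl | hy
  · obtain ⟨η, hη, e⟩ := key y y' hy
    refine ⟨η, ?_, e⟩
    rw [abs_of_pos (sub_pos.2 hη.1), abs_of_pos (sub_pos.2 hy)]
    linarith [hη.2]
  · exact ⟨y, by simp, by simp⟩
  · obtain ⟨η, hη, e⟩ := key y' y hy
    refine ⟨η, ?_, by linarith⟩
    rw [abs_of_neg (sub_neg.2 hη.2), abs_of_neg (sub_neg.2 hy)]
    linarith [hη.1]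

variable (hY : ∀ t ξ, 0 ≤ t → xOf q (Y t ξ) t = ξ)

include hY

theorem hasDerivAt_inverse_space (h : TzitzeicaFlow q φ) {t : ℝ} (ht : 0 ≤ t) (ξ : ℝ) :
    HasDerivAt (Y t) (q (Y t ξ) t) ξ := by
  have hc : ContinuousAt (Y t) ξ := tendsto_of_strictMono (X := fun _ y => xOf q y t) (Ξ := id)
    (Eventually.of_forall fun η => ⟨h.strictMono_xOf ht, hY t η ht⟩) (h.strictMono_xOf ht)
    (fun y => tendsto_const_nhds) (by rw [hY t ξ ht]; exact tendsto_id)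
  have := HasDerivAt.of_local_left_inverse hc (h.hasDerivAt_xOf (Y t ξ) ht)
    (inv_ne_zero (h.pos _ t ht).ne') (Eventually.of_forall fun η => hY t η ht)
  rwa [inv_inv] at this

/-- Since x(Y(s), s) = ξ = x(y, t), the mean value form gives Y(s) - y = -q(η, s)(x(y, s) - x(y, t))
with η between y and Y(s). The first factor converges by joint continuity of q, the difference
quotient of the second to u. -/
theorem hasDerivAt_inverse_time (h : TzitzeicaFlow q φ) {t : ℝ} (ht : 0 < t) (ξ : ℝ) :
    HasDerivAt (fun s => Y s ξ) (-(q (Y t ξ) t * uOf q φ (Y t ξ) t)) t := by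
  set y := Y t ξ with hy
  have hpos : ∀ᶠ s in 𝓝 t, 0 < s := Ioi_mem_nhds ht
  have hx : ∀ y, HasDerivAt (fun s => xOf q y s) (uOf q φ y t) t := fun y =>
    (h.hasDerivWithinAt_xOf y ht.le).hasDerivAt (Ici_mem_nhds ht)
  have hc : Tendsto (fun s => Y s ξ) (𝓝 t) (𝓝 y) := by
    refine tendsto_of_strictMono (X := fun s y => xOf q y s) (Ξ := fun _ => ξ) ?_
      (h.strictMono_xOf ht.le) (fun y => (hx y).continuousAt) ?_
    · filter_upwards [hpos] with s hs using ⟨h.strictMono_xOf hs.le, hY s ξ hs.le⟩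
    · rw [hy, hY t ξ ht.le]; exact tendsto_const_nhds
  have hη : ∀ s, ∃ η, 0 < s → |η - y| ≤ |Y s ξ - y| ∧
      Y s ξ - y = q η s * (xOf q (Y s ξ) s - xOf q y s) := fun s => by
    by_cases hs : 0 < s
    · obtain ⟨η, hη⟩ := h.exists_xOf_sub hs.le y (Y s ξ)
      exact ⟨η, fun _ => hη⟩
    · exact ⟨0, fun h => absurd h hs⟩
  choose η hη using hη
  have hηl : Tendsto η (𝓝 t) (𝓝 y) := by
    rw [tendsto_iff_norm_sub_tendsto_zero] at hc ⊢
    refine squeeze_zero' (Eventually.of_forall fun _ => norm_nonneg _) ?_ hc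
    filter_upwards [hpos] with s hs using (hη s hs).1
  have hql : Tendsto (fun s => q (η s) s) (𝓝 t) (𝓝 (q y t)) := by
    have h1 : Tendsto (fun s => (η s, s)) (𝓝 t) (𝓝[halfPlane] (y, t)) := by
      refine tendsto_nhdsWithin_iff.2 ⟨hηl.prodMk_nhds tendsto_id, ?_⟩
      filter_upwards [hpos] with s hs using hs.le
    exact (h.continuousOn_q (y, t) ht.le).tendsto.comp h1
  have h2 := hasDerivAt_iff_tendsto_slope.1 (hx y)
  rw [hasDerivAt_iff_tendsto_slope]
  refine ((hql.mono_left nhdsWithin_le_nhds).mul h2).neg.congr' ?_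
  filter_upwards [mem_nhdsWithin_of_mem_nhds hpos] with s hs
  have e := (hη s hs).2
  have e2 := hY t ξ ht.le
  rw [← hy] at e2
  rw [slope_def_field, slope_def_field, ← hy, e, hY s ξ hs.le, e2]
  ring

theorem hasDerivAt_u_space (h : TzitzeicaFlow q φ) {t : ℝ} (ht : 0 ≤ t) (ξ : ℝ) :
    HasDerivAt (fun ξ => uOf q φ (Y t ξ) t) (-φ (Y t ξ) t) ξ := by
  refine ((h.hasDerivAt_uOf (Y t ξ) ht).comp ξ (h.hasDerivAt_inverse_space hY ht ξ)).congr_deriv ?_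
  have := (h.pos (Y t ξ) t ht).ne'
  field_simp

theorem hasDerivAt_u_space_space (h : TzitzeicaFlow q φ) {t : ℝ} (ht : 0 ≤ t) (ξ : ℝ) :
    HasDerivAt (fun ξ => -φ (Y t ξ) t) (1 - q (Y t ξ) t ^ 3) ξ := by
  refine ((h.hasDerivAt_φ (Y t ξ) t ht).comp ξ
    (h.hasDerivAt_inverse_space hY ht ξ)).fun_neg.congr_deriv ?_
  have := (h.pos (Y t ξ) t ht).ne'
  field_simp
  ring

omit hY

/-- The parametric solution solves the system. -/
theorem solvesSystem (h : TzitzeicaFlow q φ)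
    (hd : ∀ y t, 0 < t → DifferentiableAt ℝ (fun p : ℝ × ℝ => q p.1 p.2) (y, t))
    {u p : ℝ → ℝ → ℝ}
    (hup : ∀ y t, 0 ≤ t → u (xOf q y t) t = uOf q φ y t ∧ p (xOf q y t) t = q y t) :
    SolvesSystem u p ∧ ∀ ξ t, 0 < t → 0 < p ξ t := by
  have hY : ∀ t ξ, ∃ y, 0 ≤ t → xOf q y t = ξ := fun t ξ => by
    by_cases ht : 0 ≤ t
    · obtain ⟨y, hy⟩ := (h.bijective_xOf ht).2 ξ
      exact ⟨y, fun _ => hy⟩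
    · exact ⟨0, fun h => absurd h ht⟩
  choose Y hY using hY
  have hu : ∀ ξ t, 0 ≤ t → u ξ t = uOf q φ (Y t ξ) t := fun ξ t ht => by
    rw [← (hup _ t ht).1, hY t ξ ht]
  have hp : ∀ ξ t, 0 ≤ t → p ξ t = q (Y t ξ) t := fun ξ t ht => by
    rw [← (hup _ t ht).2, hY t ξ ht]
  refine ⟨fun ξ t ht => ?_, fun ξ t ht => by rw [hp ξ t ht.le]; exact h.pos _ t ht.le⟩
  have hux : ∀ ξ, HasDerivAt (fun ξ => u ξ t) (-φ (Y t ξ) t) ξ := fun ξ => by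
    rw [funext fun ξ => hu ξ t ht.le]
    exact h.hasDerivAt_u_space hY ht.le ξ
  set y := Y t ξ with hy
  have hq := (hd y t ht).hasFDerivAt
  set L := fderiv ℝ (fun p : ℝ × ℝ => q p.1 p.2) (y, t)
  have hLy : HasDerivAt (fun η => q η t) (L (1, 0)) y :=
    hq.comp_hasDerivAt (f := fun η => (η, t)) y ((hasDerivAt_id y).prodMk (hasDerivAt_const y t))
  have hLt : L (0, 1) = φ y t * q y t :=
    (hq.comp_hasDerivAt (f := fun s => (y, s)) t ((hasDerivAt_const t y).prodMk (hasDerivAt_id t))).unique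
      ((h.hasDerivWithinAt_q y t ht.le).hasDerivAt (Ici_mem_nhds ht))
  have hpx : HasDerivAt (fun ξ => p ξ t) (L (1, 0) * q y t) ξ := by
    rw [funext fun ξ => hp ξ t ht.le]
    exact hLy.comp ξ (h.hasDerivAt_inverse_space hY ht.le ξ)
  refine ⟨(hux ξ).differentiableAt, hpx.differentiableAt, ?_, ?_⟩
  · have h1 := hq.comp_hasDerivAt (f := fun s => (Y s ξ, id s)) t
      ((h.hasDerivAt_inverse_time hY ht ξ).prodMk (hasDerivAt_id t))
    have h2 : (fun s => p ξ s) =ᶠ[𝓝 t] ((fun p : ℝ × ℝ => q p.1 p.2) ∘ fun s => (Y s ξ, id s)) := by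
      filter_upwards [Ioi_mem_nhds ht] with s hs using hp ξ s (le_of_lt hs)
    refine (h1.congr_of_eventuallyEq h2).congr_deriv ?_
    rw [((hux ξ).fun_mul hpx).deriv, hp ξ t ht.le, hu ξ t ht.le, ← hy]
    -- Splits the velocity of the curve of constant ξ into its y- and t-components.
    have e : ((-(q y t * uOf q φ y t), 1) : ℝ × ℝ) =
        (-(q y t * uOf q φ y t)) • ((1, 0) : ℝ × ℝ) + (0, 1) := by simp
    rw [e, map_add, map_smul, hLt, smul_eq_mul]
    ring
  · rw [funext fun ξ => (hux ξ).deriv, hp ξ t ht.le]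
    exact h.hasDerivAt_u_space_space hY ht.le ξ

/-- The initial value of the parametric solution. -/
theorem initial_u (h : TzitzeicaFlow q φ) {u₀ : ℝ → ℝ} (hu : Admissible u₀)
    (h0 : ∀ x, q (y₀ u₀ x) 0 = q₀ u₀ x) (x : ℝ) :
    xOf q (y₀ u₀ x) 0 = x ∧ uOf q φ (y₀ u₀ x) 0 = u₀ x := by
  -- Used three times: for -φ against u₀', for x(y₀(x), 0) against x, and for u against u₀. Each
  -- difference has derivative 0 and limit 0 at +∞.
  have const : ∀ f : ℝ → ℝ, (∀ x, HasDerivAt f 0 x) → Tendsto f atTop (𝓝 0) → ∀ x, f x = 0 :=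
    fun f hf hl x => by
      have hc := is_const_of_deriv_eq_zero (fun x => (hf x).differentiableAt)
        fun x => (hf x).deriv
      have : Tendsto f atTop (𝓝 (f x)) := by
        rw [funext fun y => hc y x]; exact tendsto_const_nhds
      exact tendsto_nhds_unique this hl
  have hdecay : ∀ k ≤ 4, Tendsto (iteratedDeriv k u₀) atTop (𝓝 0) := fun k hk => by
    obtain ⟨C, -, hC⟩ := hu.exists_decay hk
    exact squeeze_zero_norm hC (by simpa using tendsto_wt_atTop.const_mul C)
  have hyt := Admissible.tendsto_y_atTop u₀
  have hq0 : ∀ x, q₀ u₀ x ≠ 0 := fun x => (hu.q_pos x).ne'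
  have hφ : ∀ x, -φ (y₀ u₀ x) 0 - iteratedDeriv 1 u₀ x = 0 := by
    refine const _ (fun x => ?_) ?_
    · refine ((((h.hasDerivAt_φ (y₀ u₀ x) 0 le_rfl).comp x (hu.hasDerivAt_y x)).fun_neg).fun_sub
        (hu.hasDerivAt_iteratedDeriv 1 x)).congr_deriv ?_
      have e := hu.q_cube x
      have e2 : (q₀ u₀ x ^ 2 - (q₀ u₀ x)⁻¹) * q₀ u₀ x = q₀ u₀ x ^ 3 - 1 := by
        have := hq0 x
        field_simp
      rw [h0 x, e2, e]
      ring
    · simpa using (((h.tendsto_φ le_rfl).comp hyt).neg).sub (hdecay 1 (by norm_num))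
  constructor
  · refine sub_eq_zero.1 (const (fun x => xOf q (y₀ u₀ x) 0 - x) (fun x => ?_) ?_ x)
    · refine (((h.hasDerivAt_xOf (y₀ u₀ x) le_rfl).comp x (hu.hasDerivAt_y x)).sub
        (hasDerivAt_id x)).congr_deriv ?_
      rw [h0 x, inv_mul_cancel₀ (hq0 x), sub_self]
    · have := ((tendsto_xOf_sub q 0).comp hyt).add (Admissible.tendsto_y_sub u₀)
      rw [add_zero] at this
      refine this.congr fun x => ?_
      simp
  · have key := const (fun x => uOf q φ (y₀ u₀ x) 0 - iteratedDeriv 0 u₀ x) (fun x => ?_) ?_ x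
    · rw [iteratedDeriv_zero] at key
      exact sub_eq_zero.1 key
    · refine (((h.hasDerivAt_uOf (y₀ u₀ x) le_rfl).comp x (hu.hasDerivAt_y x)).sub
        (hu.hasDerivAt_iteratedDeriv 0 x)).congr_deriv ?_
      rw [h0 x]
      have e := hφ x
      have e2 := inv_mul_cancel₀ (hq0 x)
      rw [zero_add]
      linear_combination e - φ (y₀ u₀ x) 0 * e2
    · simpa using ((tendsto_uOf q φ 0).comp hyt).sub (hdecay 0 (by norm_num))

end TzitzeicaFlow

end Inverse

end ShortWave
namespace ShortWave

open MeasureTheory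

/-! ### From regularity of q to the flow hypotheses -/

section FlowOfRegular

/-- Because |y₀(x) - x| ≤ B, one has 1 + |y₀(x)| ≤ (1 + B)(1 + |x|), so decay in x transfers to
decay in y at the cost of (1 + B)⁴. -/
theorem exists_initial_bounds {u₀ : ℝ → ℝ} (hu : Admissible u₀) {q : ℝ → ℝ → ℝ}
    (h0 : ∀ x, q (y₀ u₀ x) 0 = q₀ u₀ x) :
    ∃ c C : ℝ, 0 < c ∧ ∀ y, c ≤ q y 0 ∧ |q y 0 - 1| ≤ C * wt y := by
  obtain ⟨c, b, hc, hb⟩ := hu.exists_q_bounds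
  obtain ⟨C, hC0, hC⟩ := hu.exists_abs_q_sub_one_le
  obtain ⟨B, hB0, hB⟩ := hu.exists_abs_y_sub_le
  refine ⟨c, C * (1 + B) ^ 4, hc, fun y => ?_⟩
  obtain ⟨x, rfl⟩ := hu.surjective_y y
  rw [h0]
  refine ⟨(hb x).1, (hC x).trans ?_⟩
  rw [mul_assoc]
  gcongr
  have h1 : 1 + |y₀ u₀ x| ≤ (1 + B) * (1 + |x|) := by
    have h2 := abs_add_le (y₀ u₀ x - x) x
    rw [sub_add_cancel] at h2
    nlinarith [hB x, mul_nonneg hB0 (abs_nonneg x)]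
  have h2 : (1 + |y₀ u₀ x|) ^ 4 ≤ (1 + B) ^ 4 * (1 + |x|) ^ 4 := by
    rw [← mul_pow]; gcongr
  rw [wt, wt, inv_eq_one_div, ← div_eq_mul_inv,
    div_le_div_iff₀ (by positivity) (by positivity), one_mul]
  exact h2

/-- With φ = q_t/q, symmetry of the mixed derivatives gives φ_y = (q_y/q)_t = q² - 1/q. The bounds
on φ and its Lipschitz constant come from those on q, q_t, q_tt and, separately, 1/q. -/
theorem tzitzeicaFlow {q : ℝ → ℝ → ℝ} (hq : RegularOnHalfPlane fun p => q p.1 p.2)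
    (hqi : RegularOnHalfPlane fun p => (q p.1 p.2)⁻¹) (hpos : ∀ y t, 0 ≤ t → 0 < q y t)
    (heq : ∀ y t, 0 ≤ t → HasDerivWithinAt (fun s => deriv (fun η => q η s) y / q y s)
        (q y t ^ 2 - (q y t)⁻¹) (Ici 0) t)
    (hlim : ∀ t, 0 ≤ t → Tendsto (fun y => q y t) atTop (𝓝 1))
    (hinit : ∃ c C : ℝ, 0 < c ∧ ∀ y, c ≤ q y 0 ∧ |q y 0 - 1| ≤ C * wt y) :
    TzitzeicaFlow q fun y t => partialT (fun p => q p.1 p.2) (y, t) * (q y t)⁻¹ := by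
  set Q : ℝ × ℝ → ℝ := fun p => q p.1 p.2 with hQ
  have hQd := hq.1.differentiableOn two_ne_zero
  have hT := contDiffOn_partialT hq.1
  have hYc := contDiffOn_partialY hq.1
  have hqc : ContinuousOn (fun p : ℝ × ℝ => q p.1 p.2) halfPlane := hq.1.continuousOn
  have hinv : ContinuousOn (fun p : ℝ × ℝ => (q p.1 p.2)⁻¹) halfPlane :=
    hqc.inv₀ fun p hp => (hpos p.1 p.2 hp).ne'
  have hqt : ∀ y t, 0 ≤ t → HasDerivWithinAt (fun s => q y s) (partialT Q (y, t)) (Ici 0) t :=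
    fun y t ht => hasDerivWithinAt_partialT hQd y ht
  refine ⟨hpos, hqc, hT.continuousOn.mul hinv, fun y t ht => ?_, fun y t ht => ?_, fun a T => ?_,
    hlim, hinit⟩
  · have h0 := (hpos y t ht).ne'
    have hqy : ∀ y t, 0 ≤ t → HasDerivAt (fun η => q η t) (partialY Q (y, t)) y :=
      fun y t ht => hasDerivAt_partialY hQd y ht
    have h1 := (hasDerivAt_partialY (hT.differentiableOn one_ne_zero) y ht).fun_mul
      ((hqy y t ht).fun_inv h0)
    have h2 := (hasDerivWithinAt_partialT (hYc.differentiableOn one_ne_zero) y ht).fun_div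
      (hqt y t ht) h0
    have h3 := h2.congr_of_mem (f₁ := fun s => deriv (fun η => q η s) y / q y s)
      (fun s hs => by rw [(hqy y s hs).deriv]) ht
    have e := (uniqueDiffOn_Ici (0 : ℝ) t ht).eq_deriv _ (heq y t ht) h3
    refine h1.congr_deriv ?_
    rw [e, partialT_partialY hq.1 ht]
    field_simp
    ring
  · refine (hqt y t ht).congr_deriv ?_
    rw [inv_mul_cancel_right₀ (hpos y t ht).ne']
  · obtain ⟨K, hK⟩ := hq.2 a T
    obtain ⟨L, hL⟩ := hqi.2 a T
    have hKL : ∀ y, a ≤ y → ∀ t ∈ Icc 0 T, q y t ≤ K ∧ (q y t)⁻¹ ≤ L ∧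
        |partialT Q (y, t)| ≤ K ∧ |partialT (partialT Q) (y, t)| ≤ K := fun y hy t ht => by
      have hp : (y, t) ∈ halfPlane := ht.1
      have k0 := hK (y, t) hp hy ht.2 0 (by norm_num)
      have l0 := hL (y, t) hp hy ht.2 0 (by norm_num)
      rw [norm_iteratedFDerivWithin_zero] at k0 l0
      exact ⟨(le_abs_self _).trans k0, (le_abs_self _).trans l0,
        (norm_partialT_le hp).trans (hK (y, t) hp hy ht.2 1 (by norm_num)),
        (norm_partialT_partialT_le hq.1 hp).trans (hK (y, t) hp hy ht.2 2 le_rfl)⟩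
    -- One constant above all that is needed: |K| for q, |L| for 1/q, |K||L| for φ, and the last
    -- bracket for φ_t = q_tt/q - φ².
    refine ⟨1 + |K| + |L| + |K| * |L| + (|K| * |L| + (|K| * |L|) ^ 2), ?_, fun y hy t ht => ?_⟩
    · have : 0 ≤ |K| + |L| + |K| * |L| + (|K| * |L| + (|K| * |L|) ^ 2) := by positivity
      linarith
    have hφb : ∀ s ∈ Icc 0 T, |partialT Q (y, s) * (q y s)⁻¹| ≤ |K| * |L| := fun s hs => by
      obtain ⟨-, h2, h3, -⟩ := hKL y hy s hs
      have hi := inv_pos.2 (hpos y s hs.1)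
      rw [abs_mul, abs_of_pos hi]
      exact mul_le_mul (h3.trans (le_abs_self K)) (h2.trans (le_abs_self L)) hi.le (abs_nonneg K)
    obtain ⟨h1, h2, -, -⟩ := hKL y hy t ht
    have hA : 0 ≤ |K| * |L| := by positivity
    have hB : 0 ≤ (|K| * |L|) ^ 2 := by positivity
    have hK0 := abs_nonneg K
    have hL0 := abs_nonneg L
    refine ⟨by linarith [le_abs_self K], by linarith [le_abs_self L], by linarith [hφb t ht],
      fun s hs => ?_⟩
    have hlip := (convex_Icc (0 : ℝ) T).norm_image_sub_le_of_norm_hasDerivWithin_le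
      (f := fun s => partialT Q (y, s) * (q y s)⁻¹)
      (f' := fun s => partialT (partialT Q) (y, s) * (q y s)⁻¹ -
        (partialT Q (y, s) * (q y s)⁻¹) ^ 2)
      (C := |K| * |L| + (|K| * |L|) ^ 2) (fun s hs => ?_) (fun s hs => ?_) ht hs
    · refine hlip.trans ?_
      exact mul_le_mul_of_nonneg_right (by linarith) (norm_nonneg _)
    · have h0 := (hpos y s hs.1).ne'
      refine (((hasDerivWithinAt_partialT (hT.differentiableOn one_ne_zero) y hs.1).fun_mul
        ((hqt y s hs.1).fun_inv h0)).congr_deriv ?_).mono fun x hx => hx.1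
      field_simp
      ring
    · obtain ⟨-, h2, -, h4⟩ := hKL y hy s hs
      have hi := inv_pos.2 (hpos y s hs.1)
      refine (norm_sub_le _ _).trans (add_le_add ?_ ?_)
      · rw [Real.norm_eq_abs, abs_mul, abs_of_pos hi]
        exact mul_le_mul (h4.trans (le_abs_self K)) (h2.trans (le_abs_self L)) hi.le (abs_nonneg K)
      · rw [norm_pow, Real.norm_eq_abs]
        gcongr
        exact hφb s hs

end FlowOfRegular

end ShortWave
-- The main theorem
theorem mainTheorem3
    (u₀ : ℝ → ℝ) (hu₀ : ShortWave.Admissible u₀)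
    (D : ShortWave.RHData) (hD : ShortWave.IsScatteringData u₀ D)
    (M : ℝ → ℝ → ℂ → ShortWave.Mat)
    (hM : ∀ y t : ℝ, 0 ≤ t → ShortWave.IsUniqueRHSolution D y t (M y t))
    (hreg : ShortWave.ClassicalDependence D M)
    (qh : ℝ → ℝ → ℝ)
    (hq_pos : ∀ y t : ℝ, 0 ≤ t → 0 < qh y t)
    (hq_lim : ∀ t : ℝ, 0 ≤ t → Filter.Tendsto (fun y => qh y t) Filter.atTop (nhds 1))
    (hstruct : ∀ y t : ℝ, 0 ≤ t →
      Filter.Tendsto (M y t) (nhdsWithin 0 ShortWave.contourᶜ)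
        (nhds (ShortWave.structured (qh y t)))) :
    -- the equation for `qh`
    (∀ y t : ℝ, 0 ≤ t →
      DifferentiableAt ℝ (fun η => qh η t) y ∧
      HasDerivWithinAt (fun s => deriv (fun η => qh η s) y / qh y s)
        (qh y t ^ 2 - (qh y t)⁻¹) (Set.Ici 0) t) ∧
    -- the change of variables `x = x(y,t)` (determined by the first two properties)
    (∃ x : ℝ → ℝ → ℝ,
      (∀ t : ℝ, 0 ≤ t →
        (∀ y : ℝ, HasDerivAt (fun η => x η t) (qh y t)⁻¹ y) ∧
        Filter.Tendsto (fun y => x y t - y) Filter.atTop (nhds 0) ∧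
        Function.Bijective (fun y => x y t) ∧
        (∀ y : ℝ, DifferentiableWithinAt ℝ (fun s => x y s) (Set.Ici 0) t)) ∧
      -- `u(x(y,t),t) = ∂x/∂t (y,t)` and `q(x(y,t),t) = qh(y,t)`
      ∀ u q : ℝ → ℝ → ℝ,
        (∀ y t : ℝ, 0 ≤ t →
          u (x y t) t = derivWithin (fun s => x y s) (Set.Ici 0) t ∧
          q (x y t) t = qh y t) →
        ShortWave.SolvesSystem u q ∧ ShortWave.SolvesEquation u ∧ ∀ ξ : ℝ, u ξ 0 = u₀ ξ) ∧
    -- the system is equivalent to the equation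
    (∀ w p : ℝ → ℝ → ℝ,
      (∀ ξ t : ℝ, 0 < t → 0 < p ξ t ∧ iteratedDeriv 2 (fun η => w η t) ξ = 1 - p ξ t ^ 3) →
      (ShortWave.SolvesSystem w p ↔ ShortWave.SolvesEquation w)) := by
  have hq2 := ShortWave.regular_q hreg hstruct
  have htz : ∀ y t : ℝ, 0 ≤ t →
      HasDerivWithinAt (fun s => deriv (fun η => qh η s) y / qh y s)
        (qh y t ^ 2 - (qh y t)⁻¹) (Set.Ici 0) t :=
    fun y t ht => ShortWave.tzitzeica hM hreg hq_pos hstruct y ht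
  have h0 := ShortWave.initial_value hu₀ hD hM hstruct
  have hflow := ShortWave.tzitzeicaFlow hq2 (ShortWave.regular_q_inv hreg hstruct) hq_pos htz
    hq_lim (ShortWave.exists_initial_bounds hu₀ h0)
  refine ⟨fun y t ht => ⟨(ShortWave.hasDerivAt_partialY (hq2.1.differentiableOn two_ne_zero) y
    ht).differentiableAt, htz y t ht⟩, ⟨ShortWave.xOf qh, fun t ht => ⟨fun y =>
    hflow.hasDerivAt_xOf y ht, ShortWave.TzitzeicaFlow.tendsto_xOf_sub qh t,
    hflow.bijective_xOf ht, fun y => (hflow.hasDerivWithinAt_xOf y ht).differentiableWithinAt⟩,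
    fun u q huq => ?_⟩, fun w p hw => ⟨fun h => h.solvesEquation hw, fun h => h.solvesSystem hw⟩⟩
  have hut : ∀ y t : ℝ, 0 ≤ t → u (ShortWave.xOf qh y t) t = ShortWave.uOf qh _ y t ∧
      q (ShortWave.xOf qh y t) t = qh y t := fun y t ht =>
    ⟨(huq y t ht).1.trans ((hflow.hasDerivWithinAt_xOf y ht).derivWithin
      (uniqueDiffOn_Ici (0 : ℝ) t ht)), (huq y t ht).2⟩
  -- For t > 0 the half-plane is a neighbourhood of the point, so one-sided differentiability
  -- becomes full differentiability.
  have hd : ∀ y t : ℝ, 0 < t → DifferentiableAt ℝ (fun p : ℝ × ℝ => qh p.1 p.2) (y, t) :=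
    fun y t ht => (hq2.1.differentiableOn two_ne_zero (y, t) ht.le).differentiableAt
      (Filter.mem_of_superset ((isOpen_lt continuous_const continuous_snd).mem_nhds ht)
        fun p (hp : 0 < p.2) => hp.le)
  obtain ⟨hs, hqp⟩ := hflow.solvesSystem hd hut
  refine ⟨hs, hs.solvesEquation fun ξ t ht => ⟨hqp ξ t ht, ?_⟩, fun ξ => ?_⟩
  · rw [iteratedDeriv_succ, iteratedDeriv_one]
    exact (hs ξ t ht).2.2.2.deriv
  · obtain ⟨h1, h2⟩ := hflow.initial_u hu₀ h0 ξ
    rw [← h2, ← (hut _ 0 le_rfl).1, h1]
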